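/- Let $p\in L_\infty[0,1]$ be real and uniformly positive, let $q,r\in W_2^{-1}[0,1]$ be real (i.e. bounded linear functionals $f\mapsto\int_0^1 qf\,dx$, $f\mapsto\int_0^1 rf\,dx$ on the complex Sobolev space $W_2^1[0,1]$, real-valued on real functions), and let $U$ be a diagonal unitary complex $2\times2$ matrix. For $y\in W_2^1[0,1]$ put $y^\wedge=(y(0),y(1))^{\mathsf T}$, let $$\mathfrak H_U=\{y\in W_2^1[0,1]\mid y^\wedge\in\operatorname{im}(U-1)\}$$ with the norm $\|y\|^2=\int_0^1(|y'|^2+|y|^2)\,dx$, let $\mathfrak H_U'$ be the completion of $L_2[0,1]$ in the norm $\|I^*y\|_{\mathfrak H_U}$, where $I:\mathfrak H_U\to L_2[0,1]$ is the embedding (so $\mathfrak H'_U$ is the antidual of $\mathfrak H_U$), and let $I^+:\mathfrak H_U'\to\mathfrak H_U$ be the isometry extending $I^*$. Let $T(\lambda):\mathfrak H_U\to\mathfrak H_U'$, $\lambda\in\mathbb C$, be the operator pencil associated with the problem $-(py')'+(q-\lambda r)y=0$, $(U-1)y^\vee+i(U+1)y^\wedge=0$, where $y^\vee=(y^{[1]}(0),-y^{[1]}(1))^{\mathsf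 T}$ is formed from the quasi-derivative $y^{[1]}$; it is defined by $$\langle I^+T(\lambda)y,y\rangle_{\mathfrak H_U}=\int_0^1p|y'|^2\,dx+\int_0^1(q-\lambda r)|y|^2\,dx+\langle Vy^\wedge,y^\wedge\rangle_{\mathbb C^2},$$ where $V$ is diagonal with $V_{kk}=-\cot\frac{\arg U_{kk}}2$ if $U_{kk}\ne1$ and $V_{kk}=0$ if $U_{kk}=1$. A number $\lambda$ is an eigenvalue, with eigenfunction $y\in\mathfrak H_U$, $y\neq0$, if $T(\lambda)y=0$. Assume that $I^+T(\xi)$ is positive for some $\xi\in\mathbb R$, i.e. $\langle I^+T(\xi)y,y\rangle>0$ for all $0\ne y\in\mathfrak H_U$. Then the eigenvalues are all real, different from $\xi$, and only finitely many of them lie between $\xi$ and any given eigenvalue, so that they can be numbered as two (possibly finite or empty) sequences $$\ldots<\lambda_{-2}<\lambda_{-1}<\xi<\lambda_1<\lambda_2<\ldots,$$ and for every $n\ge1$ for which $\lambda_n$ exists, each real-valued eigenfunction $y_n$ for $\lambda_n$ has exactly $n-1$ zeros in $(0,1)$ and changes sign at each of them. Likewise, for every $n\ge1$ for which $\lambda_{-n}$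 exists, each real-valued eigenfunction for $\lambda_{-n}$ has exactly $n-1$ zeros in $(0,1)$ and changes sign at each of them. -/

import Mathlib

open MeasureTheory Set
open scoped ComplexConjugate ENNReal

noncomputable section

namespace SturmLiouville

/-- Lebesgue measure on `[0,1]`. -/
def vol01 : Measure ℝ := volume.restrict (Icc 0 1)

instance : IsProbabilityMeasure vol01 := ⟨by simp [vol01]⟩

instance : NullSingletonClass vol01 := by unfold vol01; infer_instance

/-- The complex space `L₂[0,1]`. -/
abbrev L2 : Type := Lp ℂ 2 vol01

/-- The complex Sobolev space `W₂¹[0,1]`: an absolutely continuous function with derivative in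
`L₂[0,1]` is recorded by its value at `0` and its derivative. -/
def W12 : Type := ℂ × L2

namespace W12

instance : AddCommGroup W12 := inferInstanceAs (AddCommGroup (ℂ × L2))
instance : Module ℂ W12 := inferInstanceAs (Module ℂ (ℂ × L2))

/-- The derivative `y'`. -/
def deriv : W12 →ₗ[ℂ] L2 := LinearMap.snd ℂ ℂ L2

/-- The value `y(0)`. -/
def init : W12 →ₗ[ℂ] ℂ := LinearMap.fst ℂ ℂ L2

/-- The element with prescribed value at `0` and prescribed derivative. -/
def mk (c : ℂ) (g : L2) : W12 := (c, g)

@[simp] lemma deriv_mk (c : ℂ) (g : L2) : (mk c g).deriv = g := rfl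
@[simp] lemma init_mk (c : ℂ) (g : L2) : (mk c g).init = c := rfl

@[ext] lemma ext {y z : W12} (h₀ : y.init = z.init) (h₁ : y.deriv = z.deriv) : y = z :=
  Prod.ext h₀ h₁

/-- The function on `[0,1]`: `y(t) = y(0) + ∫₀ᵗ y'`. It is only used for `t ∈ [0,1]`
(outside `[0,1]` it is constant, since the measure is carried by `[0,1]`). -/
def toFun (y : W12) (t : ℝ) : ℂ := y.init + ∫ s in (0 : ℝ)..t, y.deriv s ∂vol01

instance : CoeFun W12 (fun _ => ℝ → ℂ) := ⟨toFun⟩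

lemma integrable_L2 (g : L2) : Integrable g vol01 :=
  (Lp.memLp g).integrable (by norm_num)

lemma intervalIntegrable_L2 (g : L2) (a b : ℝ) : IntervalIntegrable g vol01 a b :=
  (integrable_L2 g).intervalIntegrable

/-- On `[0,1]` this is the usual formula with Lebesgue measure. -/
lemma toFun_eq (y : W12) {t : ℝ} (ht : t ∈ Icc (0 : ℝ) 1) :
    y t = y.init + ∫ s in (0 : ℝ)..t, y.deriv s := by
  have : vol01.restrict (Ioc 0 t) = volume.restrict (Ioc 0 t) := by
    have hsub : Ioc 0 t ⊆ Icc (0 : ℝ) 1 := fun s hs => ⟨hs.1.le, hs.2.trans ht.2⟩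
    rw [vol01, Measure.restrict_restrict measurableSet_Ioc, inter_eq_left.2 hsub]
  simp only [toFun, intervalIntegral.integral_of_le ht.1, this]

lemma toFun_zero (y : W12) : y 0 = y.init := by simp [toFun]

lemma continuous_toFun (y : W12) : Continuous y.toFun :=
  continuous_const.add (intervalIntegral.continuous_primitive (intervalIntegrable_L2 _) 0)

lemma add_toFun (y z : W12) (t : ℝ) : (y + z) t = y t + z t := by
  have h : ∫ s in (0 : ℝ)..t, (y.deriv + z.deriv : L2) s ∂vol01 =
      (∫ s in (0 : ℝ)..t, y.deriv s ∂vol01) + ∫ s in (0 : ℝ)..t, z.deriv s ∂vol01 := by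
    rw [← intervalIntegral.integral_add (intervalIntegrable_L2 _ _ _)
      (intervalIntegrable_L2 _ _ _)]
    refine intervalIntegral.integral_congr_ae ?_
    filter_upwards [Lp.coeFn_add y.deriv z.deriv] with s hs _ using hs
  simp only [toFun, map_add, h]; ring

lemma smul_toFun (c : ℂ) (y : W12) (t : ℝ) : (c • y) t = c * y t := by
  have h : ∫ s in (0 : ℝ)..t, (c • y.deriv : L2) s ∂vol01 =
      c * ∫ s in (0 : ℝ)..t, y.deriv s ∂vol01 := by
    rw [← intervalIntegral.integral_const_mul]
    refine intervalIntegral.integral_congr_ae ?_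
    filter_upwards [Lp.coeFn_smul c y.deriv] with s hs _ using hs
  simp only [toFun, map_smul, h, smul_eq_mul]; ring

lemma norm_integral_le (g : L2) (t : ℝ) : ‖∫ s in (0 : ℝ)..t, g s ∂vol01‖ ≤ ‖g‖ := by
  calc ‖∫ s in (0 : ℝ)..t, g s ∂vol01‖ ≤ ∫ s in Set.uIoc 0 t, ‖g s‖ ∂vol01 :=
        intervalIntegral.norm_integral_le_integral_norm_uIoc
    _ ≤ ∫ s, ‖g s‖ ∂vol01 := setIntegral_le_integral (integrable_L2 g).norm
        (Filter.Eventually.of_forall fun _ => norm_nonneg _)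
    _ = (eLpNorm g 1 vol01).toReal := by
        rw [integral_norm_eq_lintegral_enorm (integrable_L2 g).1, eLpNorm_one_eq_lintegral_enorm]
    _ ≤ (eLpNorm g 2 vol01).toReal := ENNReal.toReal_mono (Lp.eLpNorm_ne_top g)
        (eLpNorm_le_eLpNorm_of_exponent_le (by norm_num) (Lp.aestronglyMeasurable g))
    _ = ‖g‖ := (Lp.norm_def g).symm

lemma norm_toFun_le' (y : W12) (t : ℝ) : ‖y t‖ ≤ ‖y.init‖ + ‖y.deriv‖ :=
  (norm_add_le _ _).trans (by gcongr; exact norm_integral_le _ _)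

lemma memLp_toFun (y : W12) : MemLp y.toFun 2 vol01 :=
  MemLp.of_bound y.continuous_toFun.aestronglyMeasurable (‖y.init‖ + ‖y.deriv‖)
    (Filter.Eventually.of_forall y.norm_toFun_le')

/-- The embedding `I : W₂¹[0,1] → L₂[0,1]`. -/
def toL2 : W12 →ₗ[ℂ] L2 where
  toFun y := y.memLp_toFun.toLp y.toFun
  map_add' y z := by
    rw [← MemLp.toLp_add]
    exact MemLp.toLp_congr _ _ (Filter.Eventually.of_forall (add_toFun y z))
  map_smul' c y := by
    simp only [RingHom.id_apply]
    rw [← MemLp.toLp_const_smul]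
    exact MemLp.toLp_congr _ _ (Filter.Eventually.of_forall (smul_toFun c y))

lemma coeFn_toL2 (y : W12) : y.toL2 =ᵐ[vol01] y.toFun := y.memLp_toFun.coeFn_toLp

lemma norm_toL2_le (y : W12) : ‖y.toL2‖ ≤ ‖y.init‖ + ‖y.deriv‖ := by
  have h := Lp.norm_le_of_ae_bound (f := y.toL2) (C := ‖y.init‖ + ‖y.deriv‖) (by positivity)
    (by filter_upwards [y.coeFn_toL2] with t ht using ht ▸ y.norm_toFun_le' t)
  simpa [measureUnivNNReal] using h

lemma norm_init_le (y : W12) : ‖y.init‖ ≤ ‖y.toL2‖ + ‖y.deriv‖ := by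
  have e : y.toL2 = (mk y.init 0).toL2 + (mk 0 y.deriv).toL2 := by
    rw [← map_add]; congr 1; ext1 <;> simp
  have h : ‖(mk y.init 0).toL2‖ = ‖y.init‖ := by
    have : (mk y.init 0).toL2 = Lp.const 2 vol01 y.init := by
      apply Lp.ext
      filter_upwards [coeFn_toL2 (mk y.init 0), Lp.coeFn_const (p := 2) (μ := vol01) y.init]
        with t h1 h2
      rw [h1, h2]
      have : ∫ s in (0 : ℝ)..t, (0 : L2) s ∂vol01 = 0 := by
        rw [intervalIntegral.integral_congr_ae (g := fun _ => 0)]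
        · simp
        · filter_upwards [Lp.coeFn_zero ℂ 2 vol01] with s hs _ using hs
      simp only [toFun, init_mk, deriv_mk, this, add_zero, Function.const_apply]
    rw [this, Lp.norm_const' 2 vol01 y.init two_ne_zero ENNReal.ofNat_ne_top]; simp
  have h2 := norm_toL2_le (mk 0 y.deriv)
  simp only [init_mk, norm_zero, deriv_mk, zero_add] at h2
  calc ‖y.init‖ = ‖y.toL2 - (mk 0 y.deriv).toL2‖ := by rw [e]; simp [h]
    _ ≤ _ := (norm_sub_le _ _).trans (by gcongr)

/-- The inner product `⟨y, z⟩ = ∫₀¹ (conj y' · z' + conj y · z)` (linear in the second argument). -/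
@[reducible] def core : InnerProductSpace.Core ℂ W12 where
  inner y z := inner ℂ y.deriv z.deriv + inner ℂ y.toL2 z.toL2
  conj_inner_symm y z := by simp only [map_add, inner_conj_symm]
  re_inner_nonneg y := by
    rw [map_add]
    exact add_nonneg inner_self_nonneg inner_self_nonneg
  add_left x y z := by simp only [map_add, inner_add_left]; ring
  smul_left x y c := by simp only [map_smul, inner_smul_left]; ring
  definite y h := by
    have h' : ‖y.deriv‖ ^ 2 + ‖y.toL2‖ ^ 2 = 0 := by
      rw [inner_self_eq_norm_sq_to_K, inner_self_eq_norm_sq_to_K] at h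
      have h'' : ((‖y.deriv‖ ^ 2 + ‖y.toL2‖ ^ 2 : ℝ) : ℂ) = 0 := by push_cast; exact h
      exact_mod_cast h''
    have h1 : ‖y.deriv‖ = 0 := by nlinarith [sq_nonneg ‖y.deriv‖, sq_nonneg ‖y.toL2‖]
    have h2 : ‖y.toL2‖ = 0 := by nlinarith [sq_nonneg ‖y.deriv‖, sq_nonneg ‖y.toL2‖]
    have h3 := y.norm_init_le
    rw [h1, h2, add_zero] at h3
    ext1
    · simpa using h3
    · simpa using h1

instance : NormedAddCommGroup W12 := core.toNormedAddCommGroup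
instance : InnerProductSpace ℂ W12 := InnerProductSpace.ofCore core.toCore

lemma inner_def (y z : W12) : inner ℂ y z = inner ℂ y.deriv z.deriv + inner ℂ y.toL2 z.toL2 := rfl

lemma inner_eq_integral (y z : W12) : inner ℂ y z =
    ∫ t, (conj (y.deriv t) * z.deriv t + conj (y t) * z t) ∂vol01 := by
  rw [inner_def, L2.inner_def, L2.inner_def, ← integral_add (L2.integrable_inner _ _)
    (L2.integrable_inner _ _)]
  refine integral_congr_ae ?_
  filter_upwards [y.coeFn_toL2, z.coeFn_toL2] with t h1 h2
  rw [h1, h2]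
  simp [mul_comm]

lemma norm_sq (y : W12) : ‖y‖ ^ 2 = ‖y.deriv‖ ^ 2 + ‖y.toL2‖ ^ 2 := by
  rw [norm_sq_eq_re_inner (𝕜 := ℂ), inner_def, map_add, ← norm_sq_eq_re_inner,
    ← norm_sq_eq_re_inner]

lemma norm_deriv_le (y : W12) : ‖y.deriv‖ ≤ ‖y‖ :=
  le_of_sq_le_sq (by rw [norm_sq]; nlinarith [sq_nonneg ‖y.toL2‖]) (norm_nonneg _)

lemma norm_toL2_le_norm (y : W12) : ‖y.toL2‖ ≤ ‖y‖ :=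
  le_of_sq_le_sq (by rw [norm_sq]; nlinarith [sq_nonneg ‖y.deriv‖]) (norm_nonneg _)

lemma norm_init_le_norm (y : W12) : ‖y.init‖ ≤ 2 * ‖y‖ := by
  linarith [y.norm_init_le, y.norm_deriv_le, y.norm_toL2_le_norm]

lemma norm_toFun_le (y : W12) (t : ℝ) : ‖y t‖ ≤ 3 * ‖y‖ := by
  linarith [y.norm_toFun_le' t, y.norm_init_le_norm, y.norm_deriv_le]

lemma norm_le (y : W12) : ‖y‖ ≤ ‖y.init‖ + 2 * ‖y.deriv‖ := by
  refine le_of_sq_le_sq ?_ (by positivity)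
  rw [norm_sq]
  nlinarith [y.norm_toL2_le, norm_nonneg y.toL2, norm_nonneg y.deriv, norm_nonneg y.init]

/-- `W₂¹[0,1]` is complete. -/
instance : CompleteSpace W12 := by
  let e : W12 ≃ₗ[ℂ] ℂ × L2 := LinearEquiv.refl ℂ (ℂ × L2)
  have he : ∀ y : W12, e y = (y.init, y.deriv) := fun _ => rfl
  let E : W12 ≃L[ℂ] ℂ × L2 := e.toContinuousLinearEquivOfBounds 2 3
    (fun y => by
      rw [he, Prod.norm_mk]
      refine max_le y.norm_init_le_norm ?_
      linarith [y.norm_deriv_le, norm_nonneg y])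
    (fun x => by
      have h := norm_le (e.symm x)
      have h1 : ‖(e.symm x).init‖ ≤ ‖x‖ := norm_fst_le x
      have h2 : ‖(e.symm x).deriv‖ ≤ ‖x‖ := norm_snd_le x
      linarith)
  exact (completeSpace_congr (e := E.toEquiv) E.isUniformEmbedding).2 inferInstance

/-- Evaluation at a point, as a bounded functional. -/
def eval (t : ℝ) : W12 →L[ℂ] ℂ :=
  LinearMap.mkContinuous
    { toFun := fun y => y t
      map_add' := fun y z => add_toFun y z t
      map_smul' := fun c y => smul_toFun c y t } 3 (fun y => y.norm_toFun_le t)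

@[simp] lemma eval_apply (t : ℝ) (y : W12) : eval t y = y t := rfl

/-- The complex conjugate function. -/
def cconj (y : W12) : W12 := mk (starRingEnd ℂ y.init) (star y.deriv)

lemma cconj_toFun (y : W12) (t : ℝ) : y.cconj t = starRingEnd ℂ (y t) := by
  have h : ∫ s in (0 : ℝ)..t, (star y.deriv : L2) s ∂vol01 =
      starRingEnd ℂ (∫ s in (0 : ℝ)..t, y.deriv s ∂vol01) := by
    simp only [intervalIntegral, map_sub, ← integral_conj]
    have hs := Lp.coeFn_star y.deriv
    congr 1 <;> exact integral_congr_ae (ae_restrict_of_ae hs)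
  simp only [toFun, cconj, init_mk, deriv_mk, h, map_add]

lemma memLp_deriv_mul (y z : W12) : MemLp (fun t => y.deriv t * z t) 2 vol01 := by
  refine (Lp.memLp y.deriv).of_le_mul (c := 3 * ‖z‖)
    ((Lp.aestronglyMeasurable _).mul z.continuous_toFun.aestronglyMeasurable)
    (Filter.Eventually.of_forall fun t => ?_)
  rw [norm_mul, mul_comm]
  gcongr
  exact z.norm_toFun_le t

lemma norm_toLp_deriv_mul_le (y z : W12) :
    ‖(memLp_deriv_mul y z).toLp _‖ ≤ 3 * ‖y‖ * ‖z‖ := by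
  have b : ‖(memLp_deriv_mul y z).toLp _‖ ≤ 3 * ‖z‖ * ‖y.deriv‖ := by
    refine Lp.norm_le_mul_norm_of_ae_le_mul ?_
    filter_upwards [(memLp_deriv_mul y z).coeFn_toLp] with t ht
    rw [ht, norm_mul, mul_comm]
    gcongr
    exact z.norm_toFun_le t
  have c : 3 * ‖z‖ * ‖y.deriv‖ ≤ 3 * ‖z‖ * ‖y‖ := by gcongr; exact y.norm_deriv_le
  linarith

lemma memLp_leibniz (y z : W12) :
    MemLp (fun t => y.deriv t * z t + z.deriv t * y t) 2 vol01 :=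
  (memLp_deriv_mul y z).add (memLp_deriv_mul z y)

/-- The pointwise product of two functions of class `W₂¹[0,1]`
(see `mul_toFun` for the values). -/
def mul (y z : W12) : W12 := mk (y.init * z.init) ((memLp_leibniz y z).toLp _)

lemma coeFn_deriv_mul (y z : W12) :
    (mul y z).deriv =ᵐ[vol01] fun t => y.deriv t * z t + z.deriv t * y t :=
  (memLp_leibniz y z).coeFn_toLp

/-- Product of two primitives. -/
lemma primitive_mul_primitive (f g : L2) {t : ℝ} (ht : 0 ≤ t) :
    (∫ s in (0 : ℝ)..t, f s ∂vol01) * (∫ s in (0 : ℝ)..t, g s ∂vol01) =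
      ∫ s in (0 : ℝ)..t, (f s * (∫ u in (0 : ℝ)..s, g u ∂vol01) +
        (∫ u in (0 : ℝ)..s, f u ∂vol01) * g s) ∂vol01 := by
  set ν : Measure ℝ := vol01.restrict (Ioc 0 t) with hν
  have hf : Integrable f ν := (integrable_L2 f).restrict
  have hg : Integrable g ν := (integrable_L2 g).restrict
  have hprim : ∀ h : L2, Continuous fun s => ∫ u in (0 : ℝ)..s, h u ∂vol01 := fun h =>
    intervalIntegral.continuous_primitive (intervalIntegrable_L2 _) 0
  have hbd : ∀ h : L2, ∀ s, ‖∫ u in (0 : ℝ)..s, h u ∂vol01‖ ≤ ‖h‖ := norm_integral_le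
  have hfg : Integrable (fun x : ℝ × ℝ => f x.1 * g x.2) (ν.prod ν) := hf.mul_prod hg
  have hS : MeasurableSet {x : ℝ × ℝ | x.2 ≤ x.1} := measurableSet_le measurable_snd measurable_fst
  have hprimν : ∀ h : L2, ∀ s ∈ Ioc 0 t, ∫ u in Iic s, h u ∂ν = ∫ u in (0 : ℝ)..s, h u ∂vol01 := by
    intro h s hs
    rw [intervalIntegral.integral_of_le hs.1.le, hν, Measure.restrict_restrict measurableSet_Iic]
    congr 2
    ext u; simp only [mem_inter_iff, mem_Iic, mem_Ioc]
    exact ⟨fun H => ⟨H.2.1, H.1⟩, fun H => ⟨H.2, H.1, H.2.trans hs.2⟩⟩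
  have hprimν' : ∀ h : L2, ∀ s ∈ Ioc 0 t, ∫ u in Iio s, h u ∂ν = ∫ u in (0 : ℝ)..s, h u ∂vol01 := by
    intro h s hs
    rw [← hprimν h s hs]
    have : NullSingletonClass ν := by rw [hν]; infer_instance
    exact setIntegral_congr_set Iio_ae_eq_Iic
  have key : (∫ s, f s ∂ν) * (∫ s, g s ∂ν) =
      (∫ x in {x : ℝ × ℝ | x.2 ≤ x.1}, f x.1 * g x.2 ∂(ν.prod ν)) +
      ∫ x in {x : ℝ × ℝ | x.2 ≤ x.1}ᶜ, f x.1 * g x.2 ∂(ν.prod ν) := by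
    rw [integral_add_compl hS hfg, integral_prod_mul]
  have h1 : ∫ x in {x : ℝ × ℝ | x.2 ≤ x.1}, f x.1 * g x.2 ∂(ν.prod ν) =
      ∫ s, f s * (∫ u in (0 : ℝ)..s, g u ∂vol01) ∂ν := by
    rw [← integral_indicator hS, integral_prod _ (hfg.indicator hS)]
    refine setIntegral_congr_fun measurableSet_Ioc fun s hs => ?_
    rw [← hprimν g s hs, ← integral_const_mul, ← integral_indicator measurableSet_Iic]
    rfl
  have h2 : ∫ x in {x : ℝ × ℝ | x.2 ≤ x.1}ᶜ, f x.1 * g x.2 ∂(ν.prod ν) =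
      ∫ s, (∫ u in (0 : ℝ)..s, f u ∂vol01) * g s ∂ν := by
    rw [← integral_indicator hS.compl, integral_prod_symm _ (hfg.indicator hS.compl)]
    refine setIntegral_congr_fun measurableSet_Ioc fun s hs => ?_
    rw [← hprimν' f s hs, ← integral_mul_const, ← integral_indicator measurableSet_Iio]
    refine integral_congr_ae (Filter.Eventually.of_forall fun u => ?_)
    simp [Set.indicator_apply]
  rw [intervalIntegral.integral_of_le ht, intervalIntegral.integral_of_le ht,
    intervalIntegral.integral_of_le ht, key, h1, h2, integral_add]
  · exact hf.mul_bdd (c := ‖g‖) (hprim g).aestronglyMeasurable (Filter.Eventually.of_forall (hbd g))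
  · exact hg.bdd_mul (c := ‖f‖) (hprim f).aestronglyMeasurable (Filter.Eventually.of_forall (hbd f))

lemma mul_toFun (y z : W12) {t : ℝ} (ht : 0 ≤ t) : (mul y z) t = y t * z t := by
  have h1 : ∫ s in (0 : ℝ)..t, (mul y z).deriv s ∂vol01 =
      ∫ s in (0 : ℝ)..t, (z.init * y.deriv s + y.init * z.deriv s +
        (y.deriv s * (∫ u in (0 : ℝ)..s, z.deriv u ∂vol01) +
        (∫ u in (0 : ℝ)..s, y.deriv u ∂vol01) * z.deriv s)) ∂vol01 := by
    refine intervalIntegral.integral_congr_ae ?_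
    filter_upwards [coeFn_deriv_mul y z] with s hs _
    rw [hs]; simp only [toFun]; ring
  have hprim : ∀ h : L2, Continuous fun s => ∫ u in (0 : ℝ)..s, h u ∂vol01 := fun h =>
    intervalIntegral.continuous_primitive (intervalIntegrable_L2 _) 0
  have iy := intervalIntegrable_L2 y.deriv 0 t
  have iz := intervalIntegrable_L2 z.deriv 0 t
  have h2 : ∫ s in (0 : ℝ)..t, (mul y z).deriv s ∂vol01 =
      z.init * (∫ s in (0 : ℝ)..t, y.deriv s ∂vol01) +
      y.init * (∫ s in (0 : ℝ)..t, z.deriv s ∂vol01) +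
      (∫ s in (0 : ℝ)..t, y.deriv s ∂vol01) * (∫ s in (0 : ℝ)..t, z.deriv s ∂vol01) := by
    rw [h1, intervalIntegral.integral_add ((iy.const_mul _).add (iz.const_mul _))
      ((iy.mul_continuousOn (hprim _).continuousOn).add
        (iz.continuousOn_mul (hprim _).continuousOn)),
      intervalIntegral.integral_add (iy.const_mul _) (iz.const_mul _),
      intervalIntegral.integral_const_mul, intervalIntegral.integral_const_mul,
      primitive_mul_primitive _ _ ht]
  have h0 : (mul y z).init = y.init * z.init := rfl
  rw [toFun, h2, h0, toFun, toFun]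
  ring

lemma mul_add' (x y z : W12) : mul x (y + z) = mul x y + mul x z := by
  ext1
  · simp [mul, mul_add]
  · rw [map_add]
    apply Lp.ext
    filter_upwards [coeFn_deriv_mul x (y + z), coeFn_deriv_mul x y, coeFn_deriv_mul x z,
      Lp.coeFn_add (mul x y).deriv (mul x z).deriv, Lp.coeFn_add y.deriv z.deriv]
      with t h1 h2 h3 h4 h5
    rw [h1, h4, Pi.add_apply, h2, h3, add_toFun, map_add, h5, Pi.add_apply]
    ring

lemma mul_comm' (x y : W12) : mul x y = mul y x := by
  ext1
  · simp [mul, mul_comm]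
  · apply Lp.ext
    filter_upwards [coeFn_deriv_mul x y, coeFn_deriv_mul y x] with t h1 h2
    rw [h1, h2]; ring

lemma add_mul' (x y z : W12) : mul (x + y) z = mul x z + mul y z := by
  rw [mul_comm', mul_add', mul_comm' z, mul_comm' z]

lemma mul_smul' (c : ℂ) (x y : W12) : mul x (c • y) = c • mul x y := by
  ext1
  · simp only [mul, map_smul, init_mk, smul_eq_mul]; ring
  · rw [map_smul]
    apply Lp.ext
    filter_upwards [coeFn_deriv_mul x (c • y), coeFn_deriv_mul x y,
      Lp.coeFn_smul c (mul x y).deriv, Lp.coeFn_smul c y.deriv] with t h1 h2 h3 h4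
    rw [h1, h3, Pi.smul_apply, h2, smul_toFun, map_smul, h4, Pi.smul_apply]
    simp only [smul_eq_mul]; ring

lemma smul_mul' (c : ℂ) (x y : W12) : mul (c • x) y = c • mul x y := by
  rw [mul_comm', mul_smul', mul_comm']

lemma cconj_add (y z : W12) : (y + z).cconj = y.cconj + z.cconj := by
  ext1
  · simp [cconj]
  · simp only [cconj, deriv_mk, map_add]
    apply Lp.ext
    filter_upwards [Lp.coeFn_star (y.deriv + z.deriv), Lp.coeFn_star y.deriv,
      Lp.coeFn_star z.deriv, Lp.coeFn_add (star y.deriv) (star z.deriv),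
      Lp.coeFn_add y.deriv z.deriv] with t h1 h2 h3 h4 h5
    rw [h1, h4, Pi.add_apply, h2, h3, Pi.star_apply, h5]
    simp

lemma cconj_smul (c : ℂ) (y : W12) : (c • y).cconj = conj c • y.cconj := by
  ext1
  · simp [cconj]
  · simp only [cconj, deriv_mk, map_smul]
    apply Lp.ext
    filter_upwards [Lp.coeFn_star (c • y.deriv), Lp.coeFn_star y.deriv,
      Lp.coeFn_smul (conj c) (star y.deriv), Lp.coeFn_smul c y.deriv] with t h1 h2 h3 h4
    rw [h1, h3, Pi.smul_apply, h2, Pi.star_apply, h4]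
    simp

lemma norm_deriv_cconj (y : W12) : ‖y.cconj.deriv‖ = ‖y.deriv‖ := by
  rw [Lp.norm_def, Lp.norm_def]
  congr 1
  refine eLpNorm_congr_norm_ae ?_
  filter_upwards [Lp.coeFn_star y.deriv] with t h1
  simp only [cconj, deriv_mk]
  rw [h1]; simp

lemma norm_cconj_le (y : W12) : ‖y.cconj‖ ≤ 4 * ‖y‖ := by
  have h := norm_le y.cconj
  have h0 : ‖y.cconj.init‖ = ‖y.init‖ := by simp [cconj]
  rw [norm_deriv_cconj, h0] at h
  linarith [y.norm_init_le_norm, y.norm_deriv_le]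

lemma norm_deriv_mul_le (y z : W12) : ‖(mul y z).deriv‖ ≤ 6 * ‖y‖ * ‖z‖ := by
  have e : (mul y z).deriv = (memLp_deriv_mul y z).toLp _ + (memLp_deriv_mul z y).toLp _ := by
    rw [← MemLp.toLp_add]; rfl
  rw [e]
  refine (norm_add_le _ _).trans ?_
  linarith [norm_toLp_deriv_mul_le y z, norm_toLp_deriv_mul_le z y]

lemma norm_mul_le' (y z : W12) : ‖mul y z‖ ≤ 16 * ‖y‖ * ‖z‖ := by
  have h := norm_le (mul y z)
  have h0 : ‖(mul y z).init‖ ≤ (2 * ‖y‖) * (2 * ‖z‖) := by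
    simp only [mul, init_mk, norm_mul]
    gcongr
    · exact y.norm_init_le_norm
    · exact z.norm_init_le_norm
  nlinarith [norm_deriv_mul_le y z]

end W12

/-- The antidual space of `H`: bounded conjugate-linear functionals. -/
abbrev AntiDual (H : Type*) [NormedAddCommGroup H] [InnerProductSpace ℂ H] : Type _ := H →L⋆[ℂ] ℂ

/-- The Riesz isometry of the antidual of a Hilbert space onto the space itself:
`⟨z, Iplus f⟩ = f z`, see `inner_Iplus`. -/
def Iplus (H : Type*) [NormedAddCommGroup H] [InnerProductSpace ℂ H] [CompleteSpace H] :
    AntiDual H ≃ₗᵢ[ℂ] H :=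
  (LinearIsometryEquiv.ofSurjective
    (⟨(innerSLFlip ℂ : H →L[ℂ] H →L⋆[ℂ] ℂ).toLinearMap, fun u => by
      refine le_antisymm ?_ ?_
      · refine ContinuousLinearMap.opNorm_le_bound _ (norm_nonneg _) fun z => ?_
        simpa [mul_comm] using norm_inner_le_norm z u
      · rcases eq_or_ne u 0 with rfl | hu
        · simp
        · have h := ContinuousLinearMap.le_opNorm (innerSLFlip ℂ u : H →L⋆[ℂ] ℂ) u
          rw [innerSLFlip_apply_apply, inner_self_eq_norm_sq_to_K] at h
          have h' : ‖u‖ * ‖u‖ ≤ ‖(innerSLFlip ℂ u : H →L⋆[ℂ] ℂ)‖ * ‖u‖ := by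
            simpa [pow_two] using h
          exact le_of_mul_le_mul_right h' (norm_pos_iff.2 hu)⟩ : H →ₗᵢ[ℂ] AntiDual H)
    (fun f => by
      refine ⟨(InnerProductSpace.toDual ℂ H).symm
        (((starL ℂ : ℂ ≃L⋆[ℂ] ℂ) : ℂ →L⋆[ℂ] ℂ).comp f), ?_⟩
      ext z
      change inner ℂ z _ = _
      rw [← inner_conj_symm, InnerProductSpace.toDual_symm_apply]
      simp)).symm

lemma inner_Iplus {H : Type*} [NormedAddCommGroup H] [InnerProductSpace ℂ H] [CompleteSpace H]
    (f : AntiDual H) (z : H) : inner ℂ z (Iplus H f) = f z := by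
  obtain ⟨u, rfl⟩ := (Iplus H).symm.surjective f
  rw [LinearIsometryEquiv.apply_symm_apply]
  rfl

/-- The data of the boundary value problem: `p ∈ L_∞[0,1]` uniformly positive, two real elements
`q`, `r` of `W₂⁻¹[0,1]` (bounded functionals on `W₂¹[0,1]`; `q f` is the pairing `∫₀¹ q f dx`,
and `q` is real when it takes real values on real functions), and a diagonal unitary
`2 × 2` matrix `U`. -/
structure Problem where
  p : ℝ → ℝ
  p_memLp : MemLp p ∞ vol01
  p_pos : ∃ c > 0, ∀ᵐ t ∂vol01, c ≤ p t
  q : W12 →L[ℂ] ℂ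
  q_real : ∀ f : W12, (∀ t ∈ Icc (0 : ℝ) 1, (f t).im = 0) → (q f).im = 0
  r : W12 →L[ℂ] ℂ
  r_real : ∀ f : W12, (∀ t ∈ Icc (0 : ℝ) 1, (f t).im = 0) → (r f).im = 0
  U : Matrix (Fin 2) (Fin 2) ℂ
  U_unitary : U ∈ Matrix.unitaryGroup (Fin 2) ℂ
  U_diag : U.IsDiag

/-- The vector of boundary values `(y(0), y(1))`. -/
def trace : W12 →L[ℂ] (Fin 2 → ℂ) :=
  ContinuousLinearMap.pi ![W12.eval 0, W12.eval 1]

namespace Problem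

/-- The space `{y ∈ W₂¹[0,1] : (y(0), y(1)) ∈ im (U - 1)}` with the norm of `W₂¹[0,1]`. -/
def HU (D : Problem) : Submodule ℂ W12 :=
  (LinearMap.range (D.U - 1).mulVecLin).comap trace.toLinearMap

instance (D : Problem) : CompleteSpace D.HU := by
  have h : IsClosed (D.HU : Set W12) :=
    (Submodule.closed_of_finiteDimensional
      (LinearMap.range (D.U - 1).mulVecLin)).preimage trace.continuous
  exact h.completeSpace_coe

/-- The diagonal entries of the matrix `V`. -/
def V (D : Problem) (k : Fin 2) : ℝ :=
  if D.U k k = 1 then 0 else -Real.cot (Complex.arg (D.U k k) / 2)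

/-- The sesquilinear form of the pencil:
`∫₀¹ p y' conj(z') dx + ∫₀¹ (q - lam r) y conj(z) dx + ⟨V y^, z^⟩`. -/
def form (D : Problem) (lam : ℂ) (y z : W12) : ℂ :=
  (∫ t, (D.p t : ℂ) * y.deriv t * conj (z.deriv t) ∂vol01)
    + (D.q - lam • D.r) (W12.mul y z.cconj)
    + ∑ k, (D.V k : ℂ) * trace y k * conj (trace z k)

lemma exists_bound_p (D : Problem) : ∃ M : ℝ, 0 ≤ M ∧ ∀ᵐ t ∂vol01, ‖(D.p t : ℂ)‖ ≤ M := by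
  refine ⟨(eLpNorm D.p ∞ vol01).toReal, ENNReal.toReal_nonneg, ?_⟩
  have h : ∀ᵐ t ∂vol01, ‖D.p t‖ₑ ≤ eLpNorm D.p ∞ vol01 := by
    simpa only [eLpNorm_exponent_top] using enorm_ae_le_eLpNormEssSup D.p vol01
  filter_upwards [h] with t ht
  have := ENNReal.toReal_mono D.p_memLp.2.ne ht
  simpa using this

lemma integrable_form (D : Problem) (f g : L2) :
    Integrable (fun t => (D.p t : ℂ) * f t * conj (g t)) vol01 := by
  obtain ⟨M, -, hM⟩ := D.exists_bound_p
  have h : Integrable (fun t => f t * conj (g t)) vol01 := by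
    simpa using L2.integrable_inner (𝕜 := ℂ) g f
  have h2 := h.bdd_mul (c := M)
    (Complex.continuous_ofReal.comp_aestronglyMeasurable D.p_memLp.1) hM
  simpa [mul_assoc] using h2

lemma norm_integral_form_le (D : Problem) : ∃ M : ℝ, 0 ≤ M ∧ ∀ y z : W12,
    ‖∫ t, (D.p t : ℂ) * y.deriv t * conj (z.deriv t) ∂vol01‖ ≤ M * ‖y‖ * ‖z‖ := by
  obtain ⟨M, hM0, hM⟩ := D.exists_bound_p
  refine ⟨M, hM0, fun y z => ?_⟩
  have hmem : MemLp (fun t => (D.p t : ℂ) * y.deriv t) 2 vol01 := by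
    refine (Lp.memLp y.deriv).of_le_mul (c := M)
      ((Complex.continuous_ofReal.comp_aestronglyMeasurable D.p_memLp.1).mul
        (Lp.aestronglyMeasurable _)) ?_
    filter_upwards [hM] with t ht
    rw [norm_mul]; gcongr
  have h1 : ‖hmem.toLp _‖ ≤ M * ‖y.deriv‖ := by
    refine Lp.norm_le_mul_norm_of_ae_le_mul ?_
    filter_upwards [hM, hmem.coeFn_toLp] with t ht ht'
    rw [ht', norm_mul]; gcongr
  have h2 : ∫ t, (D.p t : ℂ) * y.deriv t * conj (z.deriv t) ∂vol01 =
      inner ℂ z.deriv (hmem.toLp _) := by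
    rw [L2.inner_def]
    refine integral_congr_ae ?_
    filter_upwards [hmem.coeFn_toLp] with t ht
    rw [ht]; simp
  rw [h2]
  calc _ ≤ ‖z.deriv‖ * ‖hmem.toLp _‖ := norm_inner_le_norm _ _
    _ ≤ ‖z‖ * (M * ‖y‖) := by
      gcongr
      · exact z.norm_deriv_le
      · exact h1.trans (by gcongr; exact y.norm_deriv_le)
    _ = _ := by ring

lemma form_bound (D : Problem) (lam : ℂ) :
    ∃ C : ℝ, ∀ y z : W12, ‖D.form lam y z‖ ≤ C * ‖y‖ * ‖z‖ := by
  obtain ⟨M, -, hM⟩ := D.norm_integral_form_le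
  refine ⟨M + ‖D.q - lam • D.r‖ * 64 + ∑ k, ‖(D.V k : ℂ)‖ * ‖trace‖ * ‖trace‖, fun y z => ?_⟩
  have h2 : ‖(D.q - lam • D.r) (W12.mul y z.cconj)‖ ≤ ‖D.q - lam • D.r‖ * 64 * ‖y‖ * ‖z‖ := by
    refine (ContinuousLinearMap.le_opNorm _ _).trans ?_
    have h : ‖W12.mul y z.cconj‖ ≤ 64 * ‖y‖ * ‖z‖ := by
      refine (W12.norm_mul_le' _ _).trans ?_
      have := mul_le_mul_of_nonneg_left z.norm_cconj_le (norm_nonneg y)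
      linarith
    have := mul_le_mul_of_nonneg_left h (norm_nonneg (D.q - lam • D.r))
    linarith
  have h3 : ‖∑ k, (D.V k : ℂ) * trace y k * conj (trace z k)‖ ≤
      (∑ k, ‖(D.V k : ℂ)‖ * ‖trace‖ * ‖trace‖) * ‖y‖ * ‖z‖ := by
    rw [Finset.sum_mul, Finset.sum_mul]
    refine (norm_sum_le _ _).trans (Finset.sum_le_sum fun k _ => ?_)
    rw [norm_mul, norm_mul, RCLike.norm_conj]
    have a1 : ‖trace y k‖ ≤ ‖trace‖ * ‖y‖ := (norm_le_pi_norm _ k).trans (trace.le_opNorm y)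
    have a2 : ‖trace z k‖ ≤ ‖trace‖ * ‖z‖ := (norm_le_pi_norm _ k).trans (trace.le_opNorm z)
    calc _ ≤ ‖(D.V k : ℂ)‖ * (‖trace‖ * ‖y‖) * (‖trace‖ * ‖z‖) := by gcongr
      _ = _ := by ring
  calc _ ≤ _ := (norm_add_le _ _).trans (add_le_add (norm_add_le _ _) le_rfl)
    _ ≤ _ := add_le_add (add_le_add (hM y z) h2) h3
    _ = _ := by ring

/-- The form as a map which is linear in `y` and conjugate-linear in `z`. -/
def sesqForm (D : Problem) (lam : ℂ) : D.HU →ₗ[ℂ] D.HU →ₗ⋆[ℂ] ℂ :=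
  LinearMap.mk₂'ₛₗ (RingHom.id ℂ) (starRingEnd ℂ) (fun y z => D.form lam y z)
    (fun y y' z => by
      have h : ∫ t, (D.p t : ℂ) * ((y : W12) + y').deriv t * conj ((z : W12).deriv t) ∂vol01 =
          (∫ t, (D.p t : ℂ) * (y : W12).deriv t * conj ((z : W12).deriv t) ∂vol01) +
          ∫ t, (D.p t : ℂ) * (y' : W12).deriv t * conj ((z : W12).deriv t) ∂vol01 := by
        rw [← integral_add (D.integrable_form _ _) (D.integrable_form _ _)]
        refine integral_congr_ae ?_
        filter_upwards [Lp.coeFn_add (y : W12).deriv (y' : W12).deriv] with t ht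
        rw [map_add, ht, Pi.add_apply]; ring
      simp only [form, Submodule.coe_add]
      rw [h]
      simp only [W12.add_mul', map_add, Pi.add_apply, mul_add, add_mul,
        Finset.sum_add_distrib]
      ring)
    (fun c y z => by
      have h : ∫ t, (D.p t : ℂ) * (c • (y : W12)).deriv t * conj ((z : W12).deriv t) ∂vol01 =
          c * (∫ t, (D.p t : ℂ) * (y : W12).deriv t * conj ((z : W12).deriv t) ∂vol01) := by
        rw [← integral_const_mul]
        refine integral_congr_ae ?_
        filter_upwards [Lp.coeFn_smul c (y : W12).deriv] with t ht
        rw [map_smul, ht, Pi.smul_apply, smul_eq_mul]; ring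
      simp only [form, Submodule.coe_smul]
      rw [h]
      simp only [W12.smul_mul', map_smul, Pi.smul_apply, smul_eq_mul,
        RingHom.id_apply, mul_add, Finset.mul_sum]
      congr 1
      exact Finset.sum_congr rfl fun k _ => by ring)
    (fun y z z' => by
      have h : ∫ t, (D.p t : ℂ) * (y : W12).deriv t * conj (((z : W12) + z').deriv t) ∂vol01 =
          (∫ t, (D.p t : ℂ) * (y : W12).deriv t * conj ((z : W12).deriv t) ∂vol01) +
          ∫ t, (D.p t : ℂ) * (y : W12).deriv t * conj ((z' : W12).deriv t) ∂vol01 := by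
        rw [← integral_add (D.integrable_form _ _) (D.integrable_form _ _)]
        refine integral_congr_ae ?_
        filter_upwards [Lp.coeFn_add (z : W12).deriv (z' : W12).deriv] with t ht
        rw [map_add, ht, Pi.add_apply, map_add]; ring
      simp only [form, Submodule.coe_add]
      rw [h]
      simp only [W12.cconj_add, W12.mul_add', map_add, Pi.add_apply,
        mul_add, Finset.sum_add_distrib]
      ring)
    (fun c y z => by
      have h : ∫ t, (D.p t : ℂ) * (y : W12).deriv t * conj ((c • (z : W12)).deriv t) ∂vol01 =
          conj c * (∫ t, (D.p t : ℂ) * (y : W12).deriv t * conj ((z : W12).deriv t) ∂vol01) := by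
        rw [← integral_const_mul]
        refine integral_congr_ae ?_
        filter_upwards [Lp.coeFn_smul c (z : W12).deriv] with t ht
        rw [map_smul, ht, Pi.smul_apply, smul_eq_mul, map_mul]; ring
      simp only [form, Submodule.coe_smul]
      rw [h]
      simp only [W12.cconj_smul, W12.mul_smul', map_smul,
        Pi.smul_apply, smul_eq_mul, map_mul, mul_add, Finset.mul_sum]
      congr 1
      exact Finset.sum_congr rfl fun k _ => by ring)

/-- The operator pencil `T(lam)`, from the space `HU` to its antidual (the space with negative norm
of the pair `HU ⊆ L₂[0,1]`): `T(lam) y` is the functional `z ↦ form lam y z`. -/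
def T (D : Problem) (lam : ℂ) : D.HU →L[ℂ] AntiDual D.HU :=
  LinearMap.mkContinuousOfExistsBound₂ (D.sesqForm lam)
    (by obtain ⟨C, hC⟩ := D.form_bound lam; exact ⟨C, fun y z => hC y z⟩)

lemma T_apply (D : Problem) (lam : ℂ) (y z : D.HU) : D.T lam y z = D.form lam y z := rfl

/-- The bounded operator `I⁺ T(lam)` on the Hilbert space `HU`. -/
def IplusT (D : Problem) (lam : ℂ) : D.HU →L[ℂ] D.HU :=
  ((Iplus D.HU).toContinuousLinearEquiv : AntiDual D.HU →L[ℂ] D.HU).comp (D.T lam)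

lemma inner_IplusT (D : Problem) (lam : ℂ) (y z : D.HU) :
    inner ℂ z (D.IplusT lam y) = D.form lam y z :=
  inner_Iplus (D.T lam y) z

/-- The operator `I⁺ T(ξ)` is positive: its quadratic form is positive on nonzero vectors. -/
def IsPositiveAt (D : Problem) (ξ : ℝ) : Prop :=
  ∀ y : D.HU, y ≠ 0 → 0 < (inner ℂ y (D.IplusT ξ y)).re

/-- `y` is an eigenfunction of the pencil for the eigenvalue `lam`. -/
def IsEigenfunction (D : Problem) (lam : ℂ) (y : D.HU) : Prop := y ≠ 0 ∧ D.T lam y = 0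

/-- `lam` is an eigenvalue of the pencil. -/
def IsEigenvalue (D : Problem) (lam : ℂ) : Prop := ∃ y : D.HU, D.IsEigenfunction lam y

/-- `lam = λ_n`: the `n`-th eigenvalue to the right of `ξ`, in increasing order (`n ≥ 1`). -/
def IsEigenvalueRight (D : Problem) (ξ : ℝ) (n : ℕ) (lam : ℝ) : Prop :=
  ξ < lam ∧ D.IsEigenvalue lam ∧
    {μ : ℝ | ξ < μ ∧ μ ≤ lam ∧ D.IsEigenvalue μ}.encard = n

/-- `lam = λ_{-n}`: the `n`-th eigenvalue to the left of `ξ`, in decreasing order (`n ≥ 1`). -/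
def IsEigenvalueLeft (D : Problem) (ξ : ℝ) (n : ℕ) (lam : ℝ) : Prop :=
  lam < ξ ∧ D.IsEigenvalue lam ∧
    {μ : ℝ | lam ≤ μ ∧ μ < ξ ∧ D.IsEigenvalue μ}.encard = n

end Problem

/-- The real function `f` changes sign at `t`: near `t`, its values on the left of `t` are nonzero
and of the sign opposite to its values on the right of `t`. -/
def ChangesSignAt (f : ℝ → ℝ) (t : ℝ) : Prop :=
  ∃ ε > 0, ∀ s₁ ∈ Ioo (t - ε) t, ∀ s₂ ∈ Ioo t (t + ε), f s₁ * f s₂ < 0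

end SturmLiouville

end

/-! ### Lebesgue measure on the unit interval. -/

noncomputable section

namespace SturmLiouville

open Filter Topology

/-! Write `a_λ(y, z)` for `D.form λ y z`. It is Hermitian for real `λ` and affine in `λ`, with slope
given by the pairing of `r`. Positivity at `ξ` makes every eigenvalue real and different from `ξ`.
If `e` is an eigenfunction for `l > ξ`, then `a_ξ(e, e) > 0 = a_l(e, e)`, so `a_λ(e, e) < 0` for all
`λ > l`. Eigenfunctions for different eigenvalues are orthogonal for every form of the pencil.

Fix a real eigenfunction `f` for `lam > ξ`, and compare the number of its zeros in `(0,1)` with the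
number of eigenvalues from both sides.

Eigenvalues in `(ξ, lam)` are at most as many as zeros (`RealKer.card_le_zeros`). By Jacobi's
factorisation, `a_lam(w, w)` is formally `∫ p |w' - w f'/f|²` when `w` vanishes at the zeros of `f`,
so it is nonnegative there (`RealKer.form_nonneg`). The eigenfunctions for these eigenvalues span a
space where `a_lam` is negative definite, and such a space meets the common kernel of the
evaluations at the zeros only in `0`.

Zeros are fewer than eigenvalues in `(ξ, lam]` (`RealKer.card_zeros_lt`). Cutting `f` off at its
zeros gives one function more than there are zeros. These functions are independent and `a_lam`
vanishes on their span (`RealKer.form_cut`). Were there no more eigenvalues than zeros, a nonzero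
`z` in the span would be `a_ξ`-orthogonal to one eigenfunction of each eigenvalue. Increasing the
parameter from `ξ` until the form degenerates on that orthogonal complement (`exists_critical`,
`exists_inKer`) yields an eigenfunction for some `mu ≤ lam` orthogonal to the chosen ones, contrary
to simplicity.

The distributional coefficients enter through `q - λ r = c δ₀ - σ'` with `σ ∈ L₂`: an eigenfunction
solves a first order system for `f` and `Y = p f' + σ f`. Uniqueness of the Cauchy problem gives `Y
≠ 0` at every zero of a nonzero solution, and an integrating factor shows that `f` then passes
through the zero at least linearly (`IsSol.linear_at_zero`). So the zeros are finitely many and the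
sign changes at each of them. Eigenvalues to the left of `ξ` are handled by replacing `r` with `-r`.
-/

lemma ae_vol01_iff {P : ℝ → Prop} : (∀ᵐ t ∂vol01, P t) ↔ ∀ᵐ t, t ∈ Icc (0 : ℝ) 1 → P t :=
  ae_restrict_iff' measurableSet_Icc

lemma integral_vol01 (f : ℝ → ℝ) : ∫ t, f t ∂vol01 = ∫ t in (0 : ℝ)..1, f t := by
  rw [vol01, integral_Icc_eq_integral_Ioc, intervalIntegral.integral_of_le zero_le_one]

lemma integrable_vol01_iff {f : ℝ → ℝ} :
    Integrable f vol01 ↔ IntervalIntegrable f volume 0 1 := by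
  rw [intervalIntegrable_iff_integrableOn_Icc_of_le zero_le_one, vol01, IntegrableOn]

lemma ae_mem_Ioo_vol01 : ∀ᵐ t ∂vol01, t ∈ Ioo (0 : ℝ) 1 := by
  rw [ae_vol01_iff]
  have h₁ : ∀ᵐ x : ℝ, x ≠ 0 := by simp [ae_iff, measure_singleton]
  have h₂ : ∀ᵐ x : ℝ, x ≠ 1 := by simp [ae_iff, measure_singleton]
  filter_upwards [h₁, h₂] with x h1 h2 hx
  exact ⟨lt_of_le_of_ne hx.1 (Ne.symm h1), lt_of_le_of_ne hx.2 h2⟩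

/-! ### Calculus of absolutely continuous functions. -/

lemma _root_.AbsolutelyContinuousOnInterval.congr_of_eqOn {f f₁ : ℝ → ℝ} {a b : ℝ}
    (hf : AbsolutelyContinuousOnInterval f a b) (h : EqOn f f₁ (uIcc a b)) :
    AbsolutelyContinuousOnInterval f₁ a b := by
  rw [absolutelyContinuousOnInterval_iff] at hf ⊢
  intro ε hε
  obtain ⟨δ, hδ, H⟩ := hf ε hε
  refine ⟨δ, hδ, fun E hE hE' => ?_⟩
  refine lt_of_eq_of_lt (Finset.sum_congr rfl fun i hi => ?_) (H E hE hE')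
  rw [h (hE.1 i hi).1, h (hE.1 i hi).2]

lemma _root_.LipschitzOnWith.comp_absolutelyContinuousOnInterval {f G : ℝ → ℝ} {a b : ℝ}
    {K : NNReal} (hG : LipschitzOnWith K G (f '' uIcc a b))
    (hf : AbsolutelyContinuousOnInterval f a b) :
    AbsolutelyContinuousOnInterval (fun t => G (f t)) a b := by
  rw [absolutelyContinuousOnInterval_iff] at hf ⊢
  intro ε hε
  obtain ⟨δ, hδ, H⟩ := hf (ε / (K + 1)) (by positivity)
  refine ⟨δ, hδ, fun E hE hE' => ?_⟩
  have h1 : ∑ i ∈ Finset.range E.1, dist (G (f (E.2 i).1)) (G (f (E.2 i).2)) ≤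
      K * ∑ i ∈ Finset.range E.1, dist (f (E.2 i).1) (f (E.2 i).2) := by
    rw [Finset.mul_sum]
    refine Finset.sum_le_sum fun i hi => ?_
    exact hG.dist_le_mul _ (mem_image_of_mem _ (hE.1 i hi).1) _ (mem_image_of_mem _ (hE.1 i hi).2)
  have h2 := H E hE hE'
  have h0 : 0 ≤ ∑ i ∈ Finset.range E.1, dist (f (E.2 i).1) (f (E.2 i).2) :=
    Finset.sum_nonneg fun i _ => dist_nonneg
  rw [lt_div_iff₀ (by positivity)] at h2
  nlinarith [K.2]

/-- `f` is absolutely continuous on `[0,1]` with derivative `g` almost everywhere. -/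
structure IsPrim (f g : ℝ → ℝ) : Prop where
  ac : AbsolutelyContinuousOnInterval f 0 1
  hd : ∀ᵐ t ∂vol01, HasDerivAt f (g t) t

namespace IsPrim

variable {f g f₁ g₁ : ℝ → ℝ}

lemma congr (h : IsPrim f g) (hf : ∀ t ∈ Icc (0 : ℝ) 1, f t = f₁ t) (hg : g =ᵐ[vol01] g₁) :
    IsPrim f₁ g₁ := by
  refine ⟨h.ac.congr_of_eqOn (by rwa [uIcc_of_le zero_le_one]), ?_⟩
  filter_upwards [h.hd, hg, ae_mem_Ioo_vol01] with t h1 h2 h3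
  rw [← h2]
  refine h1.congr_of_eventuallyEq ?_
  filter_upwards [Ioo_mem_nhds h3.1 h3.2] with s hs
  exact (hf s ⟨hs.1.le, hs.2.le⟩).symm

lemma ae_unique (h : IsPrim f g) (h₁ : IsPrim f g₁) : g =ᵐ[vol01] g₁ := by
  filter_upwards [h.hd, h₁.hd] with t h1 h2 using h1.unique h2

lemma deriv_ae (h : IsPrim f g) : deriv f =ᵐ[vol01] g := by
  filter_upwards [h.hd] with t h1 using h1.deriv

lemma continuousOn (h : IsPrim f g) : ContinuousOn f (Icc 0 1) := by
  simpa [uIcc_of_le] using h.ac.continuousOn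

lemma integrable (h : IsPrim f g) : Integrable g vol01 :=
  (integrable_vol01_iff.2 h.ac.intervalIntegrable_deriv).congr h.deriv_ae

lemma intervalIntegrable (h : IsPrim f g) {a b : ℝ} (ha : a ∈ Icc (0 : ℝ) 1)
    (hb : b ∈ Icc (0 : ℝ) 1) : IntervalIntegrable g volume a b := by
  refine (integrable_vol01_iff.1 h.integrable).mono_set ?_
  rw [uIcc_of_le zero_le_one]
  exact uIcc_subset_Icc ha hb

lemma integral (h : IsPrim f g) {a b : ℝ} (ha : a ∈ Icc (0 : ℝ) 1) (hb : b ∈ Icc (0 : ℝ) 1) :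
    ∫ t in a..b, g t = f b - f a := by
  have hs : uIcc a b ⊆ uIcc 0 1 := by
    rw [uIcc_of_le zero_le_one]; exact uIcc_subset_Icc ha hb
  rw [← (h.ac.mono hs).integral_deriv_eq_sub]
  refine intervalIntegral.integral_congr_ae ?_
  filter_upwards [ae_vol01_iff.1 h.deriv_ae] with t ht ht'
  rw [ht (uIcc_subset_Icc ha hb (uIoc_subset_uIcc ht'))]

lemma integral01 (h : IsPrim f g) : ∫ t, g t ∂vol01 = f 1 - f 0 := by
  rw [integral_vol01, h.integral (by simp) (by simp)]

lemma primitive (hg : Integrable g vol01) (c : ℝ) {a : ℝ} (ha : a ∈ Icc (0 : ℝ) 1) :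
    IsPrim (fun t => c + ∫ s in a..t, g s) g := by
  have hi := integrable_vol01_iff.1 hg
  have ha' : a ∈ uIcc (0 : ℝ) 1 := by rwa [uIcc_of_le zero_le_one]
  refine ⟨?_, ?_⟩
  · have h1 : AbsolutelyContinuousOnInterval (fun _ : ℝ => c) 0 1 :=
      (LipschitzWith.const c).lipschitzOnWith.absolutelyContinuousOnInterval
    exact h1.fun_add (hi.absolutelyContinuousOnInterval_intervalIntegral ha')
  · rw [ae_vol01_iff]
    filter_upwards [hi.ae_hasDerivAt_integral] with t ht ht'
    rw [uIcc_of_le zero_le_one] at ht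
    exact (ht ht' a ha).const_add c

lemma const (c : ℝ) : IsPrim (fun _ => c) (fun _ => 0) :=
  ⟨(LipschitzWith.const c).lipschitzOnWith.absolutelyContinuousOnInterval,
    Eventually.of_forall fun t => hasDerivAt_const t c⟩

lemma id' : IsPrim (fun t => t) (fun _ => 1) :=
  ⟨LipschitzWith.id.lipschitzOnWith.absolutelyContinuousOnInterval,
    Eventually.of_forall fun t => hasDerivAt_id t⟩

lemma add (h : IsPrim f g) (h₁ : IsPrim f₁ g₁) :
    IsPrim (fun t => f t + f₁ t) (fun t => g t + g₁ t) := by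
  refine ⟨h.ac.fun_add h₁.ac, ?_⟩
  filter_upwards [h.hd, h₁.hd] with t a b using a.add b

lemma sub (h : IsPrim f g) (h₁ : IsPrim f₁ g₁) :
    IsPrim (fun t => f t - f₁ t) (fun t => g t - g₁ t) := by
  refine ⟨h.ac.fun_sub h₁.ac, ?_⟩
  filter_upwards [h.hd, h₁.hd] with t a b using a.sub b

lemma mul (h : IsPrim f g) (h₁ : IsPrim f₁ g₁) :
    IsPrim (fun t => f t * f₁ t) (fun t => g t * f₁ t + f t * g₁ t) := by
  refine ⟨h.ac.fun_mul h₁.ac, ?_⟩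
  filter_upwards [h.hd, h₁.hd] with t a b using a.mul b

lemma const_mul (c : ℝ) (h : IsPrim f g) : IsPrim (fun t => c * f t) (fun t => c * g t) := by
  refine ⟨h.ac.const_mul c, ?_⟩
  filter_upwards [h.hd] with t a using a.const_mul c

/-- The image of `[0,1]` under `f` is compact and convex, so `G` is Lipschitz on it, and a Lipschitz
function of an absolutely continuous one is absolutely continuous. -/
lemma comp (h : IsPrim f g) {G : ℝ → ℝ}
    (hG : ∀ t ∈ Icc (0 : ℝ) 1, ContDiffAt ℝ 1 G (f t)) :
    IsPrim (fun t => G (f t)) (fun t => deriv G (f t) * g t) := by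
  have hcomp : IsCompact (f '' Icc 0 1) := isCompact_Icc.image_of_continuousOn h.continuousOn
  have hconv : Convex ℝ (f '' Icc 0 1) :=
    (isPreconnected_Icc.image _ h.continuousOn).ordConnected.convex
  have hG' : ContDiffOn ℝ 1 G (f '' Icc 0 1) := by
    rintro x ⟨t, ht, rfl⟩
    exact (hG t ht).contDiffWithinAt
  obtain ⟨K, hK⟩ := hG'.exists_lipschitzOnWith (by decide) hconv hcomp
  refine ⟨?_, ?_⟩
  · refine LipschitzOnWith.comp_absolutelyContinuousOnInterval (K := K) ?_ h.ac
    rwa [uIcc_of_le zero_le_one]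
  · filter_upwards [h.hd, ae_mem_Ioo_vol01] with t h1 h2
    exact ((hG t ⟨h2.1.le, h2.2.le⟩).differentiableAt (by decide)).hasDerivAt.comp t h1

lemma bddOn (h : IsPrim f g) : ∃ C, 0 ≤ C ∧ ∀ t ∈ Icc (0 : ℝ) 1, |f t| ≤ C := by
  obtain ⟨C, hC⟩ := h.ac.exists_bound
  rw [uIcc_of_le zero_le_one] at hC
  exact ⟨C, (norm_nonneg _).trans (hC 0 (by simp)), hC⟩

end IsPrim

/-! ### Square integrable derivatives and real functions of class `W₂¹`. -/

lemma ae_vol01_of_forall {P : ℝ → Prop} (h : ∀ t ∈ Icc (0 : ℝ) 1, P t) : ∀ᵐ t ∂vol01, P t :=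
  ae_vol01_iff.2 (Eventually.of_forall h)

lemma aestronglyMeasurable_of_continuousOn {f : ℝ → ℝ} (hf : ContinuousOn f (Icc 0 1)) :
    AEStronglyMeasurable f vol01 := hf.aestronglyMeasurable measurableSet_Icc

/-- A continuous function times a square integrable one is square integrable. -/
lemma memLp_continuousOn_mul {f g : ℝ → ℝ} (hf : ContinuousOn f (Icc 0 1))
    (hg : MemLp g 2 vol01) : MemLp (fun t => f t * g t) 2 vol01 := by
  obtain ⟨C, hC⟩ := isCompact_Icc.exists_bound_of_continuousOn hf
  refine hg.of_le_mul (c := C) ((aestronglyMeasurable_of_continuousOn hf).mul hg.1) ?_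
  filter_upwards [ae_vol01_of_forall hC] with t ht
  rw [norm_mul]; gcongr

lemma memLp_continuousOn {f : ℝ → ℝ} (hf : ContinuousOn f (Icc 0 1)) : MemLp f 2 vol01 := by
  simpa using memLp_continuousOn_mul hf (memLp_const (1 : ℝ))

/-- The Cauchy–Schwarz inequality on a subinterval. -/
lemma sq_integral_le {g : ℝ → ℝ} (hg : MemLp g 2 vol01) {a b : ℝ} (ha : a ∈ Icc (0 : ℝ) 1)
    (hb : b ∈ Icc (0 : ℝ) 1) :
    (∫ t in a..b, g t) ^ 2 ≤ |b - a| * ∫ t, g t ^ 2 ∂vol01 := by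
  wlog hab : a ≤ b generalizing a b
  · have := this hb ha (le_of_not_ge hab)
    rw [intervalIntegral.integral_symm, neg_sq, abs_sub_comm]; exact this
  have hsub : Ioc a b ⊆ Icc 0 1 := fun t ht => ⟨ha.1.trans ht.1.le, ht.2.trans hb.2⟩
  have hi : Integrable g vol01 := hg.integrable (by norm_num)
  have hi2 : Integrable (fun t => g t ^ 2) vol01 := hg.integrable_sq
  have i1 : IntegrableOn g (Ioc a b) := hi.mono_measure (Measure.restrict_mono hsub le_rfl)
  have i2 : IntegrableOn (fun t => g t ^ 2) (Ioc a b) :=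
    hi2.mono_measure (Measure.restrict_mono hsub le_rfl)
  rw [intervalIntegral.integral_of_le hab, abs_of_nonneg (sub_nonneg.2 hab)]
  set J := ∫ t in Ioc a b, g t
  have hJ2 : ∫ t in Ioc a b, g t ^ 2 ≤ ∫ t, g t ^ 2 ∂vol01 :=
    setIntegral_mono_set hi2 (Eventually.of_forall fun t => sq_nonneg _) hsub.eventuallyLE
  -- The quadratic polynomial `x ↦ ∫ (x - g)²` is nonnegative, so its discriminant is nonpositive.
  have key : ∀ x : ℝ, 0 ≤ (b - a) * x ^ 2 - 2 * J * x + ∫ t in Ioc a b, g t ^ 2 := by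
    intro x
    have : 0 ≤ ∫ t in Ioc a b, (x - g t) ^ 2 := integral_nonneg fun t => sq_nonneg _
    have e : ∫ t in Ioc a b, (x - g t) ^ 2 =
        (b - a) * x ^ 2 - 2 * J * x + ∫ t in Ioc a b, g t ^ 2 := by
      have e1 : ∀ t, (x - g t) ^ 2 = x ^ 2 - 2 * x * g t + g t ^ 2 := fun t => by ring
      simp_rw [e1]
      have ic : IntegrableOn (fun _ : ℝ => x ^ 2) (Ioc a b) := by simp
      have i3 : IntegrableOn (fun t => 2 * x * g t) (Ioc a b) := i1.const_mul _
      have i4 : IntegrableOn (fun t => x ^ 2 - 2 * x * g t) (Ioc a b) := ic.sub i3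
      rw [integral_add i4 i2, integral_sub ic i3, integral_const_mul]
      simp [hab, J]; ring
    rwa [e] at this
  have := discrim_le_zero (a := b - a) (b := -2 * J) (c := ∫ t in Ioc a b, g t ^ 2)
    (fun x => by have := key x; nlinarith)
  rw [discrim] at this
  have hba : 0 ≤ b - a := sub_nonneg.2 hab
  nlinarith [mul_le_mul_of_nonneg_left hJ2 hba]

namespace W12

lemma sub_toFun (y z : W12) (t : ℝ) : (y - z) t = y t - z t := by
  have := add_toFun (y - z) z t
  rw [sub_add_cancel] at this
  rw [this]; ring

lemma isPrim_re (y : W12) : IsPrim (fun t => (y t).re) (fun t => (y.deriv t).re) := by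
  have hi : Integrable (fun t => (y.deriv t).re) vol01 := (integrable_L2 y.deriv).re
  refine (IsPrim.primitive hi y.init.re (a := 0) (by simp)).congr (fun t ht => ?_) (by rfl)
  rw [toFun_eq y ht, Complex.add_re]
  congr 1
  have hint : IntervalIntegrable y.deriv volume 0 t := by
    rw [intervalIntegrable_iff_integrableOn_Ioc_of_le ht.1]
    have hsub : Ioc 0 t ⊆ Icc (0 : ℝ) 1 := fun s hs => ⟨hs.1.le, hs.2.trans ht.2⟩
    exact (integrable_L2 y.deriv).mono_measure (Measure.restrict_mono hsub le_rfl)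
  exact (Complex.reCLM.intervalIntegral_comp_comm hint)

lemma isPrim_im (y : W12) : IsPrim (fun t => (y t).im) (fun t => (y.deriv t).im) := by
  have h := isPrim_re (-(Complex.I • y))
  refine h.congr (fun t _ => ?_) ?_
  · have : (-(Complex.I • y)) t = -(Complex.I * y t) := by
      rw [← neg_smul, smul_toFun]; ring
    rw [this]; simp
  · have e : (-(Complex.I • y)).deriv = (-Complex.I) • y.deriv := by
      rw [← neg_smul, map_smul]
    rw [e]
    filter_upwards [Lp.coeFn_smul (-Complex.I) y.deriv] with t ht
    rw [ht]; simp

/-- A function of class `W₂¹[0,1]` is determined by its values. -/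
lemma ext_fun {y z : W12} (h : ∀ t ∈ Icc (0 : ℝ) 1, y t = z t) : y = z := by
  have e1 := (y.isPrim_re.congr (fun t ht => by rw [h t ht]) (by rfl)).ae_unique z.isPrim_re
  have e2 := (y.isPrim_im.congr (fun t ht => by rw [h t ht]) (by rfl)).ae_unique z.isPrim_im
  ext1
  · rw [← toFun_zero, ← toFun_zero, h 0 (by simp)]
  · apply Lp.ext
    filter_upwards [e1, e2] with t h1 h2 using Complex.ext h1 h2

lemma cconj_eq (y : W12) : y.cconj.deriv =ᵐ[vol01] fun t => conj (y.deriv t) :=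
  Lp.coeFn_star y.deriv

end W12

/-- `y` is the real function `f`, with derivative `g`. -/
structure RealRep (y : W12) (f g : ℝ → ℝ) : Prop where
  prim : IsPrim f g
  mem : MemLp g 2 vol01
  val : ∀ t ∈ Icc (0 : ℝ) 1, y t = f t
  der : y.deriv =ᵐ[vol01] fun t => (g t : ℂ)

lemma IsPrim.exists_realRep {f g : ℝ → ℝ} (h : IsPrim f g) (hg : MemLp g 2 vol01) :
    ∃ y : W12, RealRep y f g := by
  have hg' : MemLp (fun t => (g t : ℂ)) 2 vol01 := hg.ofReal
  refine ⟨W12.mk (f 0) (hg'.toLp _), h, hg, fun t ht => ?_, hg'.coeFn_toLp⟩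
  have e : ∫ s in (0 : ℝ)..t, (W12.mk (f 0) (hg'.toLp _)).deriv s = ∫ s in (0 : ℝ)..t, (g s : ℂ) := by
    refine intervalIntegral.integral_congr_ae ?_
    filter_upwards [ae_vol01_iff.1 hg'.coeFn_toLp] with s hs hs'
    rw [uIoc_of_le ht.1] at hs'
    exact hs ⟨hs'.1.le, hs'.2.trans ht.2⟩
  rw [W12.toFun_eq _ ht, e, intervalIntegral.integral_ofReal, h.integral (by simp) ht]
  simp

namespace RealRep

variable {y z : W12} {f g f₁ g₁ : ℝ → ℝ}

lemma of_real (hy : ∀ t ∈ Icc (0 : ℝ) 1, (y t).im = 0) :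
    RealRep y (fun t => (y t).re) (fun t => (y.deriv t).re) := by
  have him : (fun t => (y.deriv t).im) =ᵐ[vol01] fun _ => 0 :=
    (y.isPrim_im.congr (f₁ := fun _ => 0) hy (by rfl)).ae_unique (IsPrim.const 0)
  refine ⟨y.isPrim_re, (Lp.memLp y.deriv).re, fun t ht => ?_, ?_⟩
  · exact Complex.ext (by simp) (by simp [hy t ht])
  · filter_upwards [him] with t ht
    exact Complex.ext (by simp) (by simp [ht])

lemma exists_re (y : W12) : ∃ u : W12, RealRep u (fun t => (y t).re) (fun t => (y.deriv t).re) :=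
  y.isPrim_re.exists_realRep (Lp.memLp y.deriv).re

lemma exists_im (y : W12) : ∃ u : W12, RealRep u (fun t => (y t).im) (fun t => (y.deriv t).im) :=
  y.isPrim_im.exists_realRep (Lp.memLp y.deriv).im

lemma eq_re_add_im {u v : W12} (hu : RealRep u (fun t => (y t).re) (fun t => (y.deriv t).re))
    (hv : RealRep v (fun t => (y t).im) (fun t => (y.deriv t).im)) : y = u + Complex.I • v := by
  refine W12.ext_fun fun t ht => ?_
  rw [W12.add_toFun, W12.smul_toFun, hu.val t ht, hv.val t ht]
  apply Complex.ext <;> simp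

lemma im_eq_zero (h : RealRep y f g) : ∀ t ∈ Icc (0 : ℝ) 1, (y t).im = 0 := fun t ht => by
  rw [h.val t ht, Complex.ofReal_im]

lemma cconj_eq (h : RealRep y f g) : y.cconj = y :=
  W12.ext_fun fun t ht => by rw [W12.cconj_toFun, h.val t ht, Complex.conj_ofReal]

lemma mul (h : RealRep y f g) (h₁ : RealRep z f₁ g₁) :
    RealRep (W12.mul y z) (fun t => f t * f₁ t) (fun t => g t * f₁ t + f t * g₁ t) := by
  refine ⟨h.prim.mul h₁.prim, ?_, fun t ht => ?_, ?_⟩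
  · have a := memLp_continuousOn_mul h₁.prim.continuousOn h.mem
    have b := memLp_continuousOn_mul h.prim.continuousOn h₁.mem
    refine (a.add b).ae_eq (Eventually.of_forall fun t => ?_)
    simp only [Pi.add_apply]; ring
  · rw [W12.mul_toFun _ _ ht.1, h.val t ht, h₁.val t ht]; push_cast; ring
  · filter_upwards [W12.coeFn_deriv_mul y z, h.der, h₁.der, ae_mem_Ioo_vol01] with t a b c d
    have d' : t ∈ Icc (0 : ℝ) 1 := ⟨d.1.le, d.2.le⟩
    rw [a, b, c, h.val t d', h₁.val t d']; push_cast; ring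

end RealRep

/-! ### Real functionals as distributions of first order. -/

/-- The functional `s` is the real distribution `c δ₀ - σ'`. -/
structure IsDensity (s : W12 →L[ℂ] ℂ) (c : ℝ) (σ : ℝ → ℝ) : Prop where
  mem : MemLp σ 2 vol01
  eq : ∀ f : W12, s f = c * f.init + ∫ t, (σ t : ℂ) * f.deriv t ∂vol01

lemma W12.norm_mk_zero_le (g : L2) : ‖W12.mk 0 g‖ ≤ 2 * ‖g‖ := by
  simpa using W12.norm_le (W12.mk 0 g)

lemma W12.toFun_mk_one_zero (t : ℝ) (ht : t ∈ Icc (0 : ℝ) 1) : W12.mk 1 0 t = 1 := by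
  obtain ⟨u, hu⟩ := (IsPrim.const 1).exists_realRep (memLp_const 0)
  have : W12.mk 1 0 = u := by
    ext1
    · have := hu.val 0 (by simp)
      rw [W12.toFun_zero] at this
      simp [this]
    · apply Lp.ext
      rw [W12.deriv_mk]
      filter_upwards [hu.der, Lp.coeFn_zero ℂ 2 vol01] with t h1 h2
      rw [h1, h2]; simp
  rw [this, hu.val t ht]; simp

/-- The Riesz representation of `s` on functions vanishing at `0`, seen as a functional of the
derivative, gives `σ`; the value of `s` at the constant `1` gives `c`. -/
lemma exists_isDensity (s : W12 →L[ℂ] ℂ)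
    (hs : ∀ f : W12, (∀ t ∈ Icc (0 : ℝ) 1, (f t).im = 0) → (s f).im = 0) :
    ∃ c σ, IsDensity s c σ := by
  let ℓ₀ : L2 →ₗ[ℂ] ℂ := s.toLinearMap.comp (LinearMap.inr ℂ ℂ L2)
  have hℓ₀ : ∀ g, ℓ₀ g = s (W12.mk 0 g) := fun g => rfl
  let ℓ : L2 →L[ℂ] ℂ := ℓ₀.mkContinuous (‖s‖ * 2) fun g => by
    rw [hℓ₀, mul_assoc]
    exact (s.le_opNorm _).trans (by gcongr; exact W12.norm_mk_zero_le g)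
  let ρ : L2 := (InnerProductSpace.toDual ℂ L2).symm ℓ
  have hρ : ∀ g : L2, s (W12.mk 0 g) = ∫ t, conj (ρ t) * g t ∂vol01 := by
    intro g
    have h1 : inner ℂ ρ g = ℓ g := InnerProductSpace.toDual_symm_apply
    have h2 : ℓ g = s (W12.mk 0 g) := rfl
    rw [← h2, ← h1, L2.inner_def]
    refine integral_congr_ae (Eventually.of_forall fun t => ?_)
    simp [mul_comm]
  have hm : MemLp (fun t => (ρ t).im) 2 vol01 := (Lp.memLp ρ).im
  have him : ∀ᵐ t ∂vol01, (ρ t).im = 0 := by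
    -- Test with the primitive `u` of `Im ρ`: it is a real function, so `0 = Im (s u) = -∫ (Im ρ)²`.
    have hp := IsPrim.primitive (hm.integrable (by norm_num)) 0 (a := 0) (by simp)
    obtain ⟨u, hu⟩ := hp.exists_realRep hm
    have hu0 : u.init = 0 := by
      rw [← W12.toFun_zero, hu.val 0 (by simp)]; simp
    have hu' : u = W12.mk 0 u.deriv := by ext1 <;> simp [hu0]
    have h1 := hs u hu.im_eq_zero
    rw [hu', hρ] at h1
    have hint : Integrable (fun t => conj (ρ t) * u.deriv t) vol01 := by
      simpa [mul_comm] using L2.integrable_inner (𝕜 := ℂ) ρ u.deriv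
    have h2 : (∫ t, conj (ρ t) * u.deriv t ∂vol01).im =
        ∫ t, (conj (ρ t) * u.deriv t).im ∂vol01 := by
      exact (Complex.imCLM.integral_comp_comm hint).symm
    rw [h2] at h1
    have h3 : ∫ t, (ρ t).im ^ 2 ∂vol01 = 0 := by
      have : ∫ t, (conj (ρ t) * u.deriv t).im ∂vol01 = ∫ t, -((ρ t).im ^ 2) ∂vol01 := by
        refine integral_congr_ae ?_
        filter_upwards [hu.der] with t ht
        rw [ht]; simp [sq]
      rw [this, integral_neg] at h1
      linarith
    rw [integral_eq_zero_iff_of_nonneg (fun t => sq_nonneg _) hm.integrable_sq] at h3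
    filter_upwards [h3] with t ht
    simpa using ht
  refine ⟨(s (W12.mk 1 0)).re, fun t => (ρ t).re, (Lp.memLp ρ).re, fun f => ?_⟩
  have e : f = f.init • W12.mk 1 0 + W12.mk 0 f.deriv := by
    ext1 <;> simp
  have hr : s (W12.mk 1 0) = ((s (W12.mk 1 0)).re : ℂ) := by
    refine Complex.ext (by simp) ?_
    rw [Complex.ofReal_im]
    exact hs _ fun t ht => by rw [W12.toFun_mk_one_zero t ht]; simp
  conv_lhs => rw [e]
  rw [map_add, map_smul, hρ, ← hr, smul_eq_mul, mul_comm]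
  congr 1
  refine integral_congr_ae ?_
  filter_upwards [him] with t ht
  congr 1
  exact Complex.ext (by simp) (by simp [ht])

namespace IsDensity

variable {s : W12 →L[ℂ] ℂ} {c : ℝ} {σ : ℝ → ℝ}

lemma integrable_mul (h : IsDensity s c σ) {g : ℝ → ℝ} (hg : MemLp g 2 vol01) :
    Integrable (fun t => σ t * g t) vol01 := h.mem.integrable_mul hg

lemma apply_realRep (h : IsDensity s c σ) {y : W12} {f g : ℝ → ℝ} (hy : RealRep y f g) :
    s y = ((c * f 0 + ∫ t, σ t * g t ∂vol01 : ℝ) : ℂ) := by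
  rw [h.eq, ← W12.toFun_zero, hy.val 0 (by simp)]
  push_cast
  rw [← integral_complex_ofReal]
  congr 1
  refine integral_congr_ae ?_
  filter_upwards [hy.der] with t ht
  rw [ht]; push_cast; rfl

lemma apply_cconj (h : IsDensity s c σ) (y : W12) : s y.cconj = conj (s y) := by
  rw [h.eq, h.eq, map_add, map_mul, Complex.conj_ofReal, ← integral_conj]
  congr 1
  refine integral_congr_ae ?_
  filter_upwards [W12.cconj_eq y] with t ht
  rw [ht]; simp

end IsDensity

/-! ### The form at real parameters. -/

namespace Problem

variable (D : Problem)

/-- The functional `q - lam r`. -/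
def pot (lam : ℝ) : W12 →L[ℂ] ℂ := D.q - (lam : ℂ) • D.r

lemma pot_real (lam : ℝ) (f : W12) (hf : ∀ t ∈ Icc (0 : ℝ) 1, (f t).im = 0) :
    (D.pot lam f).im = 0 := by
  have h1 := D.q_real f hf
  have h2 := D.r_real f hf
  simp [pot, h1, h2]

lemma exists_density (lam : ℝ) : ∃ c σ, IsDensity (D.pot lam) c σ :=
  exists_isDensity _ (D.pot_real lam)

lemma form_eq (lam : ℝ) (y z : W12) : D.form lam y z =
    (∫ t, (D.p t : ℂ) * y.deriv t * conj (z.deriv t) ∂vol01) + D.pot lam (W12.mul y z.cconj)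
      + ((D.V 0 : ℂ) * y 0 * conj (z 0) + (D.V 1 : ℂ) * y 1 * conj (z 1)) := by
  simp [form, pot, trace, Fin.sum_univ_two]

lemma form_conj (lam : ℝ) (y z : W12) : conj (D.form lam y z) = D.form lam z y := by
  obtain ⟨c, σ, hd⟩ := D.exists_density lam
  have hmul : (W12.mul y z.cconj).cconj = W12.mul z y.cconj := by
    refine W12.ext_fun fun t ht => ?_
    simp only [W12.cconj_toFun, W12.mul_toFun _ _ ht.1, map_mul, Complex.conj_conj]
    ring
  rw [form_eq, form_eq, map_add, map_add, ← hd.apply_cconj, hmul, ← integral_conj]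
  congr 1
  · congr 1
    refine integral_congr_ae (Eventually.of_forall fun t => ?_)
    simp only [map_mul, Complex.conj_ofReal, Complex.conj_conj]; ring
  · simp only [map_add, map_mul, Complex.conj_ofReal, Complex.conj_conj]; ring

lemma form_self_im (lam : ℝ) (y : W12) : (D.form lam y y).im = 0 := by
  have := D.form_conj lam y y
  exact Complex.conj_eq_iff_im.1 this

lemma memLp_p_mul {g : ℝ → ℝ} (hg : MemLp g 2 vol01) : MemLp (fun t => D.p t * g t) 2 vol01 := by
  obtain ⟨M, -, hM⟩ := D.exists_bound_p
  refine hg.of_le_mul (c := M) (D.p_memLp.1.mul hg.1) ?_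
  filter_upwards [hM] with t ht
  rw [norm_mul]
  have : ‖D.p t‖ ≤ M := by simpa using ht
  gcongr

lemma integrable_p_mul_mul {g g₁ : ℝ → ℝ} (hg : MemLp g 2 vol01) (hg₁ : MemLp g₁ 2 vol01) :
    Integrable (fun t => D.p t * g t * g₁ t) vol01 := (D.memLp_p_mul hg).integrable_mul hg₁

lemma form_realRep {lam c : ℝ} {σ : ℝ → ℝ} (hd : IsDensity (D.pot lam) c σ) {y z : W12}
    {f g f₁ g₁ : ℝ → ℝ} (hy : RealRep y f g) (hz : RealRep z f₁ g₁) :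
    D.form lam y z = (((∫ t, D.p t * g t * g₁ t ∂vol01) +
      (c * (f 0 * f₁ 0) + ∫ t, σ t * (g t * f₁ t + f t * g₁ t) ∂vol01) +
      (D.V 0 * f 0 * f₁ 0 + D.V 1 * f 1 * f₁ 1) : ℝ) : ℂ) := by
  rw [form_eq, hz.cconj_eq, hd.apply_realRep (hy.mul hz), hy.val 0 (by simp), hy.val 1 (by simp),
    hz.val 0 (by simp), hz.val 1 (by simp)]
  have e : ∫ t, (D.p t : ℂ) * y.deriv t * conj (z.deriv t) ∂vol01 =
      ((∫ t, D.p t * g t * g₁ t ∂vol01 : ℝ) : ℂ) := by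
    rw [← integral_complex_ofReal]
    refine integral_congr_ae ?_
    filter_upwards [hy.der, hz.der] with t h1 h2
    rw [h1, h2]; simp
  rw [e]
  simp only [Complex.conj_ofReal]
  push_cast
  rfl

lemma form_im_realRep (lam : ℝ) {y z : W12} {f g f₁ g₁ : ℝ → ℝ} (hy : RealRep y f g)
    (hz : RealRep z f₁ g₁) : (D.form lam y z).im = 0 := by
  obtain ⟨c, σ, hd⟩ := D.exists_density lam
  rw [D.form_realRep hd hy hz, Complex.ofReal_im]

/-- As `U` is diagonal, `U - 1` acts coordinatewise, and only the coordinates with `U_kk = 1` are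
constrained: membership in `D.HU` amounts to Dirichlet conditions. -/
lemma mem_HU {y : W12} :
    y ∈ D.HU ↔ (D.U 0 0 = 1 → y 0 = 0) ∧ (D.U 1 1 = 1 → y 1 = 0) := by
  have hmv : ∀ (v : Fin 2 → ℂ) k, ((D.U - 1).mulVec v) k = (D.U k k - 1) * v k := by
    intro v k
    have h01 : D.U 0 1 = 0 := D.U_diag (by decide)
    have h10 : D.U 1 0 = 0 := D.U_diag (by decide)
    fin_cases k <;> simp [Matrix.mulVec, dotProduct, Fin.sum_univ_two, h01, h10]
  have h0 : trace y 0 = y 0 := rfl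
  have h1 : trace y 1 = y 1 := rfl
  simp only [HU, Submodule.mem_comap, LinearMap.mem_range, ContinuousLinearMap.coe_coe,
    Matrix.mulVecLin_apply]
  constructor
  · rintro ⟨v, hv⟩
    refine ⟨fun h => ?_, fun h => ?_⟩
    · rw [← h0, ← hv, hmv, h]; simp
    · rw [← h1, ← hv, hmv, h]; simp
  · rintro ⟨a, b⟩
    refine ⟨fun k => trace y k / (D.U k k - 1), ?_⟩
    ext k
    rw [hmv]
    by_cases hk : D.U k k = 1
    · rw [hk]
      fin_cases k
      · simpa [h0] using (a hk).symm
      · simpa [h1] using (b hk).symm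
    · exact mul_div_cancel₀ _ (sub_ne_zero.2 hk)

lemma form_sub_form (lam mu : ℂ) (y z : W12) :
    D.form mu y z = D.form lam y z + (lam - mu) * D.r (W12.mul y z.cconj) := by
  simp only [form, sub_apply, smul_apply, smul_eq_mul]
  ring

end Problem

/-! ### Weak solutions, quasi-derivatives and the Cauchy problem. -/

/-- `f` is a real solution of the differential equation, `f' = g`, with quasi-derivative `Y`. -/
structure Problem.IsSol (D : Problem) (σ f g Y : ℝ → ℝ) : Prop where
  prim : IsPrim f g
  mem : MemLp g 2 vol01
  primY : IsPrim Y (fun t => σ t * g t)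
  eq : ∀ᵐ t ∂vol01, D.p t * g t + σ t * f t = Y t

namespace Problem

variable {D : Problem} {σ f g Y : ℝ → ℝ}

lemma IsSol.comb {f₁ g₁ Y₁ : ℝ → ℝ} (h : D.IsSol σ f g Y) (h₁ : D.IsSol σ f₁ g₁ Y₁) (a b : ℝ) :
    D.IsSol σ (fun t => a * f t + b * f₁ t) (fun t => a * g t + b * g₁ t)
      (fun t => a * Y t + b * Y₁ t) := by
  refine ⟨(h.prim.const_mul a).add (h₁.prim.const_mul b),
    (h.mem.const_mul a).add (h₁.mem.const_mul b), ?_, ?_⟩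
  · refine ((h.primY.const_mul a).add (h₁.primY.const_mul b)).congr (fun _ _ => rfl)
      (Eventually.of_forall fun t => ?_)
    ring
  · filter_upwards [h.eq, h₁.eq] with t e1 e2
    rw [← e1, ← e2]; ring

/-- Integration by parts: `p g g₁ + σ (g f₁ + f g₁) = Y g₁ + (σ g) f₁` almost everywhere, which is
the derivative of `Y f₁`. -/
lemma integral_form_of_isSol {lam c : ℝ} (hd : IsDensity (D.pot lam) c σ)
    (h : D.IsSol σ f g Y) {y z : W12} (hy : RealRep y f g) {f₁ g₁ : ℝ → ℝ}
    (hz : RealRep z f₁ g₁) :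
    D.form lam y z = ((Y 1 * f₁ 1 - Y 0 * f₁ 0 + c * (f 0 * f₁ 0) +
      (D.V 0 * f 0 * f₁ 0 + D.V 1 * f 1 * f₁ 1) : ℝ) : ℂ) := by
  rw [D.form_realRep hd hy hz]
  have i1 : Integrable (fun t => D.p t * g t * g₁ t) vol01 :=
    D.integrable_p_mul_mul hy.mem hz.mem
  have i2 : Integrable (fun t => σ t * (g t * f₁ t + f t * g₁ t)) vol01 :=
    hd.integrable_mul (hy.mul hz).mem
  have e : (∫ t, D.p t * g t * g₁ t ∂vol01) + ∫ t, σ t * (g t * f₁ t + f t * g₁ t) ∂vol01 =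
      Y 1 * f₁ 1 - Y 0 * f₁ 0 := by
    rw [← (h.primY.mul hz.prim).integral01, ← integral_add i1 i2]
    refine integral_congr_ae ?_
    filter_upwards [h.eq] with t ht
    rw [← ht]; ring
  congr 1
  linarith

/-- The du Bois-Reymond argument: test functions vanishing at both ends show that `p g + σ f - ∫ σ
g` is constant almost everywhere. The boundary conditions then follow from two more test functions;
the summand `c` in the one at `0` stems from the point mass `c δ₀`. -/
lemma exists_isSol {lam c : ℝ} (hd : IsDensity (D.pot lam) c σ) {y : W12}
    (hy : RealRep y f g) (h0 : ∀ z ∈ D.HU, D.form lam y z = 0) :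
    ∃ Y, D.IsSol σ f g Y ∧ (D.U 0 0 ≠ 1 → Y 0 = (c + D.V 0) * f 0) ∧
      (D.U 1 1 ≠ 1 → Y 1 = -D.V 1 * f 1) := by
  have hσg : Integrable (fun t => σ t * g t) vol01 := hd.integrable_mul hy.mem
  have hS := IsPrim.primitive hσg 0 (a := 0) (by simp)
  set S : ℝ → ℝ := fun t => 0 + ∫ s in (0 : ℝ)..t, σ s * g s with hSdef
  have hS0 : S 0 = 0 := by simp [hSdef]
  set h : ℝ → ℝ := fun t => D.p t * g t + f t * σ t - S t with hh
  have hmem : MemLp h 2 vol01 :=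
    ((D.memLp_p_mul hy.mem).add (memLp_continuousOn_mul hy.prim.continuousOn hd.mem)).sub
      (memLp_continuousOn hS.continuousOn)
  -- Subtracting the mean makes the primitive `w` of `h - m` vanish at both ends, so that it is an
  -- admissible test function whatever `U` is.
  set m : ℝ := ∫ t, h t ∂vol01 with hm
  have kmem : MemLp (fun t => h t - m) 2 vol01 := hmem.sub (memLp_const m)
  have kint : Integrable (fun t => h t - m) vol01 := kmem.integrable (by norm_num)
  have hz := IsPrim.primitive kint 0 (a := 0) (by simp)
  set w : ℝ → ℝ := fun t => 0 + ∫ s in (0 : ℝ)..t, (h s - m) with hw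
  have hw0 : w 0 = 0 := by simp [hw]
  have hk0 : ∫ t, (h t - m) ∂vol01 = 0 := by
    rw [integral_sub (hmem.integrable (by norm_num)) (integrable_const m)]
    simp [hm]
  have hw1 : w 1 = 0 := by
    have := hz.integral01
    rw [hk0, hw0] at this
    linarith
  obtain ⟨z, hzr⟩ := hz.exists_realRep kmem
  have hzU : z ∈ D.HU := by
    rw [D.mem_HU, hzr.val 0 (by simp), hzr.val 1 (by simp), hw0, hw1]
    simp
  have e0 := h0 z hzU
  rw [D.form_realRep hd hy hzr, hw0, hw1] at e0
  have e1 : (∫ t, D.p t * g t * (h t - m) ∂vol01) +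
      ∫ t, σ t * (g t * w t + f t * (h t - m)) ∂vol01 = 0 := by
    have := Complex.ofReal_eq_zero.1 e0
    linarith
  have e2 := (hS.mul hz).integral01
  rw [hw0, hw1] at e2
  have i1 : Integrable (fun t => D.p t * g t * (h t - m)) vol01 :=
    D.integrable_p_mul_mul hy.mem kmem
  have i2 : Integrable (fun t => σ t * (g t * w t + f t * (h t - m))) vol01 :=
    hd.integrable_mul (hy.mul hzr).mem
  have i3 := (hS.mul hz).integrable
  have i4 : Integrable (fun t => m * (h t - m)) vol01 := kint.const_mul m
  -- This is the equation tested with `w`, less `∫ (S w)' = 0` and `m ∫ (h - m) = 0`.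
  have e3 : ∫ t, (h t - m) ^ 2 ∂vol01 = 0 := by
    have : ∫ t, (h t - m) ^ 2 ∂vol01 = (∫ t, D.p t * g t * (h t - m) ∂vol01) +
      (∫ t, σ t * (g t * w t + f t * (h t - m)) ∂vol01) -
      (∫ t, (σ t * g t * w t + S t * (h t - m)) ∂vol01) - ∫ t, m * (h t - m) ∂vol01 := by
      have i12 : Integrable (fun t => D.p t * g t * (h t - m) +
          σ t * (g t * w t + f t * (h t - m))) vol01 := i1.add i2
      have i123 : Integrable (fun t => D.p t * g t * (h t - m) +
          σ t * (g t * w t + f t * (h t - m)) - (σ t * g t * w t + S t * (h t - m))) vol01 :=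
        i12.sub i3
      rw [← integral_add i1 i2, ← integral_sub i12 i3, ← integral_sub i123 i4]
      refine integral_congr_ae (Eventually.of_forall fun t => ?_)
      simp only [hh]; ring
    rw [this, e1, e2, integral_const_mul, hk0]; simp
  rw [integral_eq_zero_iff_of_nonneg (fun t => sq_nonneg _) kmem.integrable_sq] at e3
  have hY : IsPrim (fun t => m + S t) (fun t => σ t * g t) :=
    ((IsPrim.const m).add hS).congr (fun _ _ => rfl) (Eventually.of_forall fun t => by simp)
  have hsol : D.IsSol σ f g (fun t => m + S t) := by
    refine ⟨hy.prim, hy.mem, hY, ?_⟩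
    filter_upwards [e3] with t ht
    have : h t - m = 0 := by simpa using ht
    simp only [hh] at this
    linarith
  refine ⟨_, hsol, fun hU => ?_, fun hU => ?_⟩
  -- The test function `1 - t` isolates the condition at `0`; below, `t` isolates the one at `1`.
  · obtain ⟨v, hv⟩ := ((IsPrim.const 1).sub IsPrim.id').exists_realRep (memLp_const _)
    have hvU : v ∈ D.HU := by
      rw [D.mem_HU, hv.val 1 (by simp)]
      exact ⟨fun h => absurd h hU, fun _ => by simp⟩
    have := h0 v hvU
    rw [integral_form_of_isSol hd hsol hy hv] at this
    have := Complex.ofReal_eq_zero.1 this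
    linarith
  · obtain ⟨v, hv⟩ := IsPrim.id'.exists_realRep (memLp_const _)
    have hvU : v ∈ D.HU := by
      rw [D.mem_HU, hv.val 0 (by simp)]
      exact ⟨fun _ => by simp, fun h => absurd h hU⟩
    have := h0 v hvU
    rw [integral_form_of_isSol hd hsol hy hv] at this
    have := Complex.ofReal_eq_zero.1 this
    linarith

/-- A solution with vanishing Cauchy data at a point vanishes near this point. -/
lemma IsSol.eventually_zero (hσ : MemLp σ 2 vol01) (h : D.IsSol σ f g Y) {t₀ : ℝ}
    (ht₀ : t₀ ∈ Icc (0 : ℝ) 1) (hf : f t₀ = 0) (hY : Y t₀ = 0) :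
    ∃ η > 0, ∀ t ∈ Icc (0 : ℝ) 1, |t - t₀| ≤ η → f t = 0 ∧ Y t = 0 := by
  obtain ⟨c, hc, hp⟩ := D.p_pos
  -- From `p g = Y - σ f` and `p ≥ c`, both `|f'| = |g|` and `|Y'| = |σ g|` are at most `(1 + |σ|)²
  -- / c` times `|f| + |Y|`. This factor is integrable because `σ ∈ L₂`.
  have hκ : Integrable (fun t => (1 + |σ t|) ^ 2 / c) vol01 :=
    (((memLp_const (1 : ℝ)).add hσ.norm).integrable_sq).div_const c
  have hK := IsPrim.primitive hκ 0 ht₀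
  have hKc := hK.continuousOn t₀ ht₀
  rw [Metric.continuousWithinAt_iff] at hKc
  -- On so short an interval the maximum `M` of `|f| + |Y|` satisfies `M ≤ M/4 + M/4`, hence `M =
  -- 0`.
  obtain ⟨η, hη, hηK⟩ := hKc (1 / 4) (by norm_num)
  refine ⟨η / 2, by positivity, ?_⟩
  set J := Icc (0 : ℝ) 1 ∩ Icc (t₀ - η / 2) (t₀ + η / 2) with hJ
  have hJc : IsCompact J := isCompact_Icc.inter isCompact_Icc
  have ht₀J : t₀ ∈ J := ⟨ht₀, by constructor <;> linarith⟩
  have hcont : ContinuousOn (fun t => |f t| + |Y t|) J :=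
    (h.prim.continuousOn.abs.add h.primY.continuousOn.abs).mono inter_subset_left
  obtain ⟨τ, hτ, hmax⟩ := hJc.exists_isMaxOn ⟨t₀, ht₀J⟩ hcont
  set M := |f τ| + |Y τ| with hM
  have hJord : OrdConnected J := ordConnected_Icc.inter ordConnected_Icc
  have hsub : uIoc t₀ τ ⊆ J := uIoc_subset_uIcc.trans (hJord.uIcc_subset ht₀J hτ)
  have hbd : ∀ᵐ t ∂volume.restrict (uIoc t₀ τ), |g t| ≤ (1 + |σ t|) ^ 2 / c * M ∧
      |σ t * g t| ≤ (1 + |σ t|) ^ 2 / c * M := by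
    rw [ae_restrict_iff' measurableSet_uIoc]
    filter_upwards [ae_vol01_iff.1 h.eq, ae_vol01_iff.1 hp] with t h1 h2 ht
    have htJ := hsub ht
    have h1 := h1 htJ.1
    have h2 := h2 htJ.1
    have h3 : |f t| + |Y t| ≤ M := hmax htJ
    have e : D.p t * g t = Y t - σ t * f t := by linarith
    have e1 : c * |g t| ≤ |Y t| + |σ t| * |f t| := by
      calc c * |g t| ≤ D.p t * |g t| := by gcongr
        _ = |D.p t * g t| := by rw [abs_mul, abs_of_pos (hc.trans_le h2)]
        _ ≤ |Y t| + |σ t * f t| := by rw [e]; exact abs_sub _ _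
        _ = _ := by rw [abs_mul]
    have e2 : c * |g t| ≤ (1 + |σ t|) * M := by
      nlinarith [abs_nonneg (σ t), abs_nonneg (f t), abs_nonneg (Y t)]
    have e3 : |g t| ≤ (1 + |σ t|) * M / c := by rw [le_div_iff₀ hc]; linarith
    have hM0 : 0 ≤ (1 + |σ t|) * M / c := (abs_nonneg _).trans e3
    have e4 : (1 + |σ t|) ^ 2 / c * M = (1 + |σ t|) * ((1 + |σ t|) * M / c) := by ring
    rw [e4, abs_mul]
    constructor
    · nlinarith [abs_nonneg (σ t)]
    · nlinarith [abs_nonneg (σ t), abs_nonneg (g t)]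
  have hi := (hK.intervalIntegrable ht₀ hτ.1).mul_const M
  have hKτ : |∫ t in t₀..τ, (1 + |σ t|) ^ 2 / c| ≤ 1 / 4 := by
    have := hηK hτ.1 (by
      rw [Real.dist_eq, abs_lt]
      constructor <;> linarith [hτ.2.1, hτ.2.2])
    simp only [Real.dist_eq, intervalIntegral.integral_same, zero_add, sub_zero] at this
    exact this.le
  have hM0 : 0 ≤ M := by positivity
  have hint : |∫ t in t₀..τ, (1 + |σ t|) ^ 2 / c * M| ≤ M / 4 := by
    rw [intervalIntegral.integral_mul_const, abs_mul, abs_of_nonneg hM0]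
    nlinarith
  have b1 : |f τ| ≤ M / 4 := by
    have e := h.prim.integral ht₀ hτ.1
    rw [hf, sub_zero] at e
    rw [← e]
    exact (intervalIntegral.norm_integral_le_abs_of_norm_le (f := g)
      (hbd.mono fun t ht => ht.1) hi).trans hint
  have b2 : |Y τ| ≤ M / 4 := by
    have e := h.primY.integral ht₀ hτ.1
    rw [hY, sub_zero] at e
    rw [← e]
    exact (intervalIntegral.norm_integral_le_abs_of_norm_le
      (f := fun t => σ t * g t) (hbd.mono fun t ht => ht.2) hi).trans hint
  have hMz : M = 0 := by linarith
  intro t ht htη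
  have htJ : t ∈ J := ⟨ht, by
    rw [abs_le] at htη
    constructor <;> linarith⟩
  have h3 : |f t| + |Y t| ≤ M := hmax htJ
  rw [hMz] at h3
  constructor
  · exact abs_nonpos_iff.1 (by linarith [abs_nonneg (Y t)])
  · exact abs_nonpos_iff.1 (by linarith [abs_nonneg (f t)])

/-- Uniqueness in the Cauchy problem. -/
lemma IsSol.eq_zero (hσ : MemLp σ 2 vol01) (h : D.IsSol σ f g Y) {t₀ : ℝ}
    (ht₀ : t₀ ∈ Icc (0 : ℝ) 1) (hf : f t₀ = 0) (hY : Y t₀ = 0) :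
    ∀ t ∈ Icc (0 : ℝ) 1, f t = 0 := by
  -- The set of points with zero Cauchy data is closed by continuity and open by local uniqueness;
  -- `[0,1]` is connected.
  let Z : Set (Icc (0 : ℝ) 1) := {t | f t = 0 ∧ Y t = 0}
  have hcl : IsClosed Z :=
    (isClosed_eq (continuousOn_iff_continuous_domRestrict.1 h.prim.continuousOn)
      continuous_const).inter
      (isClosed_eq (continuousOn_iff_continuous_domRestrict.1 h.primY.continuousOn) continuous_const)
  have hop : IsOpen Z := by
    rw [isOpen_iff_mem_nhds]
    rintro ⟨t, ht⟩ ⟨h1, h2⟩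
    obtain ⟨η, hη, H⟩ := h.eventually_zero hσ ht h1 h2
    refine Filter.mem_of_superset (Metric.ball_mem_nhds _ hη) fun s hs => ?_
    exact H s s.2 (le_of_lt hs)
  have : PreconnectedSpace (Icc (0 : ℝ) 1) := Subtype.preconnectedSpace isPreconnected_Icc
  have hu : Z = univ := IsClopen.eq_univ ⟨hcl, hop⟩ ⟨⟨t₀, ht₀⟩, hf, hY⟩
  intro t ht
  have : (⟨t, ht⟩ : Icc (0 : ℝ) 1) ∈ Z := hu ▸ mem_univ _
  exact this.1

/-- Near a zero with nonvanishing quasi-derivative, a solution behaves like a linear function. -/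
lemma IsSol.linear_at_zero (hσ : MemLp σ 2 vol01) (h : D.IsSol σ f g Y) {t₀ : ℝ}
    (ht₀ : t₀ ∈ Icc (0 : ℝ) 1) (hf : f t₀ = 0) (hY : Y t₀ ≠ 0) :
    ∃ κ > 0, ∃ η > 0, ∀ t ∈ Icc (0 : ℝ) 1, |t - t₀| < η →
      κ * (t - t₀) ^ 2 ≤ Y t₀ * f t * (t - t₀) := by
  obtain ⟨c, hc, hp⟩ := D.p_pos
  obtain ⟨M, -, hM⟩ := D.exists_bound_p
  -- Integrating factor: with `H = ∫ σ/p` one has `(e^H f)' = e^H (p g + σ f)/p = e^H Y/p`. Near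
  -- `t₀` this has the sign of `Y t₀` and is bounded away from `0`, whereas `g` alone need not have
  -- a sign.
  have hmem : MemLp (fun t => σ t / D.p t) 2 vol01 := by
    refine hσ.of_le_mul (c := c⁻¹) (hσ.1.div₀ D.p_memLp.1) ?_
    filter_upwards [hp] with t ht
    rw [norm_div, div_eq_inv_mul]
    have : c ≤ ‖D.p t‖ := ht.trans (le_abs_self _)
    gcongr
  have hh := IsPrim.primitive (hmem.integrable (by norm_num)) 0 (a := 0) (by simp)
  set H : ℝ → ℝ := fun t => 0 + ∫ s in (0 : ℝ)..t, σ s / D.p s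
  have hE := hh.comp (G := Real.exp) fun t _ => Real.contDiff_exp.contDiffAt
  have hF := h.prim.mul hE
  have hF' := hF.congr (g₁ := fun t => Real.exp (H t) * Y t / D.p t) (fun _ _ => rfl) (by
    filter_upwards [h.eq, hp] with t h1 h2
    have : D.p t ≠ 0 := (hc.trans_le h2).ne'
    rw [← h1, Real.deriv_exp]
    field_simp)
  obtain ⟨C, -, hC⟩ := hh.bddOn
  have hYc := h.primY.continuousOn t₀ ht₀
  rw [Metric.continuousWithinAt_iff] at hYc
  obtain ⟨η, hη, hηY⟩ := hYc (|Y t₀| / 2) (by positivity)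
  have hY2 : ∀ t ∈ Icc (0 : ℝ) 1, |t - t₀| < η → Y t₀ ^ 2 / 2 ≤ Y t₀ * Y t := by
    intro t ht htη
    have := hηY ht htη
    rw [Real.dist_eq] at this
    have h1 : |Y t₀ * (Y t - Y t₀)| ≤ Y t₀ ^ 2 / 2 := by
      rw [abs_mul, ← sq_abs (Y t₀)]
      nlinarith [abs_nonneg (Y t₀)]
    have := (abs_le.1 h1).1
    nlinarith
  have hM1 : 0 < |M| + 1 := by positivity
  -- Lower bound for `Y t₀ * (e^H Y/p)`, from `|H| ≤ C`, `Y t₀ * Y ≥ (Y t₀)²/2` and `p ≤ |M| + 1`.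
  set κ₁ := Real.exp (-C) * (Y t₀ ^ 2 / 2) / (|M| + 1) with hκ₁
  have hκ₁0 : 0 < κ₁ := by positivity
  have hlow : ∀ a b, a ∈ Icc (0 : ℝ) 1 → b ∈ Icc (0 : ℝ) 1 → |a - t₀| < η → |b - t₀| < η →
      a ≤ b → κ₁ * (b - a) ≤ Y t₀ * (f b * Real.exp (H b) - f a * Real.exp (H a)) := by
    intro a b ha hb ha' hb' hab
    rw [← hF'.integral ha hb, ← intervalIntegral.integral_const_mul]
    have e : κ₁ * (b - a) = ∫ _ in a..b, κ₁ := by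
      rw [intervalIntegral.integral_const, smul_eq_mul, mul_comm]
    rw [e]
    refine intervalIntegral.integral_mono_ae_restrict hab intervalIntegrable_const
      ((hF'.intervalIntegrable ha hb).const_mul _) ?_
    rw [EventuallyLE, ae_restrict_iff' measurableSet_Icc]
    filter_upwards [ae_vol01_iff.1 hM, ae_vol01_iff.1 hp] with t h1 h2 ht
    have ht01 : t ∈ Icc (0 : ℝ) 1 := ⟨ha.1.trans ht.1, ht.2.trans hb.2⟩
    have h1 := h1 ht01
    have h2 := h2 ht01
    have hp0 : 0 < D.p t := hc.trans_le h2
    have h3 : D.p t ≤ |M| + 1 := by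
      have : |D.p t| ≤ M := by simpa using h1
      linarith [le_abs_self (D.p t), le_abs_self M]
    have h4 := hY2 t ht01 (by
      rw [abs_lt] at *
      constructor <;> linarith [ht.1, ht.2])
    have h5 : Real.exp (-C) ≤ Real.exp (H t) := Real.exp_le_exp.2 (abs_le.1 (hC t ht01)).1
    have h6 : Y t₀ * (Real.exp (H t) * Y t / D.p t) = Real.exp (H t) * (Y t₀ * Y t) / D.p t := by
      ring
    rw [hκ₁, h6]
    have h7 : 0 ≤ Y t₀ * Y t := le_trans (by positivity) h4
    gcongr
  refine ⟨κ₁ * Real.exp (-C), by positivity, η, hη, fun t ht htη => ?_⟩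
  have h0 : |t₀ - t₀| < η := by simpa using hη
  have key : κ₁ * (t - t₀) ^ 2 ≤ Real.exp (H t) * (Y t₀ * f t * (t - t₀)) := by
    rcases le_total t₀ t with hle | hle
    · have := hlow t₀ t ht₀ ht h0 htη hle
      rw [hf] at this
      nlinarith [mul_le_mul_of_nonneg_right this (sub_nonneg.2 hle)]
    · have := hlow t t₀ ht ht₀ htη h0 hle
      rw [hf] at this
      nlinarith [mul_le_mul_of_nonneg_right this (sub_nonneg.2 hle)]
  have h7 : Real.exp (H t) ≤ Real.exp C := Real.exp_le_exp.2 (abs_le.1 (hC t ht)).2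
  have h8 : 0 ≤ Y t₀ * f t * (t - t₀) := by
    by_contra hneg
    push Not at hneg
    have := mul_neg_of_pos_of_neg (Real.exp_pos (H t)) hneg
    nlinarith [sq_nonneg (t - t₀)]
  calc κ₁ * Real.exp (-C) * (t - t₀) ^ 2 = Real.exp (-C) * (κ₁ * (t - t₀) ^ 2) := by ring
    _ ≤ Real.exp (-C) * (Real.exp (H t) * (Y t₀ * f t * (t - t₀))) := by gcongr
    _ ≤ Real.exp (-C) * (Real.exp C * (Y t₀ * f t * (t - t₀))) := by gcongr
    _ = Y t₀ * f t * (t - t₀) := by rw [← mul_assoc, ← Real.exp_add]; simp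

end Problem

/-! ### Zeros of eigenfunctions and simplicity of eigenvalues. -/

lemma W12.norm_sq_deriv (z : W12) : ‖z.deriv‖ ^ 2 = ∫ t, ‖z.deriv t‖ ^ 2 ∂vol01 := by
  have h := inner_self_eq_norm_sq_to_K (𝕜 := ℂ) z.deriv
  rw [L2.inner_def] at h
  have e : ∫ t, inner ℂ (z.deriv t) (z.deriv t) ∂vol01 =
      ((∫ t, ‖z.deriv t‖ ^ 2 ∂vol01 : ℝ) : ℂ) := by
    rw [← integral_complex_ofReal]
    refine integral_congr_ae (Eventually.of_forall fun t => ?_)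
    simp [inner_self_eq_norm_sq_to_K]
  rw [e] at h
  exact Complex.ofReal_injective (by simpa using h.symm)

/-- Functions of class `W₂¹` are Hölder continuous with exponent `1/2`. -/
lemma W12.norm_sub_sq_le (z : W12) {s t : ℝ} (hs : s ∈ Icc (0 : ℝ) 1) (ht : t ∈ Icc (0 : ℝ) 1) :
    ‖z t - z s‖ ^ 2 ≤ |t - s| * ‖z.deriv‖ ^ 2 := by
  have hre : MemLp (fun t => (z.deriv t).re) 2 vol01 := (Lp.memLp z.deriv).re
  have him : MemLp (fun t => (z.deriv t).im) 2 vol01 := (Lp.memLp z.deriv).im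
  have h1 := sq_integral_le hre hs ht
  have h2 := sq_integral_le him hs ht
  rw [z.isPrim_re.integral hs ht] at h1
  rw [z.isPrim_im.integral hs ht] at h2
  have e : ‖z.deriv‖ ^ 2 = (∫ t, (z.deriv t).re ^ 2 ∂vol01) + ∫ t, (z.deriv t).im ^ 2 ∂vol01 := by
    rw [z.norm_sq_deriv, ← integral_add hre.integrable_sq him.integrable_sq]
    refine integral_congr_ae (Eventually.of_forall fun t => ?_)
    simp only [Complex.sq_norm, Complex.normSq_apply]; ring
  rw [e, Complex.sq_norm, Complex.normSq_apply, Complex.sub_re, Complex.sub_im]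
  nlinarith

namespace Problem

variable (D : Problem)

/-- `y` is the real function `f`, and `T(lam) y = 0`. -/
structure RealKer (lam : ℝ) (y : W12) (f g : ℝ → ℝ) : Prop where
  rep : RealRep y f g
  mem : y ∈ D.HU
  eq : ∀ z ∈ D.HU, D.form lam y z = 0

variable {D} {lam : ℝ} {y : W12} {f g : ℝ → ℝ}

lemma realKer_eq_zero (h : RealRep y f g) (h0 : ∀ t ∈ Icc (0 : ℝ) 1, f t = 0) : y = 0 := by
  refine W12.ext_fun fun t ht => ?_
  rw [h.val t ht, h0 t ht]
  exact ((W12.eval t).map_zero).symm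

namespace RealKer

lemma exists_isSol (h : D.RealKer lam y f g) :
    ∃ c σ Y, IsDensity (D.pot lam) c σ ∧ D.IsSol σ f g Y ∧
      (D.U 0 0 ≠ 1 → Y 0 = (c + D.V 0) * f 0) ∧ (D.U 1 1 ≠ 1 → Y 1 = -D.V 1 * f 1) := by
  obtain ⟨c, σ, hd⟩ := D.exists_density lam
  obtain ⟨Y, hY⟩ := D.exists_isSol hd h.rep h.eq
  exact ⟨c, σ, Y, hd, hY⟩

lemma apply_zero (h : D.RealKer lam y f g) (hU : D.U 0 0 = 1) : f 0 = 0 := by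
  have := (D.mem_HU.1 h.mem).1 hU
  rw [h.rep.val 0 (by simp)] at this
  exact_mod_cast this

/-- Without a Dirichlet condition at `0`, the boundary condition makes `Y 0` a multiple of `f 0`, so
`f 0 = 0` would annihilate the Cauchy data. -/
lemma dirichlet_zero (h : D.RealKer lam y f g) (hne : y ≠ 0) (h0 : f 0 = 0) : D.U 0 0 = 1 := by
  by_contra hU
  obtain ⟨c, σ, Y, hd, hs, hY, -⟩ := h.exists_isSol
  have hY := hY hU
  rw [h0, mul_zero] at hY
  exact hne (realKer_eq_zero h.rep (hs.eq_zero hd.mem (by simp) h0 hY))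

lemma dirichlet_one (h : D.RealKer lam y f g) (hne : y ≠ 0) (h1 : f 1 = 0) : D.U 1 1 = 1 := by
  by_contra hU
  obtain ⟨c, σ, Y, hd, hs, -, hY⟩ := h.exists_isSol
  have hY := hY hU
  rw [h1, mul_zero] at hY
  exact hne (realKer_eq_zero h.rep (hs.eq_zero hd.mem (by simp) h1 hY))

/-- This replaces simplicity of the zero, as `f` need not be differentiable at `t₀`. It makes zeros
isolated, forces a sign change, and bounds `|t - t₀|` by a multiple of `|f t|`. -/
lemma linear_at_zero (h : D.RealKer lam y f g) (hne : y ≠ 0) {t₀ : ℝ}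
    (ht₀ : t₀ ∈ Icc (0 : ℝ) 1) (hf : f t₀ = 0) :
    ∃ a : ℝ, ∃ η > 0, ∀ t ∈ Icc (0 : ℝ) 1, |t - t₀| < η →
      (t - t₀) ^ 2 ≤ a * f t * (t - t₀) := by
  obtain ⟨c, σ, Y, hd, hs, -, -⟩ := h.exists_isSol
  have hY : Y t₀ ≠ 0 := fun hY => hne (realKer_eq_zero h.rep (hs.eq_zero hd.mem ht₀ hf hY))
  obtain ⟨κ, hκ, η, hη, H⟩ := hs.linear_at_zero hd.mem ht₀ hf hY
  refine ⟨Y t₀ / κ, η, hη, fun t ht htη => ?_⟩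
  have := H t ht htη
  have e : Y t₀ / κ * f t * (t - t₀) = (Y t₀ * f t * (t - t₀)) / κ := by ring
  rw [e, le_div_iff₀ hκ]; linarith

lemma eventually_ne (h : D.RealKer lam y f g) (hne : y ≠ 0) {t₀ : ℝ}
    (ht₀ : t₀ ∈ Icc (0 : ℝ) 1) (hf : f t₀ = 0) :
    ∃ η > 0, ∀ t ∈ Icc (0 : ℝ) 1, |t - t₀| < η → t ≠ t₀ → f t ≠ 0 := by
  obtain ⟨a, η, hη, H⟩ := h.linear_at_zero hne ht₀ hf
  refine ⟨η, hη, fun t ht htη htt hft => ?_⟩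
  have := H t ht htη
  rw [hft] at this
  have : 0 < (t - t₀) ^ 2 := by
    have := sub_ne_zero.2 htt
    positivity
  linarith

lemma finite_zeros (h : D.RealKer lam y f g) (hne : y ≠ 0) :
    {t | t ∈ Icc (0 : ℝ) 1 ∧ f t = 0}.Finite := by
  by_contra hinf
  obtain ⟨t₀, ht₀, hacc⟩ := Set.Infinite.exists_accPt_of_subset_isCompact hinf isCompact_Icc
    (fun t ht => ht.1)
  have hcl : IsClosed {t | t ∈ Icc (0 : ℝ) 1 ∧ f t = 0} := by
    have := h.rep.prim.continuousOn.preimage_isClosed_of_isClosed isClosed_Icc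
      (isClosed_singleton (x := (0 : ℝ)))
    exact this
  have hf : f t₀ = 0 := (isClosed_iff_clusterPt.1 hcl t₀ hacc.clusterPt).2
  obtain ⟨η, hη, H⟩ := h.eventually_ne hne ht₀ hf
  rw [accPt_iff_nhds] at hacc
  obtain ⟨t, ⟨ht1, ht2⟩, ht3⟩ := hacc _ (Metric.ball_mem_nhds t₀ hη)
  exact H t ht2.1 ht1 ht3 ht2.2

lemma changesSignAt (h : D.RealKer lam y f g) (hne : y ≠ 0) {t₀ : ℝ}
    (ht₀ : t₀ ∈ Ioo (0 : ℝ) 1) (hf : f t₀ = 0) : ChangesSignAt f t₀ := by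
  obtain ⟨a, η, hη, H⟩ := h.linear_at_zero hne ⟨ht₀.1.le, ht₀.2.le⟩ hf
  refine ⟨min η (min t₀ (1 - t₀)), ?_, fun s₁ hs₁ s₂ hs₂ => ?_⟩
  · exact lt_min hη (lt_min ht₀.1 (sub_pos.2 ht₀.2))
  have m1 : min η (min t₀ (1 - t₀)) ≤ η := min_le_left _ _
  have m2 : min η (min t₀ (1 - t₀)) ≤ t₀ := (min_le_right _ _).trans (min_le_left _ _)
  have m3 : min η (min t₀ (1 - t₀)) ≤ 1 - t₀ := (min_le_right _ _).trans (min_le_right _ _)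
  have h1 := H s₁ ⟨by linarith [hs₁.1], by linarith [hs₁.2, ht₀.2]⟩
    (abs_lt.2 ⟨by linarith [hs₁.1], by linarith [hs₁.2]⟩)
  have h2 := H s₂ ⟨by linarith [hs₂.1, ht₀.1], by linarith [hs₂.2]⟩
    (abs_lt.2 ⟨by linarith [hs₂.1], by linarith [hs₂.2]⟩)
  have d1 : s₁ - t₀ < 0 := by linarith [hs₁.2]
  have d2 : 0 < s₂ - t₀ := by linarith [hs₂.1]
  have e1 : a * f s₁ < 0 := by nlinarith
  have e2 : 0 < a * f s₂ := by nlinarith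
  have e3 : a ^ 2 * (f s₁ * f s₂) < 0 := by
    have := mul_neg_of_neg_of_pos e1 e2
    linarith [show a ^ 2 * (f s₁ * f s₂) = a * f s₁ * (a * f s₂) by ring]
  by_contra hc
  push Not at hc
  exact absurd e3 (not_lt.2 (mul_nonneg (sq_nonneg a) hc))

/-- A function of class `W₂¹` vanishing at the zeros of `f` is controlled by `f`. -/
lemma exists_sq_le (h : D.RealKer lam y f g) (hne : y ≠ 0) (z : W12)
    (hz : ∀ t ∈ Icc (0 : ℝ) 1, f t = 0 → z t = 0) :
    ∃ C, 0 ≤ C ∧ ∀ t ∈ Icc (0 : ℝ) 1, ‖z t‖ ^ 2 ≤ C * |f t| := by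
  suffices H : ∃ C : ℝ, 0 ≤ C ∧ ∀ t ∈ Icc (0 : ℝ) 1, t ∈ Icc (0 : ℝ) 1 → ‖z t‖ ^ 2 ≤ C * |f t| by
    obtain ⟨C, hC, H⟩ := H
    exact ⟨C, hC, fun t ht => H t ht ht⟩
  -- Local bounds are glued by compactness. Near a zero `t₀`, the Hölder estimate `‖z t‖² ≤ |t - t₀|
  -- ‖z'‖²` meets `|t - t₀| ≤ |a| |f t|`; near other points `|f|` is bounded below.
  refine isCompact_Icc.induction_on
    (p := fun S => ∃ C : ℝ, 0 ≤ C ∧ ∀ t ∈ S, t ∈ Icc (0 : ℝ) 1 → ‖z t‖ ^ 2 ≤ C * |f t|)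
    ⟨0, le_rfl, by simp⟩ ?_ ?_ ?_
  · rintro s t hst ⟨C, hC, H⟩
    exact ⟨C, hC, fun x hx => H x (hst hx)⟩
  · rintro s t ⟨C, hC, H⟩ ⟨C', hC', H'⟩
    refine ⟨C + C', by positivity, ?_⟩
    rintro x (hx | hx) hx'
    · exact (H x hx hx').trans (by gcongr; linarith)
    · exact (H' x hx hx').trans (by gcongr; linarith)
  · intro t₀ ht₀
    by_cases hf : f t₀ = 0
    · obtain ⟨a, η, hη, H⟩ := h.linear_at_zero hne ht₀ hf
      refine ⟨_, mem_nhdsWithin_of_mem_nhds (Metric.ball_mem_nhds t₀ hη), |a| * ‖z.deriv‖ ^ 2,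
        by positivity, fun t ht ht' => ?_⟩
      have h1 := z.norm_sub_sq_le ht₀ ht'
      rw [hz t₀ ht₀ hf, sub_zero] at h1
      have h2 : |t - t₀| ≤ |a| * |f t| := by
        have h3 := H t ht' ht
        rcases eq_or_ne t t₀ with rfl | hne'
        · simp; positivity
        have h4 : 0 < |t - t₀| := abs_pos.2 (sub_ne_zero.2 hne')
        have h5 : a * f t * (t - t₀) ≤ |a| * |f t| * |t - t₀| := by
          rw [← abs_mul, ← abs_mul]; exact le_abs_self _
        rw [← sq_abs] at h3
        nlinarith
      calc _ ≤ _ := h1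
        _ ≤ |a| * |f t| * ‖z.deriv‖ ^ 2 := by gcongr
        _ = _ := by ring
    · have hc := h.rep.prim.continuousOn t₀ ht₀
      have hev : ∀ᶠ t in 𝓝[Icc 0 1] t₀, |f t₀| / 2 < |f t| := by
        refine hc.abs.eventually (lt_mem_nhds ?_)
        have := abs_pos.2 hf
        linarith
      refine ⟨_, hev, (3 * ‖z‖) ^ 2 * (2 / |f t₀|), by positivity, fun t ht _ => ?_⟩
      have h1 : ‖z t‖ ^ 2 ≤ (3 * ‖z‖) ^ 2 := by gcongr; exact z.norm_toFun_le t
      have h0 : 0 < |f t₀| := abs_pos.2 hf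
      have h2 : 1 ≤ 2 / |f t₀| * |f t| := by
        have ht : |f t₀| / 2 < |f t| := ht
        rw [div_mul_eq_mul_div, le_div_iff₀ h0]
        linarith
      nlinarith [sq_nonneg (3 * ‖z‖)]

/-- Two real solutions of the boundary value problem are proportional. -/
lemma proportional (h : D.RealKer lam y f g) (hne : y ≠ 0) {y₁ : W12} {f₁ g₁ : ℝ → ℝ}
    (h₁ : D.RealKer lam y₁ f₁ g₁) : ∃ a : ℝ, y₁ = (a : ℂ) • y := by
  obtain ⟨c, σ, hd⟩ := D.exists_density lam
  obtain ⟨Y, hs, hY, -⟩ := D.exists_isSol hd h.rep h.eq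
  obtain ⟨Y₁, hs₁, hY₁, -⟩ := D.exists_isSol hd h₁.rep h₁.eq
  -- The boundary condition at `0` leaves a one-dimensional space of Cauchy data there, and `y₁ - a
  -- y` has zero data.
  suffices H : ∃ a : ℝ, f₁ 0 = a * f 0 ∧ Y₁ 0 = a * Y 0 by
    obtain ⟨a, e1, e2⟩ := H
    refine ⟨a, W12.ext_fun fun t ht => ?_⟩
    have := (hs₁.comb hs 1 (-a)).eq_zero hd.mem (t₀ := 0) (by simp) (by rw [e1]; ring)
      (by rw [e2]; ring) t ht
    rw [W12.smul_toFun, h.rep.val t ht, h₁.rep.val t ht]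
    have : f₁ t = a * f t := by linarith
    rw [this]; push_cast; ring
  by_cases hU : D.U 0 0 = 1
  · have hf := h.apply_zero hU
    have hf₁ := h₁.apply_zero hU
    have hY0 : Y 0 ≠ 0 := fun hY0 =>
      hne (realKer_eq_zero h.rep (hs.eq_zero hd.mem (by simp) hf hY0))
    exact ⟨Y₁ 0 / Y 0, by rw [hf, hf₁]; ring, by field_simp⟩
  · have hf0 : f 0 ≠ 0 := fun hf0 => hU (h.dirichlet_zero hne hf0)
    refine ⟨f₁ 0 / f 0, by field_simp, ?_⟩
    rw [hY hU, hY₁ hU]; field_simp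

end RealKer

/-- `y` solves the boundary value problem with spectral parameter `lam`. -/
def InKer (D : Problem) (lam : ℂ) (y : D.HU) : Prop := ∀ z : D.HU, D.form lam y z = 0

lemma inKer_iff {lam : ℂ} {y : D.HU} : D.InKer lam y ↔ D.T lam y = 0 := by
  constructor
  · intro h
    ext z
    rw [T_apply, h z]; rfl
  · intro h z
    rw [← T_apply, h]; rfl

/-- The form is real on pairs of real functions, so `a(u, z) + i a(v, z) = 0` splits for real `z`;
antilinearity then gives all `z`. -/
lemma InKer.exists_re_im {y : D.HU} (h : D.InKer lam y) : ∃ u v : W12,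
    D.RealKer lam u (fun t => ((y : W12) t).re) (fun t => ((y : W12).deriv t).re) ∧
    D.RealKer lam v (fun t => ((y : W12) t).im) (fun t => ((y : W12).deriv t).im) ∧
    (y : W12) = u + Complex.I • v := by
  obtain ⟨u, hu⟩ := RealRep.exists_re (y : W12)
  obtain ⟨v, hv⟩ := RealRep.exists_im (y : W12)
  have hU := D.mem_HU.1 y.2
  have huU : u ∈ D.HU := by
    rw [D.mem_HU, hu.val 0 (by simp), hu.val 1 (by simp)]
    exact ⟨fun h => by simp [hU.1 h], fun h => by simp [hU.2 h]⟩
  have hvU : v ∈ D.HU := by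
    rw [D.mem_HU, hv.val 0 (by simp), hv.val 1 (by simp)]
    exact ⟨fun h => by simp [hU.1 h], fun h => by simp [hU.2 h]⟩
  have hsplit : y = (⟨u, huU⟩ : D.HU) + Complex.I • (⟨v, hvU⟩ : D.HU) :=
    Subtype.ext (RealRep.eq_re_add_im hu hv)
  have hreal : ∀ (z : D.HU) (f₁ g₁ : ℝ → ℝ), RealRep (z : W12) f₁ g₁ →
      D.form lam u z = 0 ∧ D.form lam v z = 0 := by
    intro z f₁ g₁ hz
    have e : D.T lam y z = 0 := h z
    rw [hsplit, map_add, map_smul, add_apply, smul_apply, T_apply, T_apply] at e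
    have e1 := D.form_im_realRep lam hu hz
    have e2 := D.form_im_realRep lam hv hz
    have r := congrArg Complex.re e
    have i := congrArg Complex.im e
    simp [e1, e2] at r i
    exact ⟨Complex.ext r e1, Complex.ext i e2⟩
  have hall : ∀ z : D.HU, D.form lam u z = 0 ∧ D.form lam v z = 0 := by
    intro z
    obtain ⟨a, ha⟩ := RealRep.exists_re (z : W12)
    obtain ⟨b, hb⟩ := RealRep.exists_im (z : W12)
    have hzU := D.mem_HU.1 z.2
    have haU : a ∈ D.HU := by
      rw [D.mem_HU, ha.val 0 (by simp), ha.val 1 (by simp)]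
      exact ⟨fun h => by simp [hzU.1 h], fun h => by simp [hzU.2 h]⟩
    have hbU : b ∈ D.HU := by
      rw [D.mem_HU, hb.val 0 (by simp), hb.val 1 (by simp)]
      exact ⟨fun h => by simp [hzU.1 h], fun h => by simp [hzU.2 h]⟩
    have hzs : z = (⟨a, haU⟩ : D.HU) + Complex.I • (⟨b, hbU⟩ : D.HU) :=
      Subtype.ext (RealRep.eq_re_add_im ha hb)
    have ha' := hreal ⟨a, haU⟩ _ _ ha
    have hb' := hreal ⟨b, hbU⟩ _ _ hb
    constructor
    · have : D.T lam ⟨u, huU⟩ z = 0 := by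
        rw [hzs, map_add, map_smulₛₗ, T_apply, T_apply, ha'.1, hb'.1]; simp
      exact this
    · have : D.T lam ⟨v, hvU⟩ z = 0 := by
        rw [hzs, map_add, map_smulₛₗ, T_apply, T_apply, ha'.2, hb'.2]; simp
      exact this
  exact ⟨u, v, ⟨hu, huU, fun z hz => (hall ⟨z, hz⟩).1⟩, ⟨hv, hvU, fun z hz => (hall ⟨z, hz⟩).2⟩,
    RealRep.eq_re_add_im hu hv⟩

/-- The eigenvalues are simple. -/
lemma InKer.proportional {e₁ e₂ : D.HU} (h₁ : D.InKer lam e₁) (hne : e₁ ≠ 0)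
    (h₂ : D.InKer lam e₂) : ∃ c : ℂ, e₂ = c • e₁ := by
  obtain ⟨u₁, v₁, hu₁, hv₁, e1⟩ := h₁.exists_re_im
  obtain ⟨u₂, v₂, hu₂, hv₂, e2⟩ := h₂.exists_re_im
  have hu : ∃ u f g, D.RealKer lam u f g ∧ u ≠ 0 := by
    by_cases hu0 : u₁ = 0
    · refine ⟨v₁, _, _, hv₁, fun hv0 => hne (Subtype.ext ?_)⟩
      rw [e1, hu0, hv0]; simp
    · exact ⟨u₁, _, _, hu₁, hu0⟩
  obtain ⟨u, f, g, hu, hu0⟩ := hu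
  obtain ⟨a₁, ha₁⟩ := hu.proportional hu0 hu₁
  obtain ⟨b₁, hb₁⟩ := hu.proportional hu0 hv₁
  obtain ⟨a₂, ha₂⟩ := hu.proportional hu0 hu₂
  obtain ⟨b₂, hb₂⟩ := hu.proportional hu0 hv₂
  have e1' : (e₁ : W12) = (a₁ + Complex.I * b₁ : ℂ) • u := by
    rw [e1, ha₁, hb₁, add_smul, mul_smul]
  have e2' : (e₂ : W12) = (a₂ + Complex.I * b₂ : ℂ) • u := by
    rw [e2, ha₂, hb₂, add_smul, mul_smul]
  have hs : (a₁ + Complex.I * b₁ : ℂ) ≠ 0 := fun h0 => hne (Subtype.ext (by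
    rw [e1', h0, zero_smul]; rfl))
  refine ⟨(a₂ + Complex.I * b₂) / (a₁ + Complex.I * b₁), Subtype.ext ?_⟩
  rw [Submodule.coe_smul, e1', e2', smul_smul, div_mul_cancel₀ _ hs]

end Problem

/-! ### Jacobi's factorisation and nonnegativity of the form. -/

lemma sqrt_sub_nonneg {x ε : ℝ} : 0 ≤ √(x ^ 2 + ε ^ 2) - ε :=
  sub_nonneg.2 (Real.le_sqrt_of_sq_le (by nlinarith [sq_nonneg x]))

lemma sqrt_sub_le {x ε : ℝ} (hε : 0 < ε) : √(x ^ 2 + ε ^ 2) - ε ≤ x ^ 2 / (2 * ε) := by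
  rw [sub_le_iff_le_add]
  refine Real.sqrt_le_iff.2 ⟨by positivity, ?_⟩
  have : (x ^ 2 / (2 * ε) + ε) ^ 2 = (x ^ 2 / (2 * ε)) ^ 2 + x ^ 2 + ε ^ 2 := by
    field_simp; ring
  nlinarith [sq_nonneg (x ^ 2 / (2 * ε))]

lemma sqrt_sub_le_abs {x ε : ℝ} (hε : 0 < ε) : √(x ^ 2 + ε ^ 2) - ε ≤ |x| := by
  rw [sub_le_iff_le_add]
  refine Real.sqrt_le_iff.2 ⟨by positivity, ?_⟩
  nlinarith [sq_abs x, abs_nonneg x]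

/-- Smoothed absolute values of functions of class `W₂¹`. -/
lemma W12.exists_smooth_abs (w : W12) {ε : ℝ} (hε : 0 < ε) : ∃ Φ φ g, RealRep Φ φ g ∧
    (∀ t, φ t = √(‖w t‖ ^ 2 + ε ^ 2) - ε) ∧ (∀ᵐ t ∂vol01, |g t| ≤ ‖w.deriv t‖) ∧
    W12.mul Φ Φ.cconj = W12.mul w w.cconj - ((2 * ε : ℝ) : ℂ) • Φ := by
  have hv := (w.isPrim_re.mul w.isPrim_re).add (w.isPrim_im.mul w.isPrim_im)
  have hnorm : ∀ t, ‖w t‖ ^ 2 = (w t).re * (w t).re + (w t).im * (w t).im := fun t => by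
    rw [Complex.sq_norm, Complex.normSq_apply]
  have hpos : ∀ t, 0 < (w t).re * (w t).re + (w t).im * (w t).im + ε ^ 2 := fun t => by
    rw [← hnorm]; positivity
  have hG := hv.comp (G := fun x => √(x + ε ^ 2)) fun t _ =>
    (Real.contDiffAt_sqrt (hpos t).ne').comp (g := Real.sqrt) (f := fun x => x + ε ^ 2) _
      (contDiffAt_id.add contDiffAt_const)
  have hφ := hG.sub (IsPrim.const ε)
  set g : ℝ → ℝ := fun t => ((w t).re * (w.deriv t).re + (w t).im * (w.deriv t).im) /
    √(‖w t‖ ^ 2 + ε ^ 2) with hg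
  have hφ' : IsPrim (fun t => √(‖w t‖ ^ 2 + ε ^ 2) - ε) g := by
    refine hφ.congr (fun t _ => by rw [hnorm]) (Eventually.of_forall fun t => ?_)
    have hd : HasDerivAt (fun x => √(x + ε ^ 2))
        (1 / (2 * √((w t).re * (w t).re + (w t).im * (w t).im + ε ^ 2)))
        ((w t).re * (w t).re + (w t).im * (w t).im) :=
      ((hasDerivAt_id _).add_const (ε ^ 2)).sqrt (hpos t).ne'
    have hs := (Real.sqrt_pos.2 (hpos t)).ne'
    simp only [hd.deriv, hg, hnorm]
    field_simp
    ring
  have hle : ∀ t, |g t| ≤ ‖w.deriv t‖ := by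
    intro t
    have hs : 0 < √(‖w t‖ ^ 2 + ε ^ 2) := Real.sqrt_pos.2 (by positivity)
    rw [hg, abs_div, abs_of_pos hs, div_le_iff₀ hs]
    have h1 : |(w t).re * (w.deriv t).re + (w t).im * (w.deriv t).im| ≤
        ‖w.deriv t‖ * ‖w t‖ := by
      have e : (w t).re * (w.deriv t).re + (w t).im * (w.deriv t).im =
          (w.deriv t * conj (w t)).re := by simp; ring
      rw [e]
      refine (Complex.abs_re_le_norm _).trans ?_
      rw [norm_mul, RCLike.norm_conj]
    refine h1.trans ?_
    gcongr
    exact Real.le_sqrt_of_sq_le (by nlinarith [sq_nonneg ε])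
  have hmem : MemLp g 2 vol01 := by
    refine (Lp.memLp w.deriv).of_le (hφ'.integrable.1) (Eventually.of_forall fun t => hle t)
  obtain ⟨Φ, hΦ⟩ := hφ'.exists_realRep hmem
  refine ⟨Φ, _, g, hΦ, fun t => rfl, Eventually.of_forall hle, W12.ext_fun fun t ht => ?_⟩
  rw [hΦ.cconj_eq, W12.sub_toFun, W12.smul_toFun, W12.mul_toFun _ _ ht.1, W12.mul_toFun _ _ ht.1,
    W12.cconj_toFun, hΦ.val t ht, Complex.mul_conj, Complex.normSq_eq_norm_sq]
  have hsq := Real.sq_sqrt (show 0 ≤ ‖w t‖ ^ 2 + ε ^ 2 by positivity)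
  set S := √(‖w t‖ ^ 2 + ε ^ 2)
  rw [← Complex.ofReal_mul, ← Complex.ofReal_mul, ← Complex.ofReal_sub]
  congr 1
  nlinarith

namespace Problem

variable {D : Problem} {lam : ℝ} {y : W12} {f g : ℝ → ℝ}

lemma integrable_p_norm_sq (D : Problem) (w : W12) :
    Integrable (fun t => D.p t * ‖w.deriv t‖ ^ 2) vol01 := by
  refine ((D.integrable_form w.deriv w.deriv).re).congr (Eventually.of_forall fun t => ?_)
  simp only [mul_assoc, Complex.mul_conj, Complex.normSq_eq_norm_sq]
  rw [← Complex.ofReal_mul]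
  exact RCLike.ofReal_re _

lemma form_self_re (lam : ℝ) (w : W12) : (D.form lam w w).re =
    (∫ t, D.p t * ‖w.deriv t‖ ^ 2 ∂vol01) + (D.pot lam (W12.mul w w.cconj)).re +
      (D.V 0 * ‖w 0‖ ^ 2 + D.V 1 * ‖w 1‖ ^ 2) := by
  have e : ∫ t, (D.p t : ℂ) * w.deriv t * conj (w.deriv t) ∂vol01 =
      ((∫ t, D.p t * ‖w.deriv t‖ ^ 2 ∂vol01 : ℝ) : ℂ) := by
    rw [← integral_complex_ofReal]
    refine integral_congr_ae (Eventually.of_forall fun t => ?_)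
    simp only [mul_assoc, Complex.mul_conj, Complex.normSq_eq_norm_sq]
    push_cast; rfl
  rw [form_eq, e]
  simp only [mul_assoc, Complex.mul_conj, Complex.normSq_eq_norm_sq]
  simp only [Complex.add_re, Complex.ofReal_re, ← Complex.ofReal_mul]

/-- The leading term does not increase since `|Φ'| ≤ |w'|`. The potential is a functional without
sign, so its term is compared through the exact identity `Φ² = |w|² - 2 ε Φ`, where `Φ` stays
bounded in `W₂¹` uniformly in `ε`. -/
lemma exists_form_smooth_abs_le (D : Problem) (lam : ℝ) (w : W12) : ∃ K : ℝ, ∀ ε > 0,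
    ∃ Φ φ g, RealRep Φ φ g ∧ (∀ t, φ t = √(‖w t‖ ^ 2 + ε ^ 2) - ε) ∧
      (D.form lam Φ Φ).re ≤ (D.form lam w w).re + K * ε := by
  -- Bounds `‖Φ‖` for every `ε`: `|Φ(0)| ≤ 3 ‖w‖`, `‖Φ'‖ ≤ ‖w'‖`, and `W12.norm_le` counts the
  -- derivative twice.
  set N := 5 * ‖w‖
  refine ⟨2 * (‖D.pot lam‖ * N + |D.V 0| * (3 * N) + |D.V 1| * (3 * N)), fun ε hε => ?_⟩
  obtain ⟨Φ, φ, g, hΦ, hφ, hg, hmul⟩ := w.exists_smooth_abs hε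
  refine ⟨Φ, φ, g, hΦ, hφ, ?_⟩
  have hN : ‖Φ‖ ≤ N := by
    refine (W12.norm_le Φ).trans ?_
    have h1 : ‖Φ.init‖ ≤ 3 * ‖w‖ := by
      rw [← W12.toFun_zero, hΦ.val 0 (by simp), Complex.norm_real, Real.norm_eq_abs, hφ,
        abs_of_nonneg sqrt_sub_nonneg]
      refine (sqrt_sub_le_abs hε).trans ?_
      rw [abs_norm]
      exact w.norm_toFun_le 0
    have h2 : ‖Φ.deriv‖ ≤ ‖w.deriv‖ := by
      refine Lp.norm_le_norm_of_ae_le ?_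
      filter_upwards [hΦ.der, hg] with t h1 h2
      rw [h1, Complex.norm_real]; exact h2
    have h3 := w.norm_deriv_le
    have h4 : ‖Φ.init‖ ≤ 3 * ‖w‖ := h1
    show _ ≤ 5 * ‖w‖
    linarith
  have hN0 : 0 ≤ N := by positivity
  have hval : ∀ t ∈ Icc (0 : ℝ) 1, ‖Φ t‖ ^ 2 = ‖w t‖ ^ 2 - 2 * ε * φ t := by
    intro t ht
    rw [hΦ.val t ht, Complex.norm_real, Real.norm_eq_abs, sq_abs, hφ]
    have hsq := Real.sq_sqrt (show 0 ≤ ‖w t‖ ^ 2 + ε ^ 2 by positivity)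
    nlinarith
  have hφle : ∀ t ∈ Icc (0 : ℝ) 1, |φ t| ≤ 3 * N := by
    intro t ht
    have := Φ.norm_toFun_le t
    rw [hΦ.val t ht, Complex.norm_real, Real.norm_eq_abs] at this
    linarith
  rw [form_self_re, form_self_re, hval 0 (by simp), hval 1 (by simp), hmul, map_sub, map_smul]
  have hint : ∫ t, D.p t * ‖Φ.deriv t‖ ^ 2 ∂vol01 ≤ ∫ t, D.p t * ‖w.deriv t‖ ^ 2 ∂vol01 := by
    refine integral_mono_ae (D.integrable_p_norm_sq Φ) (D.integrable_p_norm_sq w) ?_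
    obtain ⟨c, hc, hp⟩ := D.p_pos
    filter_upwards [hp, hΦ.der, hg] with t h1 h2 h3
    have h4 : ‖Φ.deriv t‖ ≤ ‖w.deriv t‖ := by rw [h2, Complex.norm_real]; exact h3
    have h5 := hc.le.trans h1
    gcongr
  have hpot : |(D.pot lam Φ).re| ≤ ‖D.pot lam‖ * N :=
    (Complex.abs_re_le_norm _).trans (((D.pot lam).le_opNorm Φ).trans (by gcongr))
  have hV : ∀ k, ∀ t ∈ Icc (0 : ℝ) 1, -(|D.V k| * (3 * N)) ≤ D.V k * φ t := by
    intro k t ht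
    refine (neg_le_of_abs_le ?_)
    rw [abs_mul]
    gcongr
    exact hφle t ht
  have hV0 := hV 0 0 (by simp)
  have hV1 := hV 1 1 (by simp)
  have hpot' := neg_le_of_abs_le hpot
  have e : (((2 * ε : ℝ) : ℂ) • (D.pot lam Φ)).re = 2 * ε * (D.pot lam Φ).re := by
    rw [smul_eq_mul, Complex.re_ofReal_mul]
  rw [Complex.sub_re, e]
  nlinarith [mul_le_mul_of_nonneg_left hpot' hε.le, mul_le_mul_of_nonneg_left hV0 hε.le,
    mul_le_mul_of_nonneg_left hV1 hε.le]

/-- Pointwise part of the Jacobi identity. -/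
lemma jacobi_aux {C δ φ γ f g : ℝ} (hδ : 0 < δ) (hC : 0 ≤ C) (hφ : |φ| ≤ C * f ^ 2) :
    -(δ ^ 2 * (C ^ 2 * g ^ 2)) ≤ γ * γ - g * ((γ * φ + φ * γ) * (f / (f ^ 2 + δ ^ 2)) +
      φ * φ * ((δ ^ 2 - f ^ 2) / (f ^ 2 + δ ^ 2) ^ 2 * g)) ∧
    |(γ * φ + φ * γ) - (g * (φ * φ * (f / (f ^ 2 + δ ^ 2))) +
      f * ((γ * φ + φ * γ) * (f / (f ^ 2 + δ ^ 2)) +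
        φ * φ * ((δ ^ 2 - f ^ 2) / (f ^ 2 + δ ^ 2) ^ 2 * g)))| ≤
      δ ^ 2 * (2 * C * |γ| + 2 * C ^ 2 * (|f| * |g|)) ∧
    |φ * φ - f * (φ * φ * (f / (f ^ 2 + δ ^ 2)))| ≤ δ ^ 2 * (C ^ 2 * f ^ 2) := by
  set q := f ^ 2 + δ ^ 2 with hq
  have hq0 : 0 < q := by positivity
  have hfq : f ^ 2 ≤ q := by rw [hq]; nlinarith [sq_nonneg δ]
  -- The three expressions are the integrands against `p` and `σ` and the boundary terms in `a(w, w)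
  -- - a(y, w² f/(f² + δ²))`. In terms of `a`, which `|φ| ≤ C f²` bounds by `C`, the first is a
  -- square minus a multiple of `δ²`, and the other two are multiples of `δ²`.
  set a := φ / q with ha
  have hφa : φ = a * q := by rw [ha]; field_simp
  have haC : |a| ≤ C := by
    rw [ha, abs_div, abs_of_pos hq0, div_le_iff₀ hq0]
    exact hφ.trans (by gcongr)
  have ha2 : a ^ 2 ≤ C ^ 2 := by rw [← sq_abs]; gcongr
  refine ⟨?_, ?_, ?_⟩
  · have e : γ * γ - g * ((γ * φ + φ * γ) * (f / q) + φ * φ * ((δ ^ 2 - f ^ 2) / q ^ 2 * g)) =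
        (γ - a * g * f) ^ 2 - δ ^ 2 * (a ^ 2 * g ^ 2) := by
      rw [hφa]; field_simp; ring
    rw [e]
    have : δ ^ 2 * (a ^ 2 * g ^ 2) ≤ δ ^ 2 * (C ^ 2 * g ^ 2) := by gcongr
    nlinarith [sq_nonneg (γ - a * g * f)]
  · have e : (γ * φ + φ * γ) - (g * (φ * φ * (f / q)) + f * ((γ * φ + φ * γ) * (f / q) +
        φ * φ * ((δ ^ 2 - f ^ 2) / q ^ 2 * g))) =
        δ ^ 2 * (2 * a * γ - 2 * a ^ 2 * (f * g)) := by
      rw [hφa]; field_simp; rw [hq]; ring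
    rw [e, abs_mul, abs_of_nonneg (sq_nonneg δ)]
    gcongr
    refine (abs_sub _ _).trans ?_
    rw [abs_mul, abs_mul, abs_mul, abs_mul, abs_mul, abs_of_nonneg (sq_nonneg a)]
    simp only [abs_two]
    gcongr
  · have e : φ * φ - f * (φ * φ * (f / q)) = δ ^ 2 * (a * φ) := by
      rw [hφa]; field_simp; rw [hq]; ring
    rw [e, abs_mul, abs_mul, abs_of_nonneg (sq_nonneg δ), sq C, mul_assoc]
    gcongr

lemma nonneg_of_forall_le {x K : ℝ} (h : ∀ δ > 0, 0 ≤ x + K * δ) : 0 ≤ x := by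
  by_contra hx
  push Not at hx
  have h1 := h (-x / (2 * (|K| + 1))) (by have := abs_nonneg K; apply div_pos <;> linarith)
  have h2 : K * (-x / (2 * (|K| + 1))) ≤ -x / 2 := by
    have : 0 < |K| + 1 := by positivity
    rw [← mul_div_assoc, div_le_div_iff₀ (by positivity) (by positivity)]
    nlinarith [le_abs_self K]
  linarith

lemma neg_integral_le {k a b c d : ℝ → ℝ} (hk : Integrable k vol01) (ha : Integrable a vol01)
    (hb : Integrable b vol01) (hc : Integrable c vol01) (hd : Integrable d vol01)
    (h : ∀ᵐ t ∂vol01, -k t ≤ a t + b t - (c t + d t)) :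
    -∫ t, k t ∂vol01 ≤ ((∫ t, a t ∂vol01) + ∫ t, b t ∂vol01) -
      ((∫ t, c t ∂vol01) + ∫ t, d t ∂vol01) := by
  rw [← integral_add ha hb, ← integral_add hc hd, ← integral_sub, ← integral_neg]
  · exact integral_mono_ae hk.neg ((ha.add hb).sub (hc.add hd)) h
  · exact ha.add hb
  · exact hc.add hd

/-- Formally `a(y, w²/f) = 0`, hence `a(w, w) = a(w, w) - a(y, w²/f) = ∫ p (w' - w f'/f)² ≥ 0`. With
`1/f` regularised to `f/(f² + δ²)` the test function is admissible, and the quadratic bound on `φ`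
keeps the error of order `δ²`. -/
lemma RealKer.form_nonneg_of_abs_le (h : D.RealKer lam y f g) {w : W12} {φ γ : ℝ → ℝ}
    (hw : RealRep w φ γ) (hwU : w ∈ D.HU) {C : ℝ} (hC : 0 ≤ C)
    (hφ : ∀ t ∈ Icc (0 : ℝ) 1, |φ t| ≤ C * f t ^ 2) : 0 ≤ (D.form lam w w).re := by
  obtain ⟨c, σ, hd⟩ := D.exists_density lam
  have hy := h.rep
  have hfc := hy.prim.continuousOn
  set B : ℝ → ℝ := fun t =>
    D.p t * (C ^ 2 * g t ^ 2) + |σ t| * (2 * C * |γ t| + 2 * C ^ 2 * (|f t| * |g t|)) with hB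
  have hBi : Integrable B vol01 := by
    have i1 : Integrable (fun t => D.p t * (C ^ 2 * g t ^ 2)) vol01 := by
      refine (((D.memLp_p_mul hy.mem).integrable_mul hy.mem).const_mul (C ^ 2)).congr
        (Eventually.of_forall fun t => ?_)
      simp only [Pi.mul_apply]; ring
    have m1 : MemLp (fun t => |f t| * |g t|) 2 vol01 :=
      memLp_continuousOn_mul hfc.abs hy.mem.norm
    have m2 : MemLp (fun t => 2 * C * |γ t| + 2 * C ^ 2 * (|f t| * |g t|)) 2 vol01 :=
      (hw.mem.norm.const_mul (2 * C)).add (m1.const_mul (2 * C ^ 2))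
    exact i1.add (hd.mem.norm.integrable_mul m2)
  set K : ℝ := (∫ t, B t ∂vol01) + |c| * (C ^ 2 * f 0 ^ 2) + |D.V 0| * (C ^ 2 * f 0 ^ 2) +
    |D.V 1| * (C ^ 2 * f 1 ^ 2) with hK
  have key : ∀ δ > 0, 0 ≤ (D.form lam w w).re + K * δ ^ 2 := by
    intro δ hδ
    have hpos : ∀ x : ℝ, x ^ 2 + δ ^ 2 ≠ 0 := fun x => by positivity
    have hderiv : ∀ x : ℝ, deriv (fun x : ℝ => x / (x ^ 2 + δ ^ 2)) x =
        (δ ^ 2 - x ^ 2) / (x ^ 2 + δ ^ 2) ^ 2 := by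
      intro x
      have := (hasDerivAt_id x).div (((hasDerivAt_id x).pow 2).add_const (δ ^ 2)) (hpos x)
      refine this.deriv.trans ?_
      simp; ring
    have hη := hy.prim.comp (G := fun x => x / (x ^ 2 + δ ^ 2)) fun t _ =>
      ContDiffAt.div (f := fun x => x) (g := fun x => x ^ 2 + δ ^ 2) contDiffAt_id
        ((contDiffAt_id.pow 2).add contDiffAt_const) (hpos _)
    simp only [hderiv] at hη
    have hηm : MemLp (fun t => (δ ^ 2 - f t ^ 2) / (f t ^ 2 + δ ^ 2) ^ 2 * g t) 2 vol01 := by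
      refine memLp_continuousOn_mul ?_ hy.mem
      refine ContinuousOn.div (by fun_prop) (by fun_prop) fun t _ => ?_
      have := hpos (f t)
      positivity
    obtain ⟨H, hH⟩ := hη.exists_realRep hηm
    have hψ := (hw.mul hw).mul hH
    have hψU : W12.mul (W12.mul w w) H ∈ D.HU := by
      have := D.mem_HU.1 hwU
      rw [D.mem_HU]
      simp only [W12.mul_toFun _ _ le_rfl, W12.mul_toFun _ _ zero_le_one]
      exact ⟨fun h => by rw [this.1 h]; ring, fun h => by rw [this.2 h]; ring⟩
    have e0 := h.eq _ hψU
    rw [D.form_realRep hd hy hψ] at e0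
    have e0 := Complex.ofReal_eq_zero.1 e0
    have e1 := congrArg Complex.re (D.form_realRep hd hw hw)
    rw [Complex.ofReal_re] at e1
    have i1 := D.integrable_p_mul_mul hw.mem hw.mem
    have i2 := hd.integrable_mul (hw.mul hw).mem
    have i3 := D.integrable_p_mul_mul hy.mem hψ.mem
    have i4 := hd.integrable_mul (hy.mul hψ).mem
    have hI : -(δ ^ 2 * ∫ t, B t ∂vol01) ≤ ((∫ t, D.p t * γ t * γ t ∂vol01) +
        ∫ t, σ t * (γ t * φ t + φ t * γ t) ∂vol01) - ((∫ t, D.p t * g t *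
        ((γ t * φ t + φ t * γ t) * (f t / (f t ^ 2 + δ ^ 2)) +
          φ t * φ t * ((δ ^ 2 - f t ^ 2) / (f t ^ 2 + δ ^ 2) ^ 2 * g t)) ∂vol01) +
        ∫ t, σ t * (g t * (φ t * φ t * (f t / (f t ^ 2 + δ ^ 2))) +
          f t * ((γ t * φ t + φ t * γ t) * (f t / (f t ^ 2 + δ ^ 2)) +
          φ t * φ t * ((δ ^ 2 - f t ^ 2) / (f t ^ 2 + δ ^ 2) ^ 2 * g t))) ∂vol01) := by
      rw [← integral_const_mul]
      refine neg_integral_le (hBi.const_mul _) i1 i2 i3 i4 ?_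
      obtain ⟨p₀, hp₀, hp⟩ := D.p_pos
      filter_upwards [hp, ae_vol01_of_forall hφ] with t ht1 ht2
      obtain ⟨j1, j2, -⟩ := jacobi_aux (γ := γ t) (g := g t) hδ hC ht2
      have j3 := mul_le_mul_of_nonneg_left j1 (hp₀.le.trans ht1)
      have j4 := mul_le_mul_of_nonneg_left j2 (abs_nonneg (σ t))
      rw [← abs_mul] at j4
      have j5 := neg_le_of_abs_le j4
      simp only [hB]
      linarith
    obtain ⟨-, -, j0⟩ := jacobi_aux (γ := γ 0) (g := g 0) hδ hC (hφ 0 (by simp))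
    obtain ⟨-, -, j1⟩ := jacobi_aux (γ := γ 1) (g := g 1) hδ hC (hφ 1 (by simp))
    have hb : ∀ {a x b : ℝ}, |x| ≤ b → -(|a| * b) ≤ a * x := by
      intro a x b hx
      refine neg_le_of_abs_le ?_
      rw [abs_mul]
      gcongr
    have k1 := hb (a := c) j0
    have k2 := hb (a := D.V 0) j0
    have k3 := hb (a := D.V 1) j1
    rw [e1, hK]
    linarith
  refine nonneg_of_forall_le (K := K) fun δ hδ => ?_
  have := key (√δ) (Real.sqrt_pos.2 hδ)
  rwa [Real.sq_sqrt hδ.le] at this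

/-- The quadratic form is nonnegative on functions vanishing at the zeros of a real solution. -/
lemma RealKer.form_nonneg (h : D.RealKer lam y f g) (hne : y ≠ 0) {z : W12} (hzU : z ∈ D.HU)
    (hz : ∀ t ∈ Icc (0 : ℝ) 1, f t = 0 → z t = 0) : 0 ≤ (D.form lam z z).re := by
  -- Only `|z|² ≤ C |f|` is available, while `form_nonneg_of_abs_le` needs a bound by `f²`. As `√(x²
  -- + ε²) - ε ≤ x²/(2ε)`, one smoothing gives `Φ ≤ C |f|/(2ε)` and a second one `Ψ ≤ (C/(2ε))²
  -- f²/(2δ)`. The constant `K'` depends on `Φ`, so `δ` tends to `0` before `ε`.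
  obtain ⟨C, hC, hCz⟩ := h.exists_sq_le hne z hz
  obtain ⟨K, hK⟩ := D.exists_form_smooth_abs_le lam z
  refine nonneg_of_forall_le (K := K) fun ε hε => ?_
  obtain ⟨Φ, φ, γ, hΦ, hφ, hle⟩ := hK ε hε
  refine le_trans ?_ hle
  obtain ⟨K', hK'⟩ := D.exists_form_smooth_abs_le lam Φ
  refine nonneg_of_forall_le (K := K') fun δ hδ => ?_
  obtain ⟨Ψ, ψ, γ', hΨ, hψ, hle'⟩ := hK' δ hδ
  refine le_trans ?_ hle'
  have h0 : ∀ t ∈ Icc (0 : ℝ) 1, z t = 0 → Φ t = 0 := by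
    intro t ht h0
    rw [hΦ.val t ht, hφ, h0]
    simp [Real.sqrt_sq hε.le]
  have h1 : ∀ t ∈ Icc (0 : ℝ) 1, z t = 0 → Ψ t = 0 := by
    intro t ht h1
    rw [hΨ.val t ht, hψ, h0 t ht h1]
    simp [Real.sqrt_sq hδ.le]
  have hU : Ψ ∈ D.HU := by
    have := D.mem_HU.1 hzU
    rw [D.mem_HU]
    exact ⟨fun h => h1 0 (by simp) (this.1 h), fun h => h1 1 (by simp) (this.2 h)⟩
  refine h.form_nonneg_of_abs_le hΨ hU (C := (C / (2 * ε)) ^ 2 / (2 * δ)) (by positivity)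
    fun t ht => ?_
  rw [hψ, abs_of_nonneg sqrt_sub_nonneg]
  refine (sqrt_sub_le hδ).trans ?_
  rw [div_mul_eq_mul_div, ← sq_abs (f t), ← mul_pow]
  gcongr
  rw [hΦ.val t ht, Complex.norm_real, Real.norm_eq_abs, hφ, abs_of_nonneg sqrt_sub_nonneg]
  refine (sqrt_sub_le hε).trans ?_
  rw [div_mul_eq_mul_div]
  gcongr
  exact hCz t ht

end Problem

/-! ### Coercivity up to finitely many functionals. -/

section Abstract

variable {H : Type*} [NormedAddCommGroup H] [NormedSpace ℂ H]

lemma re_form_add_real_smul (B : H →L[ℂ] H →L⋆[ℂ] ℂ) (hB : ∀ x y, conj (B x y) = B y x)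
    (x y : H) (t : ℝ) : (B (x + (t : ℂ) • y) (x + (t : ℂ) • y)).re =
      (B x x).re + 2 * t * (B x y).re + t ^ 2 * (B y y).re := by
  have e : (B y x).re = (B x y).re := by rw [← hB x y, Complex.conj_re]
  simp only [map_add, map_smul, map_smulₛₗ, add_apply, smul_apply, smul_eq_mul,
    Complex.conj_ofReal, Complex.add_re, Complex.re_ofReal_mul, e]
  ring

/-- A nonnegative closed form which is coercive up to finitely many functionals is coercive or has
a kernel. -/
lemma coercive_or_exists_ker [CompleteSpace H] (B : H →L[ℂ] H →L⋆[ℂ] ℂ)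
    (hB : ∀ x y, conj (B x y) = B y x) (M : Submodule ℂ H) (hM : IsClosed (M : Set H))
    (hpos : ∀ x ∈ M, 0 ≤ (B x x).re) {κ : Type*} [Fintype κ] (L : H →L[ℂ] (κ → ℂ)) {c C : ℝ}
    (hc : 0 < c) (hL : ∀ x, c * ‖x‖ ^ 2 - C * ‖L x‖ ^ 2 ≤ (B x x).re) :
    (∃ δ > 0, ∀ x ∈ M, δ * ‖x‖ ^ 2 ≤ (B x x).re) ∨ ∃ x ∈ M, x ≠ 0 ∧ ∀ y ∈ M, B x y = 0 := by
  by_cases hco : ∃ δ > 0, ∀ x ∈ M, δ * ‖x‖ ^ 2 ≤ (B x x).re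
  · exact Or.inl hco
  right
  push Not at hco
  have hcont : Continuous fun x => (B x x).re := by
    refine Complex.continuous_re.comp (continuous_iff_continuousAt.2 fun a => ?_)
    rw [ContinuousAt, tendsto_iff_norm_sub_tendsto_zero]
    have h0 : Tendsto (fun x => ‖B (x - a)‖ * ‖x‖ + ‖B a (x - a)‖) (𝓝 a) (𝓝 0) := by
      have : Continuous fun x => ‖B (x - a)‖ * ‖x‖ + ‖B a (x - a)‖ := by fun_prop
      simpa using this.tendsto a
    refine squeeze_zero (fun x => norm_nonneg _) (fun x => ?_) h0
    have e : B x x - B a a = B (x - a) x + B a (x - a) := by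
      rw [map_sub, map_sub, sub_apply]; ring
    rw [e]
    exact (norm_add_le _ _).trans (by gcongr; exact (B (x - a)).le_opNorm x)
  -- Failure of coercivity yields unit vectors along which the form tends to `0`. A subsequence on
  -- which the finite-dimensional part `L` converges turns out to be Cauchy, and its limit spans the
  -- kernel sought.
  have hseq : ∀ n : ℕ, ∃ x ∈ M, ‖x‖ = 1 ∧ (B x x).re < 1 / ((n : ℝ) + 1) := by
    intro n
    obtain ⟨x, hx, hlt⟩ := hco (1 / ((n : ℝ) + 1)) (by positivity)
    have hx0 : x ≠ 0 := by
      rintro rfl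
      simp at hlt
    have hn : 0 < ‖x‖ := norm_pos_iff.2 hx0
    refine ⟨((‖x‖⁻¹ : ℝ) : ℂ) • x, M.smul_mem _ hx, ?_, ?_⟩
    · rw [norm_smul, Complex.norm_real, norm_inv, norm_norm, inv_mul_cancel₀ hn.ne']
    · have := re_form_add_real_smul B hB 0 x ‖x‖⁻¹
      simp only [zero_add, map_zero, zero_apply, Complex.zero_re, mul_zero] at this
      rw [this, inv_pow, inv_mul_lt_iff₀ (by positivity)]
      linarith
  choose u hu hu1 huB using hseq
  have hLu : ∀ n, L (u n) ∈ Metric.closedBall (0 : κ → ℂ) ‖L‖ := by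
    intro n
    rw [mem_closedBall_zero_iff]
    simpa [hu1] using L.le_opNorm (u n)
  obtain ⟨a, -, φ, hφ, ha⟩ := (isCompact_closedBall (0 : κ → ℂ) ‖L‖).tendsto_subseq hLu
  have hB0 : Tendsto (fun n => (B (u (φ n)) (u (φ n))).re) atTop (𝓝 0) := by
    refine (squeeze_zero (fun n => hpos _ (hu n)) (fun n => (huB n).le)
      tendsto_one_div_add_atTop_nhds_zero_nat).comp hφ.tendsto_atTop
  have hcau : CauchySeq fun n => u (φ n) := by
    rw [Metric.cauchySeq_iff']
    intro ε hε
    have hη : 0 < √(c * ε ^ 2 / (4 * (|C| + 1))) := Real.sqrt_pos.2 (by positivity)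
    have hev := hB0.eventually (gt_mem_nhds (show 0 < c * ε ^ 2 / 8 by positivity))
    obtain ⟨N₁, hN₁⟩ := eventually_atTop.1 hev
    obtain ⟨N₂, hN₂⟩ : ∃ N₂, ∀ m ≥ N₂, ∀ n ≥ N₂,
        dist (L (u (φ m))) (L (u (φ n))) < √(c * ε ^ 2 / (4 * (|C| + 1))) := by
      exact Metric.cauchySeq_iff.1 ha.cauchySeq _ hη
    refine ⟨max N₁ N₂, fun n hn => ?_⟩
    have b1 := hN₁ n ((le_max_left _ _).trans hn)
    have b2 := hN₁ (max N₁ N₂) (le_max_left _ _)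
    have b3 := hN₂ n ((le_max_right _ _).trans hn) (max N₁ N₂) (le_max_right _ _)
    set x := u (φ n)
    set y := u (φ (max N₁ N₂))
    -- Parallelogram identity: nonnegativity at `x + y` gives `B(x - y) ≤ 2 B(x) + 2 B(y)`, and `hL`
    -- turns this into a bound on `‖x - y‖`.
    have p1 := hpos (x + ((1 : ℝ) : ℂ) • y) (M.add_mem (hu _) (M.smul_mem _ (hu _)))
    have e1 := re_form_add_real_smul B hB x y 1
    have e2 := re_form_add_real_smul B hB x y (-1)
    have hxy : x + ((-1 : ℝ) : ℂ) • y = x - y := by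
      push_cast; rw [neg_one_smul, sub_eq_add_neg]
    rw [hxy] at e2
    have h1 := hL (x - y)
    rw [map_sub, ← dist_eq_norm (L x) (L y)] at h1
    have h2 : dist (L x) (L y) ^ 2 < c * ε ^ 2 / (4 * (|C| + 1)) := by
      have := pow_lt_pow_left₀ b3 dist_nonneg two_ne_zero
      rwa [Real.sq_sqrt (by positivity)] at this
    have h3 : C * dist (L x) (L y) ^ 2 ≤ c * ε ^ 2 / 4 := by
      have hC : C ≤ |C| + 1 := by linarith [le_abs_self C]
      calc C * dist (L x) (L y) ^ 2 ≤ (|C| + 1) * dist (L x) (L y) ^ 2 := by gcongr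
        _ ≤ (|C| + 1) * (c * ε ^ 2 / (4 * (|C| + 1))) := by gcongr
        _ = c * ε ^ 2 / 4 := by field_simp
    rw [dist_eq_norm]
    have h4 : c * ‖x - y‖ ^ 2 < c * ε ^ 2 := by
      have : 0 < c * ε ^ 2 := by positivity
      linarith
    exact lt_of_pow_lt_pow_left₀ 2 hε.le (lt_of_mul_lt_mul_left h4 hc.le)
  obtain ⟨x, hx⟩ := cauchySeq_tendsto_of_complete hcau
  have hxM : x ∈ M := hM.mem_of_tendsto hx (Eventually.of_forall fun n => hu _)
  have hx1 : ‖x‖ = 1 := by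
    refine tendsto_nhds_unique hx.norm ?_
    simp [hu1]
  have hBx : (B x x).re = 0 := tendsto_nhds_unique ((hcont.tendsto x).comp hx) hB0
  have hre : ∀ y ∈ M, (B x y).re = 0 := by
    intro y hy
    -- As `B x x` vanishes, `t ↦ B(x + t y)` is a nonnegative quadratic without constant term, so
    -- its linear coefficient is `0`.
    have := discrim_le_zero (a := (B y y).re) (b := 2 * (B x y).re) (c := 0) fun t => by
      have h1 := hpos _ (M.add_mem hxM (M.smul_mem (t : ℂ) hy))
      rw [re_form_add_real_smul B hB, hBx] at h1
      nlinarith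
    rw [discrim] at this
    nlinarith [sq_nonneg (B x y).re]
  refine ⟨x, hxM, fun h0 => by simp [h0] at hx1, fun y hy => Complex.ext (hre y hy) ?_⟩
  have := hre _ (M.smul_mem Complex.I hy)
  rw [map_smulₛₗ] at this
  simpa using this

end Abstract

namespace Problem

variable {D : Problem}

/-- By Young's inequality, `σ · 2 Re (z' z̄)` costs half of `p₀ ‖z'‖²` plus a multiple of `S ∫ σ²`;
the point terms are bounded by multiples of `S`. -/
lemma exists_form_ge (D : Problem) (lam : ℝ) : ∃ c > 0, ∃ C, 0 ≤ C ∧ ∀ (z : W12) (S : ℝ),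
    (∀ t ∈ Icc (0 : ℝ) 1, ‖z t‖ ^ 2 ≤ S) →
      c * ‖z.deriv‖ ^ 2 - C * S ≤ (D.form lam z z).re := by
  obtain ⟨p₀, hp₀, hp⟩ := D.p_pos
  obtain ⟨c, σ, hd⟩ := D.exists_density lam
  set Q := ∫ t, σ t ^ 2 ∂vol01
  refine ⟨p₀ / 2, by positivity, 2 / p₀ * Q + |c| + |D.V 0| + |D.V 1|, ?_, fun z S hS => ?_⟩
  · have : 0 ≤ Q := integral_nonneg fun t => sq_nonneg _
    positivity
  have hS0 := hS 0 (by simp)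
  have hS1 := hS 1 (by simp)
  have hmul : (W12.mul z z.cconj).deriv =ᵐ[vol01]
      fun t => ((2 * (z.deriv t * conj (z t)).re : ℝ) : ℂ) := by
    filter_upwards [W12.coeFn_deriv_mul z z.cconj, W12.cconj_eq z] with t h1 h2
    rw [h1, h2, W12.cconj_toFun]
    apply Complex.ext <;> simp <;> ring
  have hint : Integrable (fun t => σ t * (2 * (z.deriv t * conj (z t)).re)) vol01 := by
    refine hd.mem.integrable_mul (((Lp.memLp (W12.mul z z.cconj).deriv).re).ae_eq ?_)
    filter_upwards [hmul] with t ht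
    rw [ht]; exact RCLike.ofReal_re (K := ℂ) _
  have e1 : (D.pot lam (W12.mul z z.cconj)).re = c * ‖z 0‖ ^ 2 +
      ∫ t, σ t * (2 * (z.deriv t * conj (z t)).re) ∂vol01 := by
    have h0 : (W12.mul z z.cconj).init = ((‖z 0‖ ^ 2 : ℝ) : ℂ) := by
      rw [← W12.toFun_zero, W12.mul_toFun _ _ le_rfl, W12.cconj_toFun, Complex.mul_conj,
        Complex.normSq_eq_norm_sq]
    have h1 : ∫ t, (σ t : ℂ) * (W12.mul z z.cconj).deriv t ∂vol01 =
        ((∫ t, σ t * (2 * (z.deriv t * conj (z t)).re) ∂vol01 : ℝ) : ℂ) := by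
      rw [← integral_complex_ofReal]
      refine integral_congr_ae ?_
      filter_upwards [hmul] with t ht
      rw [ht]; push_cast; rfl
    rw [hd.eq, h0, h1, ← Complex.ofReal_mul, ← Complex.ofReal_add, Complex.ofReal_re]
  have e2 : p₀ * ‖z.deriv‖ ^ 2 ≤ ∫ t, D.p t * ‖z.deriv t‖ ^ 2 ∂vol01 := by
    rw [z.norm_sq_deriv, ← integral_const_mul]
    refine integral_mono_ae ((Lp.memLp z.deriv).norm.integrable_sq.const_mul p₀)
      (D.integrable_p_norm_sq z) ?_
    filter_upwards [hp] with t ht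
    gcongr
  have e3 : -(p₀ / 2 * ‖z.deriv‖ ^ 2 + 2 / p₀ * Q * S) ≤
      ∫ t, σ t * (2 * (z.deriv t * conj (z t)).re) ∂vol01 := by
    have i1 : Integrable (fun t => p₀ / 2 * ‖z.deriv t‖ ^ 2) vol01 :=
      (Lp.memLp z.deriv).norm.integrable_sq.const_mul _
    have i2 : Integrable (fun t => 2 / p₀ * S * σ t ^ 2) vol01 :=
      hd.mem.integrable_sq.const_mul _
    have e : p₀ / 2 * ‖z.deriv‖ ^ 2 + 2 / p₀ * Q * S =
        ∫ t, (p₀ / 2 * ‖z.deriv t‖ ^ 2 + 2 / p₀ * S * σ t ^ 2) ∂vol01 := by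
      rw [integral_add i1 i2, integral_const_mul, integral_const_mul, ← z.norm_sq_deriv]
      ring
    rw [e, ← integral_neg]
    refine integral_mono_ae (i1.add i2).neg hint ?_
    filter_upwards [ae_vol01_of_forall hS] with t ht
    have h1 : |(z.deriv t * conj (z t)).re| ≤ ‖z.deriv t‖ * ‖z t‖ := by
      refine (Complex.abs_re_le_norm _).trans ?_
      rw [norm_mul, RCLike.norm_conj]
    have h2 : |σ t * (2 * (z.deriv t * conj (z t)).re)| ≤
        2 * (|σ t| * (‖z.deriv t‖ * ‖z t‖)) := by
      rw [abs_mul, abs_mul, abs_two]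
      nlinarith [abs_nonneg (σ t), mul_le_mul_of_nonneg_left h1 (abs_nonneg (σ t))]
    have h3 : 2 * (|σ t| * (‖z.deriv t‖ * ‖z t‖)) ≤
        p₀ / 2 * ‖z.deriv t‖ ^ 2 + 2 / p₀ * ‖z t‖ ^ 2 * σ t ^ 2 := by
      have e : p₀ / 2 * ‖z.deriv t‖ ^ 2 + 2 / p₀ * ‖z t‖ ^ 2 * σ t ^ 2 -
          2 * (|σ t| * (‖z.deriv t‖ * ‖z t‖)) =
          p₀ / 2 * (‖z.deriv t‖ - 2 / p₀ * (|σ t| * ‖z t‖)) ^ 2 := by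
        rw [← sq_abs (σ t)]; field_simp; ring
      have : 0 ≤ p₀ / 2 * (‖z.deriv t‖ - 2 / p₀ * (|σ t| * ‖z t‖)) ^ 2 := by positivity
      linarith
    have h4 : 2 / p₀ * ‖z t‖ ^ 2 * σ t ^ 2 ≤ 2 / p₀ * S * σ t ^ 2 := by gcongr
    have := neg_le_of_abs_le (h2.trans (h3.trans (add_le_add_right h4 _)))
    exact this
  have hb : ∀ {a x : ℝ}, 0 ≤ x → x ≤ S → -(|a| * S) ≤ a * x := by
    intro a x hx hxS
    refine neg_le_of_abs_le ?_
    rw [abs_mul, abs_of_nonneg hx]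
    gcongr
  have k1 := hb (a := c) (sq_nonneg _) hS0
  have k2 := hb (a := D.V 0) (sq_nonneg _) hS0
  have k3 := hb (a := D.V 1) (sq_nonneg _) hS1
  rw [form_self_re, e1]
  linarith

/-- The form is coercive up to finitely many point evaluations. -/
lemma exists_garding (D : Problem) (lam : ℝ) : ∃ (N : ℕ) (L : D.HU →L[ℂ] (Fin (N + 1) → ℂ)),
    ∃ c > 0, ∃ C, ∀ z : D.HU, c * ‖z‖ ^ 2 - C * ‖L z‖ ^ 2 ≤ (D.form lam z z).re := by
  obtain ⟨c, hc, C, hC, H⟩ := D.exists_form_ge lam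
  -- With the grid points `k/N`, the Hölder estimate gives `|z|² ≤ 2 ‖L z‖² + (2/N) ‖z'‖²`. The term
  -- `4C/c` ensures `2C/N ≤ c/2`, and the added `1` ensures `2/N ≤ 2`. Then `‖z‖² ≤ 3 ‖z'‖² + 2 ‖L
  -- z‖²`, whence the constants `c/6` and `2C + c/3`.
  obtain ⟨N, hN⟩ := exists_nat_gt (4 * C / c + 1)
  have hC4 : 0 ≤ 4 * C / c := by positivity
  have hN0 : (0 : ℝ) < N := by linarith
  let L : D.HU →L[ℂ] (Fin (N + 1) → ℂ) :=
    ContinuousLinearMap.pi fun k => (W12.eval (k / N)).comp D.HU.subtypeL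
  refine ⟨N, L, c / 6, by positivity, 2 * C + c / 3, fun z => ?_⟩
  have hLk : ∀ k : Fin (N + 1), ‖(z : W12) (k / N)‖ ≤ ‖L z‖ := fun k =>
    norm_le_pi_norm (L z) k
  set d := ‖(z : W12).deriv‖
  have hS : ∀ t ∈ Icc (0 : ℝ) 1, ‖(z : W12) t‖ ^ 2 ≤ 2 * ‖L z‖ ^ 2 + 2 / N * d ^ 2 := by
    intro t ht
    have hk : ⌊t * N⌋₊ < N + 1 := by
      have : ⌊t * N⌋₊ ≤ N := Nat.floor_le_of_le (by nlinarith [ht.2])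
      omega
    have h1 := hLk ⟨_, hk⟩
    simp only at h1
    set s : ℝ := (⌊t * N⌋₊ : ℝ) / N
    have hst : s ≤ t := by
      rw [div_le_iff₀ hN0]
      exact Nat.floor_le (mul_nonneg ht.1 hN0.le)
    have hs0 : 0 ≤ s := by positivity
    have hts : t - s ≤ 1 / N := by
      have := (Nat.lt_floor_add_one (t * N)).le
      have e : t - s = (t * N - ⌊t * N⌋₊) / N := by
        simp only [s]; field_simp
      rw [e]
      gcongr
      linarith
    have h2 := (z : W12).norm_sub_sq_le (s := s) (t := t) ⟨hs0, hst.trans ht.2⟩ ht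
    rw [abs_of_nonneg (sub_nonneg.2 hst)] at h2
    have h3 : (t - s) * d ^ 2 ≤ 1 / N * d ^ 2 := by gcongr
    have h4 : ‖(z : W12) t‖ ≤ ‖(z : W12) s‖ + ‖(z : W12) t - (z : W12) s‖ := norm_le_insert' _ _
    have h5 : ‖(z : W12) t‖ ^ 2 ≤ 2 * ‖(z : W12) s‖ ^ 2 + 2 * ‖(z : W12) t - (z : W12) s‖ ^ 2 := by
      nlinarith [sq_nonneg (‖(z : W12) s‖ - ‖(z : W12) t - (z : W12) s‖),
        norm_nonneg ((z : W12) t)]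
    have h6 : ‖(z : W12) s‖ ^ 2 ≤ ‖L z‖ ^ 2 := by gcongr
    have e : 2 / (N : ℝ) * d ^ 2 = 2 * (1 / N * d ^ 2) := by ring
    rw [e]
    linarith
  have h1 := H z _ hS
  have hN1 : C * (2 / N) ≤ c / 2 := by
    rw [← mul_div_assoc, div_le_iff₀ hN0]
    have : 4 * C / c ≤ N := by linarith
    rw [div_le_iff₀ hc] at this
    linarith
  have hNl : 2 / (N : ℝ) ≤ 2 := by
    rw [div_le_iff₀ hN0]; linarith
  have h2 : ‖z‖ ^ 2 ≤ d ^ 2 + (2 * ‖L z‖ ^ 2 + 2 / N * d ^ 2) := by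
    have e : ‖z‖ ^ 2 = d ^ 2 + ‖(z : W12).toL2‖ ^ 2 := (z : W12).norm_sq
    rw [e]
    have hP : 0 ≤ 2 * ‖L z‖ ^ 2 + 2 / N * d ^ 2 := by positivity
    have h3 : ‖(z : W12).toL2‖ ≤ √(2 * ‖L z‖ ^ 2 + 2 / N * d ^ 2) := by
      have := Lp.norm_le_of_ae_bound (f := (z : W12).toL2)
        (C := √(2 * ‖L z‖ ^ 2 + 2 / N * d ^ 2)) (Real.sqrt_nonneg _)
        (by
          filter_upwards [(z : W12).coeFn_toL2, ae_vol01_of_forall hS] with t ht ht'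
          rw [ht]
          exact Real.le_sqrt_of_sq_le ht')
      simpa [measureUnivNNReal] using this
    have h4 := pow_le_pow_left₀ (norm_nonneg _) h3 2
    rw [Real.sq_sqrt hP] at h4
    linarith
  have h3 : ‖z‖ ^ 2 ≤ 3 * d ^ 2 + 2 * ‖L z‖ ^ 2 := by
    nlinarith [mul_le_mul_of_nonneg_right hNl (sq_nonneg d)]
  nlinarith [mul_le_mul_of_nonneg_right hN1 (sq_nonneg d), mul_le_mul_of_nonneg_left h3 hc.le]

/-! ### Variational construction of eigenvalues. -/

lemma isPositiveAt_iff {ξ : ℝ} :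
    D.IsPositiveAt ξ ↔ ∀ y : D.HU, y ≠ 0 → 0 < (D.form ξ y y).re := by
  simp only [IsPositiveAt, inner_IplusT]

/-- `∫ r |z|²`. -/
def weight (D : Problem) (z : W12) : ℝ := (D.r (W12.mul z z.cconj)).re

lemma r_mul_cconj (z : W12) : D.r (W12.mul z z.cconj) = (D.weight z : ℂ) := by
  refine Complex.ext (by simp [weight]) ?_
  rw [Complex.ofReal_im]
  refine D.r_real _ fun t ht => ?_
  rw [W12.mul_toFun _ _ ht.1, W12.cconj_toFun, Complex.mul_conj, Complex.ofReal_im]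

lemma form_self_affine (lam mu : ℝ) (z : W12) :
    (D.form mu z z).re = (D.form lam z z).re + (lam - mu) * D.weight z := by
  rw [D.form_sub_form lam mu, r_mul_cconj, ← Complex.ofReal_sub, ← Complex.ofReal_mul,
    Complex.add_re, Complex.ofReal_re]

lemma abs_weight_le (z : W12) : |D.weight z| ≤ 64 * ‖D.r‖ * ‖z‖ ^ 2 := by
  refine (Complex.abs_re_le_norm _).trans ((D.r.le_opNorm _).trans ?_)
  have h1 := W12.norm_mul_le' z z.cconj
  have h2 := z.norm_cconj_le
  have h3 : ‖W12.mul z z.cconj‖ ≤ 64 * ‖z‖ ^ 2 := by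
    nlinarith [norm_nonneg z]
  calc _ ≤ ‖D.r‖ * (64 * ‖z‖ ^ 2) := by gcongr
    _ = _ := by ring

/-- The first critical value of the spectral parameter on a closed subspace. -/
lemma exists_critical {ξ lam : ℝ} (hξ : D.IsPositiveAt ξ) (hlam : ξ < lam) (M : Submodule ℂ D.HU)
    (hM : IsClosed (M : Set D.HU)) {z : D.HU} (hzM : z ∈ M) (hz0 : z ≠ 0)
    (hz : (D.form lam z z).re ≤ 0) :
    ∃ mu : ℝ, ξ < mu ∧ mu ≤ lam ∧ ∃ e ∈ M, e ≠ 0 ∧ ∀ w ∈ M, D.form mu e w = 0 := by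
  rw [isPositiveAt_iff] at hξ
  -- The critical `mu` is the last parameter up to `lam` whose form is nonnegative on `M`. Were that
  -- form coercive on `M`, either `mu = lam`, contrary to the choice of `z`, or `mu` could be
  -- increased a little, the weight being bounded by `‖x‖²`. So the form has a kernel on `M`.
  let Λ : Set ℝ := {mu | mu ∈ Icc ξ lam ∧ ∀ x ∈ M, 0 ≤ (D.form mu x x).re}
  have hΛc : IsCompact Λ := by
    refine isCompact_Icc.of_isClosed_subset ?_ (fun mu h => h.1)
    refine isClosed_Icc.inter ?_
    have e : {mu : ℝ | ∀ x ∈ M, 0 ≤ (D.form mu (x : W12) x).re} =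
        ⋂ x ∈ M, {mu : ℝ | 0 ≤ (D.form mu (x : W12) x).re} := by
      ext mu
      simp only [mem_iInter]
      rfl
    change IsClosed {mu : ℝ | ∀ x ∈ M, 0 ≤ (D.form mu (x : W12) x).re}
    rw [e]
    refine isClosed_biInter fun x _ => ?_
    have e2 : (fun mu : ℝ => (D.form mu (x : W12) x).re) =
        fun mu => (D.form ξ (x : W12) x).re + (ξ - mu) * D.weight x :=
      funext fun mu => form_self_affine ξ mu x
    refine isClosed_le continuous_const ?_
    rw [e2]
    fun_prop
  have hξΛ : ξ ∈ Λ := by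
    refine ⟨⟨le_rfl, hlam.le⟩, fun x _ => ?_⟩
    rcases eq_or_ne x 0 with rfl | hx
    · have : D.T ξ 0 0 = 0 := by rw [map_zero]
      rw [T_apply] at this
      rw [this, Complex.zero_re]
    · exact (hξ x hx).le
  obtain ⟨mu, hmuΛ, hmax⟩ := hΛc.exists_isGreatest ⟨ξ, hξΛ⟩
  obtain ⟨N, L, c, hc, C, hL⟩ := D.exists_garding mu
  rcases coercive_or_exists_ker (D.T mu) (fun x y => D.form_conj mu x y) M hM hmuΛ.2 L hc hL with
    ⟨δ, hδ, hco⟩ | ⟨e, heM, he0, he⟩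
  · exfalso
    have hco : ∀ x ∈ M, δ * ‖x‖ ^ 2 ≤ (D.form mu (x : W12) x).re := hco
    rcases hmuΛ.1.2.eq_or_lt with heq | hlt
    · have h1 := hco z hzM
      rw [heq] at h1
      have : 0 < δ * ‖z‖ ^ 2 := by
        have := norm_pos_iff.2 hz0
        positivity
      linarith
    · set R := 64 * ‖D.r‖ + 1
      have hR : 0 < R := by positivity
      set η := min (lam - mu) (δ / R)
      have hη : 0 < η := lt_min (sub_pos.2 hlt) (by positivity)
      have hη1 : η ≤ lam - mu := min_le_left _ _
      have hη2 : η * R ≤ δ := by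
        rw [← le_div_iff₀ hR]; exact min_le_right _ _
      have : mu + η ∈ Λ := by
        refine ⟨⟨by linarith [hmuΛ.1.1], by linarith⟩, fun x hx => ?_⟩
        rw [form_self_affine mu]
        have h1 := hco x hx
        have h2 : |D.weight x| ≤ R * ‖x‖ ^ 2 := by
          refine (abs_weight_le (x : W12)).trans ?_
          have : ‖(x : W12)‖ = ‖x‖ := rfl
          rw [this]
          gcongr
          simp [R]
        have h3 : η * D.weight x ≤ δ * ‖x‖ ^ 2 := by
          calc η * D.weight x ≤ η * (R * ‖x‖ ^ 2) := by
                gcongr; exact (le_abs_self _).trans h2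
            _ = η * R * ‖x‖ ^ 2 := by ring
            _ ≤ _ := by gcongr
        linarith
      linarith [hmax this]
  · refine ⟨mu, lt_of_le_of_ne hmuΛ.1.1 ?_, hmuΛ.1.2, e, heM, he0, he⟩
    rintro rfl
    have h1 := hξ e he0
    have h2 : D.form ξ (e : W12) e = 0 := he e heM
    rw [h2, Complex.zero_re] at h1
    exact lt_irrefl _ h1

/-- Vectors orthogonal for two forms of the pencil are orthogonal for all of them. -/
lemma form_eq_zero_of_two {l₁ l₂ : ℝ} (hl : l₁ ≠ l₂) {x y : W12} (h₁ : D.form l₁ x y = 0)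
    (h₂ : D.form l₂ x y = 0) (mu : ℝ) : D.form mu x y = 0 := by
  rw [D.form_sub_form l₁ l₂, h₁, zero_add] at h₂
  have hne : (l₁ : ℂ) - l₂ ≠ 0 := sub_ne_zero.2 (by exact_mod_cast hl)
  have hr := (mul_eq_zero.1 h₂).resolve_left hne
  rw [D.form_sub_form l₁ mu, h₁, hr]; simp

lemma InKer.form_eq_zero' {l : ℝ} {e : D.HU} (h : D.InKer l e) (z : D.HU) :
    D.form l z e = 0 := by
  rw [← D.form_conj, h z, map_zero]

lemma InKer.orthogonal {l l' : ℝ} {e e' : D.HU} (h : D.InKer l e) (h' : D.InKer l' e')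
    (hl : l ≠ l') (mu : ℝ) : D.form mu e e' = 0 :=
  form_eq_zero_of_two hl (h e') (h'.form_eq_zero' e) mu

/-- The value on `e` is affine in the parameter, positive at `ξ` and zero at `l`, hence negative
beyond `l`. -/
lemma InKer.form_self_pos_neg {ξ l lam : ℝ} (hξ : D.IsPositiveAt ξ) {e : D.HU}
    (h : D.InKer l e) (he : e ≠ 0) (hl : ξ < l) (hlam : l < lam) :
    (D.form lam e e).re < 0 := by
  have h0 := isPositiveAt_iff.1 hξ e he
  rw [form_self_affine l, h e, Complex.zero_re] at h0 ⊢
  have : 0 < D.weight e := by nlinarith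
  nlinarith

/-- An eigenvector orthogonal to given ones. -/
lemma exists_inKer {ξ lam : ℝ} (hξ : D.IsPositiveAt ξ) (hlam : ξ < lam) {ι : Type*} [Fintype ι]
    (l : ι → ℝ) (hinj : Function.Injective l) (e : ι → D.HU) (he : ∀ i, D.InKer (l i) (e i))
    (he0 : ∀ i, e i ≠ 0) (hlξ : ∀ i, ξ < l i) {z : D.HU} (hz0 : z ≠ 0)
    (hze : ∀ i, D.form ξ z (e i) = 0) (hz : (D.form lam z z).re ≤ 0) :
    ∃ mu : ℝ, ξ < mu ∧ mu ≤ lam ∧ ∃ x : D.HU, x ≠ 0 ∧ D.InKer mu x ∧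
      ∀ i, D.form ξ x (e i) = 0 := by
  let M : Submodule ℂ D.HU :=
    { carrier := {x | ∀ i, D.T ξ x (e i) = 0}
      add_mem' := fun {a b} ha hb i => by rw [map_add, add_apply, ha i, hb i, add_zero]
      zero_mem' := fun i => by rw [map_zero]; rfl
      smul_mem' := fun c x hx i => by rw [map_smul, smul_apply, hx i, smul_zero] }
  have hM : IsClosed (M : Set D.HU) := by
    change IsClosed {x | ∀ i, D.T ξ x (e i) = 0}
    simp only [Set.ofPred_forall]
    refine isClosed_iInter fun i => isClosed_eq ?_ continuous_const
    exact (continuous_eval_const (e i)).comp (D.T ξ).continuous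
  obtain ⟨mu, h1, h2, x, hxM, hx0, hx⟩ := exists_critical hξ hlam M hM hze hz0 hz
  refine ⟨mu, h1, h2, x, hx0, fun w => ?_, hxM⟩
  have hξ' := isPositiveAt_iff.1 hξ
  have hne : ∀ i, D.T ξ (e i) (e i) ≠ 0 := by
    intro i h0
    have := hξ' (e i) (he0 i)
    rw [← T_apply, h0, Complex.zero_re] at this
    exact lt_irrefl _ this
  -- So far `x` is annihilated only against `M`, so `w` is split by the `ξ`-orthogonal projection
  -- `v` onto the span of the `e i`. Against `e i`, the vector `x` is orthogonal both at `ξ` (as `x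
  -- ∈ M`) and at `l i` (as `e i` is an eigenvector), hence at `mu`.
  set v : D.HU := ∑ i, (D.T ξ w (e i) / D.T ξ (e i) (e i)) • e i with hv
  have hwv : w - v ∈ M := by
    intro j
    rw [map_sub, sub_apply, hv, map_sum, sum_apply, Finset.sum_eq_single j]
    · rw [map_smul, smul_apply, smul_eq_mul, div_mul_cancel₀ _ (hne j), sub_self]
    · intro i _ hij
      have : D.T ξ (e i) (e j) = 0 := (he i).orthogonal (he j) (hinj.ne hij) ξ
      rw [map_smul, smul_apply, this, smul_zero]
    · exact fun h => absurd (Finset.mem_univ j) h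
  have h3 : D.T mu x (w - v) = 0 := hx _ hwv
  have h4 : D.T mu x v = 0 := by
    rw [hv, map_sum]
    refine Finset.sum_eq_zero fun i _ => ?_
    have : D.T mu x (e i) = 0 :=
      form_eq_zero_of_two (hlξ i).ne (hxM i) ((he i).form_eq_zero' x) mu
    rw [map_smulₛₗ, this, smul_zero]
  have h5 : D.T mu x w = D.T mu x (w - v) + D.T mu x v := by rw [← map_add, sub_add_cancel]
  rw [← T_apply, h5, h3, h4, add_zero]

/-- Eigenvalues between `ξ` and `lam` are at most as many as the functionals on whose kernel the
form is nonnegative. -/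
lemma card_le_of_form_nonneg {ξ lam : ℝ} (hξ : D.IsPositiveAt ξ) {ι κ : Type*} [Fintype ι]
    [Fintype κ] (l : ι → ℝ) (hinj : Function.Injective l) (e : ι → D.HU)
    (he : ∀ i, D.InKer (l i) (e i)) (he0 : ∀ i, e i ≠ 0) (hlξ : ∀ i, ξ < l i)
    (hl : ∀ i, l i < lam) (L : D.HU →ₗ[ℂ] (κ → ℂ))
    (hL : ∀ z, L z = 0 → 0 ≤ (D.form lam z z).re) : Fintype.card ι ≤ Fintype.card κ := by
  classical
  by_contra hlt
  push Not at hlt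
  -- With more eigenvectors than functionals, `L` kills a nontrivial combination. Orthogonality
  -- makes its form the sum of `‖c i‖²` times negative numbers.
  have hker : LinearMap.ker (L.comp (Fintype.linearCombination ℂ e)) ≠ ⊥ :=
    LinearMap.ker_ne_bot_of_finrank_lt (by simpa using hlt)
  obtain ⟨c, hc, hc0⟩ := Submodule.exists_mem_ne_zero_of_ne_bot hker
  have hz := hL _ (LinearMap.mem_ker.1 hc)
  set z := Fintype.linearCombination ℂ e c with hzdef
  have hexp : D.T lam z z = ∑ i, ((‖c i‖ ^ 2 * (D.form lam (e i) (e i)).re : ℝ) : ℂ) := by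
    have hs : D.T lam z = ∑ i, c i • D.T lam (e i) := by
      rw [hzdef, Fintype.linearCombination_apply, map_sum]
      simp_rw [map_smul]
    rw [hs, sum_apply]
    refine Finset.sum_congr rfl fun i _ => ?_
    rw [smul_apply, hzdef, Fintype.linearCombination_apply, map_sum, Finset.sum_eq_single i]
    · rw [map_smulₛₗ, T_apply, smul_eq_mul, smul_eq_mul, ← mul_assoc, Complex.mul_conj,
        Complex.normSq_eq_norm_sq, Complex.ofReal_mul]
      congr 1
      exact Complex.ext (by simp) (by simp [D.form_self_im])
    · intro j _ hji
      have : D.T lam (e i) (e j) = 0 := (he i).orthogonal (he j) (hinj.ne hji.symm) lam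
      rw [map_smulₛₗ, this, smul_zero]
    · exact fun h => absurd (Finset.mem_univ i) h
  have hneg : (D.T lam z z).re < 0 := by
    rw [hexp, ← Complex.ofReal_sum, Complex.ofReal_re]
    have hle : ∀ i, ‖c i‖ ^ 2 * (D.form lam (e i) (e i)).re ≤ 0 := fun i =>
      mul_nonpos_of_nonneg_of_nonpos (sq_nonneg _)
        ((he i).form_self_pos_neg hξ (he0 i) (hlξ i) (hl i)).le
    obtain ⟨i, hi⟩ := Function.ne_iff.1 hc0
    refine Finset.sum_neg' (fun i _ => hle i) ⟨i, Finset.mem_univ i, ?_⟩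
    have hi' : 0 < ‖c i‖ := norm_pos_iff.2 hi
    exact mul_neg_of_pos_of_neg (by positivity)
      ((he i).form_self_pos_neg hξ (he0 i) (hlξ i) (hl i))
  rw [T_apply] at hneg
  linarith

end Problem

/-! ### Counting zeros against eigenvalues. -/

/-- Cutting a function off to the left of one of its zeros. -/
lemma RealRep.exists_cut {y : W12} {f g : ℝ → ℝ} (h : RealRep y f g) {τ : ℝ}
    (hτ : τ < 0 ∨ τ ∈ Icc (0 : ℝ) 1 ∧ f τ = 0) :
    ∃ u, RealRep u ((Ioi τ).indicator f) ((Ioi τ).indicator g) := by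
  have hm : MemLp ((Ioi τ).indicator g) 2 vol01 := h.mem.indicator measurableSet_Ioi
  refine IsPrim.exists_realRep ?_ hm
  -- For `τ < 0` nothing is cut off on `[0,1]`; this case supplies the whole function alongside the
  -- cut ones.
  rcases hτ with hτ | ⟨hτ, hf⟩
  · have hin : ∀ t ∈ Icc (0 : ℝ) 1, t ∈ Ioi τ := fun t ht => hτ.trans_le ht.1
    refine h.prim.congr (fun t ht => (indicator_of_mem (hin t ht) f).symm) ?_
    exact ae_vol01_of_forall fun t ht => (indicator_of_mem (hin t ht) g).symm
  · have hp := IsPrim.primitive (hm.integrable (by norm_num)) 0 hτ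
    refine hp.congr (fun t ht => ?_) (by rfl)
    rcases le_or_gt t τ with hle | hlt
    · have e : ∫ s in τ..t, (Ioi τ).indicator g s = ∫ s in τ..t, (0 : ℝ) := by
        refine intervalIntegral.integral_congr fun s hs => ?_
        rw [uIcc_of_ge hle] at hs
        exact indicator_of_notMem (not_lt.2 hs.2) g
      rw [e, indicator_of_notMem (show t ∉ Ioi τ from not_lt.2 hle)]
      simp
    · have e : ∫ s in τ..t, (Ioi τ).indicator g s = ∫ s in τ..t, g s := by
        refine intervalIntegral.integral_congr_ae (Eventually.of_forall fun s hs => ?_)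
        rw [uIoc_of_le hlt.le] at hs
        exact indicator_of_mem hs.1 g
      rw [e, h.prim.integral hτ ht, hf, indicator_of_mem (show t ∈ Ioi τ from hlt)]
      simp

namespace Problem

variable {D : Problem} {lam : ℝ} {y : W12} {f g : ℝ → ℝ}

lemma RealKer.cut_mem (h : D.RealKer lam y f g) {τ : ℝ} {u : W12}
    (hu : RealRep u ((Ioi τ).indicator f) ((Ioi τ).indicator g)) : u ∈ D.HU := by
  have hU := D.mem_HU.1 h.mem
  rw [h.rep.val 0 (by simp), h.rep.val 1 (by simp)] at hU
  rw [D.mem_HU, hu.val 0 (by simp), hu.val 1 (by simp)]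
  have aux : ∀ s, (f s : ℂ) = 0 → (((Ioi τ).indicator f s : ℝ) : ℂ) = 0 := by
    intro s hs
    have : f s = 0 := by exact_mod_cast hs
    simp [indicator, this]
  exact ⟨fun h => aux 0 (hU.1 h), fun h => aux 1 (hU.2 h)⟩

/-- The pieces of a solution between its zeros are isotropic and mutually orthogonal. -/
lemma RealKer.form_cut (h : D.RealKer lam y f g) {τ τ' : ℝ} {u u' : W12}
    (hu : RealRep u ((Ioi τ).indicator f) ((Ioi τ).indicator g))
    (hu' : RealRep u' ((Ioi τ').indicator f) ((Ioi τ').indicator g)) :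
    D.form lam u u' = 0 := by
  wlog hle : τ ≤ τ' generalizing τ τ' u u'
  · rw [← D.form_conj, this hu' hu (le_of_not_ge hle), map_zero]
  obtain ⟨c, σ, hd⟩ := D.exists_density lam
  have h0 := h.eq _ (h.cut_mem hu')
  -- On the support of `u'` the function `u` coincides with the whole solution, so the form equals
  -- that of `y` and `u'`, which is `0`.
  have aux : ∀ (a b : ℝ → ℝ) s,
      (Ioi τ).indicator a s * (Ioi τ').indicator b s = a s * (Ioi τ').indicator b s := by
    intro a b s
    by_cases hs : s ∈ Ioi τ'
    · rw [indicator_of_mem (show s ∈ Ioi τ from lt_of_le_of_lt hle hs)]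
    · rw [indicator_of_notMem hs, mul_zero, mul_zero]
  rw [D.form_realRep hd h.rep hu'] at h0
  rw [D.form_realRep hd hu hu', ← h0]
  simp only [mul_assoc, aux]

lemma exists_gt_notMem {W : Set ℝ} (hW : W.Finite) (a : ℝ) : ∃ s > a, ∀ w ∈ W, a < w → s < w := by
  have h1 : ∀ᶠ s in 𝓝[>] a, ∀ w ∈ W, a < w → s < w := by
    refine (Filter.eventually_all_finite hW).2 fun w _ => ?_
    by_cases haw : a < w
    · exact (eventually_nhdsWithin_of_eventually_nhds (gt_mem_nhds haw)).mono fun s hs _ => hs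
    · exact Eventually.of_forall fun s h => absurd h haw
  obtain ⟨s, hs1, hs2⟩ := (h1.and self_mem_nhdsWithin).exists
  exact ⟨s, hs2, hs1⟩

/-- There are more eigenvalues up to `lam` than interior zeros of a solution. -/
lemma RealKer.card_zeros_lt (h : D.RealKer lam y f g) (hne : y ≠ 0) {ξ : ℝ}
    (hξ : D.IsPositiveAt ξ) (hlam : ξ < lam) (Z : Finset ℝ)
    (hZ : ∀ t ∈ Z, t ∈ Ioo (0 : ℝ) 1 ∧ f t = 0) (E : Finset ℝ)
    (hE : ∀ mu : ℝ, mu ∈ E ↔ ξ < mu ∧ mu ≤ lam ∧ D.IsEigenvalue mu) : Z.card < E.card := by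
  by_contra hcard
  push Not at hcard
  have hnot : (-1 : ℝ) ∉ Z := fun hm => by
    have := (hZ _ hm).1.1
    linarith
  -- The point `-1` stands for the uncut solution, so there is one function more than zeros. This
  -- leaves a nontrivial combination `z` orthogonal at `ξ` to the eigenfunctions.
  set Z' := insert (-1 : ℝ) Z with hZ'
  have hcut : ∀ τ : Z', ∃ u, RealRep u ((Ioi (τ : ℝ)).indicator f)
      ((Ioi (τ : ℝ)).indicator g) := by
    rintro ⟨τ, hτ⟩
    refine h.rep.exists_cut ?_
    rcases Finset.mem_insert.1 hτ with rfl | hτ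
    · left; norm_num
    · exact Or.inr ⟨⟨(hZ τ hτ).1.1.le, (hZ τ hτ).1.2.le⟩, (hZ τ hτ).2⟩
  choose u hu using hcut
  have hev : ∀ mu : E, ∃ e : D.HU, e ≠ 0 ∧ D.InKer (mu : ℝ) e := by
    rintro ⟨mu, hmu⟩
    obtain ⟨e, he0, he⟩ := ((hE mu).1 hmu).2.2
    exact ⟨e, he0, inKer_iff.2 he⟩
  choose e he0 he using hev
  let v : Z' → D.HU := fun τ => ⟨u τ, h.cut_mem (hu τ)⟩
  let Λ : D.HU →ₗ[ℂ] (E → ℂ) := LinearMap.pi fun mu =>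
    { toFun := fun z => D.T ξ z (e mu)
      map_add' := fun a b => by rw [map_add, add_apply]
      map_smul' := fun c a => by rw [map_smul, smul_apply]; rfl }
  have hker : LinearMap.ker (Λ.comp (Fintype.linearCombination ℂ v)) ≠ ⊥ := by
    refine LinearMap.ker_ne_bot_of_finrank_lt ?_
    simp only [Module.finrank_fintype_fun_eq_card, Fintype.card_coe]
    rw [hZ', Finset.card_insert_of_notMem hnot]
    omega
  obtain ⟨c, hc, hc0⟩ := Submodule.exists_mem_ne_zero_of_ne_bot hker
  set z := Fintype.linearCombination ℂ v c with hz
  have hze : ∀ mu, D.form ξ z (e mu) = 0 := fun mu => congrFun (LinearMap.mem_ker.1 hc) mu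
  have hzform : D.form lam z z = 0 := by
    rw [← T_apply]
    have hs : D.T lam z = ∑ i, c i • D.T lam (v i) := by
      rw [hz, Fintype.linearCombination_apply, map_sum]
      simp_rw [map_smul]
    rw [hs, sum_apply]
    refine Finset.sum_eq_zero fun i _ => ?_
    rw [smul_apply, hz, Fintype.linearCombination_apply, map_sum]
    rw [Finset.sum_eq_zero, smul_zero]
    intro j _
    have : D.T lam (v i) (v j) = 0 := h.form_cut (hu i) (hu j)
    rw [map_smulₛₗ, this, smul_zero]
  have hzval : ∀ s ∈ Icc (0 : ℝ) 1,
      (z : W12) s = ∑ i, c i * (((Ioi (i : ℝ)).indicator f s : ℝ) : ℂ) := by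
    intro s hs
    have e1 : W12.eval s (z : W12) = ∑ i, c i * W12.eval s (u i) := by
      rw [hz, Fintype.linearCombination_apply]
      simp [v]
    rw [← W12.eval_apply, e1]
    refine Finset.sum_congr rfl fun i _ => ?_
    rw [W12.eval_apply, (hu i).val s hs]
  have hz0 : z ≠ 0 := by
    intro h0
    have hS : (Finset.univ.filter fun i => c i ≠ 0).Nonempty := by
      obtain ⟨i, hi⟩ := Function.ne_iff.1 hc0
      exact ⟨i, by simpa using hi⟩
    -- Take the least cutting point with nonzero coefficient. Just to the right of it (of `0`, if it
    -- is `-1`) only its own term survives, and `f ≠ 0` there.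
    obtain ⟨i, hi, hmin⟩ := Finset.exists_min_image _ (fun i : Z' => (i : ℝ)) hS
    have hfin : ({t | t ∈ Icc (0 : ℝ) 1 ∧ f t = 0} ∪ ((Z' : Set ℝ) ∪ {1})).Finite :=
      (h.finite_zeros hne).union (Z'.finite_toSet.union (finite_singleton 1))
    obtain ⟨s, hs, hsW⟩ := exists_gt_notMem hfin (max (i : ℝ) 0)
    have hZ'1 : ∀ j ∈ Z', j < 1 ∧ (j ≠ -1 → 0 < j) ∧ -1 ≤ j := by
      intro j hj
      rcases Finset.mem_insert.1 hj with rfl | hj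
      · norm_num
      · have := (hZ j hj).1
        exact ⟨this.2, fun _ => this.1, by linarith [this.1]⟩
    have hs0 : 0 < s := (le_max_right _ _).trans_lt hs
    have his : (i : ℝ) < s := (le_max_left _ _).trans_lt hs
    have hs1 : s < 1 := hsW 1 (by simp) (max_lt (hZ'1 i i.2).1 one_pos)
    have hsI : s ∈ Icc (0 : ℝ) 1 := ⟨hs0.le, hs1.le⟩
    have hfs : f s ≠ 0 := fun hf => lt_irrefl s (hsW s (Or.inl ⟨hsI, hf⟩) hs)
    have hval := hzval s hsI
    rw [h0, Finset.sum_eq_single i, indicator_of_mem (show s ∈ Ioi (i : ℝ) from his)] at hval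
    · have hzero : ((0 : D.HU) : W12) s = 0 := (W12.eval s).map_zero
      rw [hzero] at hval
      rcases mul_eq_zero.1 hval.symm with h1 | h1
      · exact (Finset.mem_filter.1 hi).2 h1
      · exact hfs (by exact_mod_cast h1)
    · intro j _ hji
      by_cases hcj : c j = 0
      · rw [hcj, zero_mul]
      have hle : (i : ℝ) ≤ j := hmin j (by simpa using hcj)
      have hlt : (i : ℝ) < j := lt_of_le_of_ne hle fun h => hji (Subtype.ext h.symm)
      have hj0 : 0 < (j : ℝ) := (hZ'1 j j.2).2.1 fun hj => by
        have := (hZ'1 i i.2).2.2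
        linarith
      have hsj := hsW j (Or.inr (Or.inl j.2)) (max_lt hlt hj0)
      rw [indicator_of_notMem (show s ∉ Ioi (j : ℝ) from not_lt.2 hsj.le)]
      simp
    · exact fun h => absurd (Finset.mem_univ i) h
  -- The new eigenvector `x` belongs to some `mu ∈ E`. It is then a nonzero multiple of the chosen
  -- eigenvector for `mu` and yet orthogonal to it at `ξ`, against positivity.
  obtain ⟨mu, hmu1, hmu2, x, hx0, hx, hxe⟩ := exists_inKer hξ hlam (fun mu : E => (mu : ℝ))
    Subtype.val_injective e he he0 (fun mu => ((hE mu).1 mu.2).1) hz0 hze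
    (by rw [hzform, Complex.zero_re])
  have hmuE : mu ∈ E := (hE mu).2 ⟨hmu1, hmu2, x, hx0, inKer_iff.1 hx⟩
  obtain ⟨a, ha⟩ := (he ⟨mu, hmuE⟩).proportional (he0 _) hx
  have h1 : D.T ξ x (e ⟨mu, hmuE⟩) = 0 := hxe ⟨mu, hmuE⟩
  rw [ha, map_smul, smul_apply, smul_eq_mul, T_apply] at h1
  have h2 := isPositiveAt_iff.1 hξ _ (he0 ⟨mu, hmuE⟩)
  rcases mul_eq_zero.1 h1 with h3 | h3
  · rw [h3, zero_smul] at ha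
    exact hx0 ha
  · rw [h3, Complex.zero_re] at h2
    exact lt_irrefl _ h2

/-- Interior zeros of a solution are at least as many as eigenvalues before `lam`. -/
lemma RealKer.card_le_zeros (h : D.RealKer lam y f g) (hne : y ≠ 0) {ξ : ℝ}
    (hξ : D.IsPositiveAt ξ) (Z : Finset ℝ) (hZ : ∀ t ∈ Ioo (0 : ℝ) 1, f t = 0 → t ∈ Z)
    (E : Finset ℝ) (hE : ∀ mu ∈ E, ξ < mu ∧ mu < lam ∧ D.IsEigenvalue (mu : ℝ)) :
    E.card ≤ Z.card := by
  have hev : ∀ mu : E, ∃ e : D.HU, e ≠ 0 ∧ D.InKer (mu : ℝ) e := by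
    rintro ⟨mu, hmu⟩
    obtain ⟨e, he0, he⟩ := (hE mu hmu).2.2
    exact ⟨e, he0, inKer_iff.2 he⟩
  choose e he0 he using hev
  let L : D.HU →L[ℂ] (Z → ℂ) :=
    ContinuousLinearMap.pi fun t => (W12.eval (t : ℝ)).comp D.HU.subtypeL
  have := card_le_of_form_nonneg hξ (fun mu : E => (mu : ℝ)) Subtype.val_injective e he he0
    (fun mu => (hE mu mu.2).1) (fun mu => (hE mu mu.2).2.1) L.toLinearMap fun z hz => ?_
  · simpa using this
  -- A zero at an endpoint forces the Dirichlet condition there, which `z` satisfies as well; so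
  -- endpoints need no functional.
  refine h.form_nonneg hne z.2 fun t ht hft => ?_
  have hzU := D.mem_HU.1 z.2
  rcases eq_or_lt_of_le ht.1 with rfl | h0
  · exact hzU.1 (h.dirichlet_zero hne hft)
  rcases eq_or_lt_of_le ht.2 with rfl | h1
  · exact hzU.2 (h.dirichlet_one hne hft)
  exact congrFun hz ⟨t, hZ t ⟨h0, h1⟩ hft⟩

/-- By `exists_garding` the form is nonnegative on the kernel of `N + 1` point evaluations, which
bounds the count by `N + 1`. It is taken at `lam + 1` because the comparison needs eigenvalues
strictly below the parameter. -/
lemma finite_eigenvalues {ξ : ℝ} (hξ : D.IsPositiveAt ξ) (lam : ℝ) :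
    {mu : ℝ | ξ < mu ∧ mu ≤ lam ∧ D.IsEigenvalue mu}.Finite := by
  by_contra hinf
  obtain ⟨N, L, c, hc, C, hL⟩ := D.exists_garding (lam + 1)
  obtain ⟨E, hE, hcard⟩ := Set.Infinite.exists_subset_card_eq hinf (N + 2)
  have hev : ∀ mu : E, ∃ e : D.HU, e ≠ 0 ∧ D.InKer (mu : ℝ) e := by
    rintro ⟨mu, hmu⟩
    obtain ⟨e, he0, he⟩ := (hE hmu).2.2
    exact ⟨e, he0, inKer_iff.2 he⟩
  choose e he0 he using hev
  have := card_le_of_form_nonneg (lam := lam + 1) hξ (fun mu : E => (mu : ℝ))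
    Subtype.val_injective e he he0 (fun mu => (hE mu.2).1)
    (fun mu => by have := (hE mu.2).2.1; linarith) L.toLinearMap fun z hz => ?_
  · simp only [Fintype.card_coe, Fintype.card_fin, hcard] at this
    omega
  have h1 := hL z
  have h2 : L z = 0 := hz
  rw [h2] at h1
  refine le_trans ?_ h1
  simp only [norm_zero]
  have := sq_nonneg ‖z‖
  simp; positivity

/-- The eigenvalues are real and different from `ξ`. -/
lemma IsEigenvalue.exists_real {ξ : ℝ} (hξ : D.IsPositiveAt ξ) {l : ℂ}
    (hl : D.IsEigenvalue l) : ∃ mu : ℝ, l = mu ∧ mu ≠ ξ := by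
  obtain ⟨e, he0, he⟩ := hl
  have h1 := inKer_iff.2 he e
  have h2 := isPositiveAt_iff.1 hξ e he0
  have h3 : D.form ξ (e : W12) e = ((D.form ξ (e : W12) e).re : ℂ) :=
    Complex.ext (by simp) (by simp [D.form_self_im])
  -- The equation for `e` tested with `e` reads `F + (ξ - l) * weight = 0` with `F > 0` and a real
  -- weight, so `l = ξ + F / weight`.
  rw [D.form_sub_form ξ, h3, r_mul_cconj] at h1
  set F := (D.form ξ (e : W12) e).re
  have hw : D.weight e ≠ 0 := by
    intro h0
    rw [h0, Complex.ofReal_zero, mul_zero, add_zero] at h1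
    exact h2.ne' (by exact_mod_cast h1)
  refine ⟨ξ + F / D.weight e, ?_, ?_⟩
  · have hw' : (D.weight e : ℂ) ≠ 0 := by exact_mod_cast hw
    push_cast
    field_simp
    linear_combination -h1
  · have : F / D.weight e ≠ 0 := div_ne_zero h2.ne' hw
    intro h0
    exact this (by linarith)

/-- The oscillation theorem for the eigenvalues to the right of `ξ`. -/
lemma oscillation_right {ξ : ℝ} (hξ : D.IsPositiveAt ξ) {n : ℕ} {lam : ℝ}
    (hlam : D.IsEigenvalueRight ξ n lam) {y : D.HU} (hy : D.IsEigenfunction lam y)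
    (hreal : ∀ t ∈ Icc (0 : ℝ) 1, ((y : W12) t).im = 0) :
    {t : ℝ | t ∈ Ioo (0 : ℝ) 1 ∧ (y : W12) t = 0}.encard = ((n - 1 : ℕ) : ℕ∞) ∧
      ∀ t ∈ Ioo (0 : ℝ) 1, (y : W12) t = 0 → ChangesSignAt (fun s => ((y : W12) s).re) t := by
  obtain ⟨hlt, hev, hn⟩ := hlam
  have hrep := RealRep.of_real hreal
  have hker : D.RealKer lam y _ _ :=
    ⟨hrep, y.2, fun z hz => (inKer_iff.2 hy.2) ⟨z, hz⟩⟩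
  have hne : (y : W12) ≠ 0 := fun h => hy.1 (Subtype.ext h)
  have hre : ∀ t ∈ Icc (0 : ℝ) 1, ((y : W12) t = 0 ↔ ((y : W12) t).re = 0) := by
    intro t ht
    exact ⟨fun h => by rw [h, Complex.zero_re], fun h => Complex.ext h (hreal t ht)⟩
  refine ⟨?_, fun t ht h0 => hker.changesSignAt hne ht ((hre t ⟨ht.1.le, ht.2.le⟩).1 h0)⟩
  have hfinZ : {t : ℝ | t ∈ Ioo (0 : ℝ) 1 ∧ (y : W12) t = 0}.Finite := by
    refine (hker.finite_zeros hne).subset fun t ht => ?_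
    have htI : t ∈ Icc (0 : ℝ) 1 := ⟨ht.1.1.le, ht.1.2.le⟩
    exact ⟨htI, (hre t htI).1 ht.2⟩
  have hfinE := finite_eigenvalues hξ lam
  have hmemZ : ∀ t, t ∈ hfinZ.toFinset ↔ t ∈ Ioo (0 : ℝ) 1 ∧ ((y : W12) t).re = 0 := by
    intro t
    rw [Set.Finite.mem_toFinset]
    exact and_congr_right fun ht => hre t ⟨ht.1.le, ht.2.le⟩
  -- Counting the eigenvalues up to and including `lam` shows that the zeros are fewer than `n`;
  -- counting those strictly before `lam` shows that they are at least `n - 1`.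
  have hup := hker.card_zeros_lt hne hξ hlt hfinZ.toFinset (fun t ht => (hmemZ t).1 ht)
    hfinE.toFinset (fun mu => by rw [Set.Finite.mem_toFinset]; rfl)
  have hlow := hker.card_le_zeros hne hξ hfinZ.toFinset (fun t ht h0 => (hmemZ t).2 ⟨ht, h0⟩)
    (hfinE.toFinset.erase lam) (fun mu hmu => by
      rw [Finset.mem_erase, Set.Finite.mem_toFinset] at hmu
      exact ⟨hmu.2.1, lt_of_le_of_ne hmu.2.2.1 hmu.1, hmu.2.2.2⟩)
  have hlamE : lam ∈ hfinE.toFinset := by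
    rw [Set.Finite.mem_toFinset]
    exact ⟨hlt, le_rfl, hev⟩
  rw [Finset.card_erase_of_mem hlamE] at hlow
  rw [hfinE.encard_eq_coe_toFinset_card] at hn
  have hn : hfinE.toFinset.card = n := by exact_mod_cast hn
  rw [hfinZ.encard_eq_coe_toFinset_card]
  have : hfinZ.toFinset.card = n - 1 := by omega
  rw [this]

/-! ### Reflection of the spectral parameter. -/

/-- The problem with the weight `-r`. -/
def reflect (D : Problem) : Problem :=
  { D with
    r := -D.r
    r_real := fun f hf => by simp [D.r_real f hf] }

/-- Since `(-λ)(-r) = λ r`, reflection carries eigenvalues to the left of `ξ` to eigenvalues to the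
right of `-ξ`, with the same eigenfunctions. -/
lemma form_reflect (D : Problem) (lam : ℂ) (y z : W12) :
    D.reflect.form (-lam) y z = D.form lam y z := by
  have h : D.reflect.q - (-lam) • D.reflect.r = D.q - lam • D.r := by simp [reflect]
  unfold form
  rw [h]
  rfl

lemma inKer_reflect {lam : ℂ} {y : D.HU} (h : D.InKer lam y) :
    D.reflect.InKer (-lam) (⟨y, y.2⟩ : D.reflect.HU) := fun z =>
  (D.form_reflect lam y z).trans (h ⟨z, z.2⟩)

lemma isEigenvalue_reflect {lam : ℂ} (h : D.IsEigenvalue lam) :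
    D.reflect.IsEigenvalue (-lam) := by
  obtain ⟨y, hy0, hy⟩ := h
  exact ⟨⟨y, y.2⟩, fun h0 => hy0 (Subtype.ext (congrArg Subtype.val h0)),
    inKer_iff.1 (inKer_reflect (inKer_iff.2 hy))⟩

lemma reflect_reflect (D : Problem) : D.reflect.reflect = D := by
  simp [reflect]

lemma isEigenvalue_reflect_iff {lam : ℂ} :
    D.reflect.IsEigenvalue lam ↔ D.IsEigenvalue (-lam) := by
  constructor
  · intro h
    have := isEigenvalue_reflect h
    rwa [reflect_reflect] at this
  · intro h
    have := isEigenvalue_reflect h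
    rwa [neg_neg] at this

lemma isPositiveAt_reflect {ξ : ℝ} (h : D.IsPositiveAt ξ) : D.reflect.IsPositiveAt (-ξ) := by
  rw [isPositiveAt_iff] at h ⊢
  intro y hy
  have := h (⟨y, y.2⟩ : D.HU) fun h0 => hy (Subtype.ext (congrArg Subtype.val h0))
  rwa [← D.form_reflect, ← Complex.ofReal_neg] at this

lemma neg_image_eigenvalues (ξ lam : ℝ) :
    {mu : ℝ | -ξ < mu ∧ mu ≤ -lam ∧ D.reflect.IsEigenvalue mu} =
      Neg.neg '' {mu : ℝ | lam ≤ mu ∧ mu < ξ ∧ D.IsEigenvalue mu} := by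
  ext mu
  rw [Set.image_neg_eq_neg, Set.mem_neg]
  change _ ∧ _ ∧ _ ↔ _ ∧ _ ∧ _
  rw [isEigenvalue_reflect_iff, ← Complex.ofReal_neg]
  constructor
  · rintro ⟨h1, h2, h3⟩
    exact ⟨by linarith, by linarith, h3⟩
  · rintro ⟨h1, h2, h3⟩
    exact ⟨by linarith, by linarith, h3⟩

lemma IsEigenvalueLeft.reflect {ξ lam : ℝ} {n : ℕ} (h : D.IsEigenvalueLeft ξ n lam) :
    D.reflect.IsEigenvalueRight (-ξ) n (-lam) := by
  obtain ⟨h1, h2, h3⟩ := h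
  refine ⟨by linarith, ?_, ?_⟩
  · rw [Complex.ofReal_neg]
    exact isEigenvalue_reflect h2
  · rw [neg_image_eigenvalues, neg_injective.encard_image, h3]

lemma exists_isEigenvalueRight {ξ lam : ℝ} (hξ : D.IsPositiveAt ξ) (hlam : ξ < lam)
    (hev : D.IsEigenvalue lam) : ∃ n : ℕ, 1 ≤ n ∧ D.IsEigenvalueRight ξ n lam := by
  have hfin := finite_eigenvalues hξ lam
  refine ⟨hfin.toFinset.card, ?_, hlam, hev, hfin.encard_eq_coe_toFinset_card⟩
  refine Finset.card_pos.2 ⟨lam, ?_⟩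
  rw [Set.Finite.mem_toFinset]
  exact ⟨hlam, le_rfl, hev⟩

lemma exists_isEigenvalueLeft {ξ lam : ℝ} (hξ : D.IsPositiveAt ξ) (hlam : lam < ξ)
    (hev : D.IsEigenvalue lam) : ∃ n : ℕ, 1 ≤ n ∧ D.IsEigenvalueLeft ξ n lam := by
  have hev' : D.reflect.IsEigenvalue ((-lam : ℝ) : ℂ) := by
    rw [Complex.ofReal_neg]
    exact isEigenvalue_reflect hev
  obtain ⟨n, hn, -, -, h⟩ :=
    exists_isEigenvalueRight (isPositiveAt_reflect hξ) (neg_lt_neg hlam) hev'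
  rw [neg_image_eigenvalues, neg_injective.encard_image] at h
  exact ⟨n, hn, hlam, hev, h⟩

end Problem

end SturmLiouville

end

theorem mainTheorem2 (D : SturmLiouville.Problem) (ξ : ℝ) (hξ : D.IsPositiveAt ξ) :
    -- the numbering `λ_n` exhausts the eigenvalues: all of them are real, and each is some `λ_{±n}`
    (∀ lam : ℂ, D.IsEigenvalue lam → ∃ (μ : ℝ) (n : ℕ), lam = μ ∧ 1 ≤ n ∧
      (D.IsEigenvalueRight ξ n μ ∨ D.IsEigenvalueLeft ξ n μ)) ∧
    -- a real eigenfunction for `λ_n` has exactly `n - 1` zeros in `(0,1)`, all with a sign change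
    (∀ (n : ℕ) (lam : ℝ), 1 ≤ n → D.IsEigenvalueRight ξ n lam →
      ∀ y : D.HU, D.IsEigenfunction lam y →
        (∀ t ∈ Set.Icc (0 : ℝ) 1, ((y : SturmLiouville.W12) t).im = 0) →
        {t : ℝ | t ∈ Set.Ioo (0 : ℝ) 1 ∧ (y : SturmLiouville.W12) t = 0}.encard
            = ((n - 1 : ℕ) : ℕ∞) ∧
          ∀ t ∈ Set.Ioo (0 : ℝ) 1, (y : SturmLiouville.W12) t = 0 →
            SturmLiouville.ChangesSignAt (fun s => ((y : SturmLiouville.W12) s).re) t) ∧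
    -- the same for `λ_{-n}`
    (∀ (n : ℕ) (lam : ℝ), 1 ≤ n → D.IsEigenvalueLeft ξ n lam →
      ∀ y : D.HU, D.IsEigenfunction lam y →
        (∀ t ∈ Set.Icc (0 : ℝ) 1, ((y : SturmLiouville.W12) t).im = 0) →
        {t : ℝ | t ∈ Set.Ioo (0 : ℝ) 1 ∧ (y : SturmLiouville.W12) t = 0}.encard
            = ((n - 1 : ℕ) : ℕ∞) ∧
          ∀ t ∈ Set.Ioo (0 : ℝ) 1, (y : SturmLiouville.W12) t = 0 →
            SturmLiouville.ChangesSignAt (fun s => ((y : SturmLiouville.W12) s).re) t) := by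
  refine ⟨fun lam hlam => ?_, fun n lam _ hlam y hy hreal => ?_, fun n lam _ hlam y hy hreal => ?_⟩
  · obtain ⟨μ, rfl, hμ⟩ := hlam.exists_real hξ
    rcases lt_or_gt_of_ne hμ with hlt | hgt
    · obtain ⟨n, hn, h⟩ := SturmLiouville.Problem.exists_isEigenvalueLeft hξ hlt hlam
      exact ⟨μ, n, rfl, hn, Or.inr h⟩
    · obtain ⟨n, hn, h⟩ := SturmLiouville.Problem.exists_isEigenvalueRight hξ hgt hlam
      exact ⟨μ, n, rfl, hn, Or.inl h⟩
  · exact SturmLiouville.Problem.oscillation_right hξ hlam hy hreal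
  · refine SturmLiouville.Problem.oscillation_right
      (SturmLiouville.Problem.isPositiveAt_reflect hξ) hlam.reflect
      (y := (⟨y, y.2⟩ : D.reflect.HU)) ⟨fun h0 => hy.1 (Subtype.ext (congrArg Subtype.val h0)), ?_⟩
      hreal
    rw [Complex.ofReal_neg]
    exact SturmLiouville.Problem.inKer_iff.1
      (SturmLiouville.Problem.inKer_reflect (SturmLiouville.Problem.inKer_iff.2 hy.2))
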